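/- **Setting.** Let $K,T\ge 1$ be integers with $TK\ge 2$, let $L,\sigma>0$, and let $f_a:[0,1]\to[0,1]$, $a\in[K]$, be $L$-Lipschitz. In trials $t=1,\dots,T$ a context $x_t\sim U(0,1)$ is revealed, an arm $a_t\in[K]$ is played, and the reward $\pi_t=f_{a_t}(x_t)+\epsilon_t$ is observed, where $\epsilon_t\sim N(0,\sigma^2)$ and all $x_t,\epsilon_t$ are independent. Put $f^*(x)=\max_a f_a(x)$ and $R(T)=\sum_{t=1}^T\big(f^*(x_t)-f_{a_t}(x_t)\big)$. **Algorithm (Approx-Zooming; it knows $K,L,T,\sigma$).** A ball is a set $\rho=[c_0(\rho),c_1(\rho)]\times\mathcal A(\rho)$ with $\mathcal A(\rho)\subseteq[K]$, of width $\Delta(\rho)=c_1(\rho)-c_0(\rho)$. The algorithm keeps a set $\mathcal P$ of active balls, initially empty, and a set $\mathcal P^*$ of flagged balls, initially $\{[0,1]\times[K]\}$. Let $n_t(\rho)$ be the number of trials $s<t$ with $\rho_s=\rho$, let $\mu_t(\rho)$ be the average reward in these trials, and let $UCB_t(\rho)=\mu_t(\rho)+2L\Delta(\rho)+\sqrt{6\sigma^2\ln(T)/n_t(\rho)}$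 ($=\infty$ if $n_t(\rho)=0$). For a ball $\rho$ let $k=\lceil 5431\,\sigma^2\ln(T|\mathcal A(\rho)|)/(L^2\Delta(\rho)^2)\rceil$. An arm $a\in\mathcal A(\rho)$ has *sufficient data* if, among the trials in which $\rho$ was selected while flagged and $a$ was played, at least $k$ have their context in each of the 64 equal closed subintervals of $[c_0(\rho),c_1(\rho)]$. In trial $t$: * If a flagged ball's context interval contains $x_t$, let $\rho_t$ be a widest such ball, and play the smallest arm $a_t\in\mathcal A(\rho_t)$ without sufficient data. If afterwards all arms of $\rho_t$ have sufficient data, remove $\rho_t$ from $\mathcal P^*$ and add to $\mathcal P$ the balls into which it is subpartitioned. * Otherwise let $\rho_t$ maximize $UCB_t$ among the active balls whose context interval contains $x_t$, and play an arm $a_t\in\mathcal A(\rho_t)$ (e.g. round robin). If $n_t(\rho_t)>6\sigma^2\ln(T)/(L^2\Delta(\rho_t)^2)$, move $\rho_t$ from $\mathcal P$ to $\mathcal P^*$. *Subpartitioning $\rho$.* For each half $[u,v]$ of $[c_0(\rho),c_1(\rho)]$ go through the arms of $\mathcal A(\rho)$ in some order, starting with no cluster centers. If $\hat{\mathcal D}_u^v(a,y)>\frac3{16}L(v-u)$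 for all current centers $y$, then $a$ becomes a center with its own cluster; otherwise $a$ joins the cluster of a closest center. Each resulting cluster $\mathcal S$ gives the new ball $[u,v]\times\mathcal S$. Here $$\hat{\mathcal D}_u^v(a,a')=\Big(\tfrac1{200}\sum_{i=1}^{200}\big(\hat f_a(z_i)-\hat f_{a'}(z_i)\big)^2-\tfrac{2\sigma^2}{k}\Big)^{1/2},\qquad z_i=(1-\tfrac i{200})u+\tfrac i{200}v,$$ (with $0$ as the root of a negative number), and $\hat f_a(x)$ is $\frac1k$ times the sum of the rewards of the $k$ samples of arm $a$, collected while $\rho$ was flagged, with contexts nearest to $x$. The order of clustering, the rule for arms in active balls (a fixed function of the ball and of the number of its previous selections) and the tie-breaking rules (fixed functions of the set of tied candidates) are arbitrary. **Quantities.** Let $\kappa(x)=f^*(x)-\max_{a}f_a(x)\mathbf 1\{f_a(x)\ne f^*(x)\}$, $w_i(\ell)=[(\ell-1)2^{-i},\ell2^{-i}]$, and $$M_i=\sum_{\ell=1}^{2^i}\mathbf 1\big\{\exists x\in w_i(\ell):\kappa(x)\le 20L2^{-i}\big\}\ \#\big\{a\in[K]: f^*(2^{-i}\ell)-f_a(2^{-i}\ell)\le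 22L2^{-i}\big\}.$$ **Theorem.** There is an absolute constant $C>0$ such that in every such setting $R(T)$ is integrable and $$\mathbb E[R(T)]\le C\max\Big\{1,\frac{L^2}{\sigma^2\ln(TK)}\Big\}\Big(\frac{\sigma^2K\ln(TK)}{L^2}+\inf_{i_{\max}\ge1}\Big(LT2^{-i_{\max}}+\sum_{i=1}^{i_{\max}-1}\frac{\sigma^2}{L}M_i2^i\ln(TK)\Big)\Big).$$ In particular, the bound holds with the absolute constant $C$ alone as soon as $\sigma^2\ln(TK)\ge L^2$, i.e. for all large $T$. -/

import Mathlib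

open MeasureTheory ProbabilityTheory

namespace ApproxZooming

noncomputable section

/-- A ball `[c₀, c₁] × arms` of the context-arm space. The algorithm only ever halves context
intervals, so `[c₀, c₁] = [pos / 2 ^ level, (pos + 1) / 2 ^ level]`. -/
structure Ball (K : ℕ) where
  level : ℕ
  pos : ℕ
  arms : Finset (Fin K)
  deriving DecidableEq

namespace Ball

variable {K : ℕ}

/-- Left end of the context interval. -/
def c0 (ρ : Ball K) : ℝ := (ρ.pos : ℝ) / 2 ^ ρ.level

/-- Right end of the context interval. -/
def c1 (ρ : Ball K) : ℝ := ((ρ.pos : ℝ) + 1) / 2 ^ ρ.level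

/-- Width `Δ(ρ) = c₁(ρ) - c₀(ρ)` of the context interval. -/
def width (ρ : Ball K) : ℝ := ρ.c1 - ρ.c0

/-- The whole context-arm space `[0, 1] × [K]`. -/
def whole (K : ℕ) : Ball K := ⟨0, 0, Finset.univ⟩

end Ball

/-- What is recorded in one trial: the selected ball `ρ_s`, the arm `a_s`, the context `x_s`, the
reward `π_s`, and whether the ball was flagged when it was selected (equivalently, whether
`s > τ_f(ρ_s)`). -/
structure Trial (K : ℕ) where
  ball : Ball K
  arm : Fin K
  ctx : ℝ
  reward : ℝ
  inFlagged : Bool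

/-- The state of the algorithm between two trials: the active balls `𝒫`, the flagged balls `𝒫*`,
and the list of the past trials (the last one first). -/
structure State (K : ℕ) where
  active : Finset (Ball K)
  flagged : Finset (Ball K)
  hist : List (Trial K)

/-- Initially the whole space is flagged and nothing is active. -/
def State.init (K : ℕ) : State K := ⟨∅, {Ball.whole K}, []⟩

/-- The parameters known to the algorithm: horizon, Lipschitz constant, noise level. -/
structure Params where
  T : ℕ
  L : ℝ
  σ : ℝ

/-- The choices which the algorithm leaves open. -/
structure Rules (K : ℕ) where
  /-- how ties between maximizing balls are broken -/
  pickBall : Finset (Ball K) → Ball K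
  pickBall_mem : ∀ S, S.Nonempty → pickBall S ∈ S
  /-- the arm played when `ρ` is selected by the UCB rule for the `(n + 1)`-st time
  (for example round robin) -/
  ucbArm : Ball K → ℕ → Fin K
  ucbArm_mem : ∀ ρ n, ρ.arms.Nonempty → ucbArm ρ n ∈ ρ.arms
  /-- the order in which the arms of a ball are clustered -/
  order : Ball K → List (Fin K)
  order_nodup : ∀ ρ, (order ρ).Nodup
  mem_order : ∀ ρ a, a ∈ order ρ ↔ a ∈ ρ.arms
  /-- how ties between closest cluster centers are broken -/
  pickCenter : Finset (Fin K) → Fin K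
  pickCenter_mem : ∀ S, S.Nonempty → pickCenter S ∈ S

variable {K : ℕ}

/-- `n_t(ρ)`: the number of past trials in which `ρ` was selected. -/
def plays (h : List (Trial K)) (ρ : Ball K) : ℕ :=
  (h.filter (fun s => s.ball = ρ)).length

/-- `μ_t(ρ)`: the average of the rewards observed from `ρ`. -/
def meanReward (h : List (Trial K)) (ρ : Ball K) : ℝ :=
  ((h.filter (fun s => s.ball = ρ)).map Trial.reward).sum / plays h ρ

/-- `UCB_t(ρ) = μ_t(ρ) + 2 L Δ(ρ) + √(6 σ² ln T / n_t(ρ))`, which is `∞` if `n_t(ρ) = 0`. -/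
def ucb (p : Params) (h : List (Trial K)) (ρ : Ball K) : EReal :=
  if plays h ρ = 0 then ⊤
  else ((meanReward h ρ + 2 * p.L * ρ.width
    + Real.sqrt (6 * p.σ ^ 2 * Real.log p.T / plays h ρ) : ℝ) : EReal)

/-- The number `k` of nearest neighbours: `5431 σ² ln(T |𝒜(ρ)|) / (L² Δ(ρ)²)`, rounded up. -/
def numNbr (p : Params) (ρ : Ball K) : ℕ :=
  ⌈5431 * p.σ ^ 2 * Real.log ((p.T : ℝ) * ρ.arms.card) / (p.L ^ 2 * ρ.width ^ 2)⌉₊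

/-- The pairs `(x_s, π_s)` collected for arm `a` in `ρ` since `ρ` was flagged. -/
def flaggedData (h : List (Trial K)) (ρ : Ball K) (a : Fin K) : List (ℝ × ℝ) :=
  (h.filter (fun s => s.ball = ρ ∧ s.arm = a ∧ s.inFlagged = true)).map
    (fun s => (s.ctx, s.reward))

/-- `SuffData(a)`: each of the 64 equal parts of the context interval of `ρ` has received
at least `k` of the samples of arm `a` in the flagged phase. -/
def SuffData (p : Params) (h : List (Trial K)) (ρ : Ball K) (a : Fin K) : Prop :=
  ∀ i ∈ Finset.Icc (1 : ℕ) 64, numNbr p ρ ≤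
    ((flaggedData h ρ a).filter (fun d =>
      ρ.c0 + ((i : ℝ) - 1) * ρ.width / 64 ≤ d.1 ∧ d.1 ≤ ρ.c0 + (i : ℝ) * ρ.width / 64)).length

instance (p : Params) (h : List (Trial K)) (ρ : Ball K) (a : Fin K) :
    Decidable (SuffData p h ρ a) := Classical.propDecidable _

/-- The `k`-nearest-neighbour estimate at `x` from the samples `D`. A sample `d` is a `k`-nearest
neighbour of `x` if at most `k` samples are at most as far from `x` as `d` is. -/
def knn (k : ℕ) (D : List (ℝ × ℝ)) (x : ℝ) : ℝ :=
  ((D.filter (fun d => (D.filter (fun e => |e.1 - x| ≤ |d.1 - x|)).length ≤ k)).map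
    Prod.snd).sum / k

/-- The estimated distance `D̂_u^v(a, a')` between two arms of `ρ`. -/
def estDist (p : Params) (h : List (Trial K)) (ρ : Ball K) (u v : ℝ) (a a' : Fin K) : ℝ :=
  Real.sqrt ((1 / 200) * ∑ i ∈ Finset.Icc (1 : ℕ) 200,
      (knn (numNbr p ρ) (flaggedData h ρ a) ((1 - (i : ℝ) / 200) * u + (i : ℝ) / 200 * v)
        - knn (numNbr p ρ) (flaggedData h ρ a') ((1 - (i : ℝ) / 200) * u + (i : ℝ) / 200 * v)) ^ 2
    - 2 * p.σ ^ 2 / numNbr p ρ)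

/-- A clustering: the set of centers, and the cluster of each center. -/
structure Clustering (K : ℕ) where
  centers : Finset (Fin K)
  members : Fin K → Finset (Fin K)

/-- Process one arm `a`: it becomes a new center if its distance `d a y` to every center `y`
exceeds `thr`, and otherwise it joins the cluster of a closest center. -/
def Clustering.add (R : Rules K) (d : Fin K → Fin K → ℝ) (thr : ℝ)
    (c : Clustering K) (a : Fin K) : Clustering K :=
  if ∀ y ∈ c.centers, thr < d a y then
    ⟨insert a c.centers, Function.update c.members a {a}⟩
  else
    let y := R.pickCenter (c.centers.filter (fun y => ∀ y' ∈ c.centers, d a y ≤ d a y'))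
    ⟨c.centers, Function.update c.members y (insert a (c.members y))⟩

/-- The clusters formed, for the half `j` (`0` = left, `1` = right) of the context interval of
`ρ`, from the data in `h`, as new balls. -/
def halfPartition (p : Params) (R : Rules K) (h : List (Trial K)) (ρ : Ball K) (j : Fin 2) :
    Finset (Ball K) :=
  let u := ρ.c0 + ρ.width * (j : ℕ) / 2
  let v := ρ.c0 + ρ.width * (1 + (j : ℕ)) / 2
  let c := (R.order ρ).foldl
    (Clustering.add R (estDist p h ρ u v) (3 / 16 * p.L * (v - u))) ⟨∅, fun _ => ∅⟩
  c.centers.image (fun y => ⟨ρ.level + 1, 2 * ρ.pos + j, c.members y⟩)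

/-- The balls into which `ρ` is partitioned. -/
def subPartition (p : Params) (R : Rules K) (h : List (Trial K)) (ρ : Ball K) :
    Finset (Ball K) :=
  halfPartition p R h ρ 0 ∪ halfPartition p R h ρ 1

/-- The balls of `S` whose context interval contains `x`. -/
def containing (S : Finset (Ball K)) (x : ℝ) : Finset (Ball K) :=
  S.filter (fun ρ => ρ.c0 ≤ x ∧ x ≤ ρ.c1)

/-- Some flagged ball contains the context `x`. -/
def flaggedPhase (st : State K) (x : ℝ) : Prop := (containing st.flagged x).Nonempty

instance (st : State K) (x : ℝ) : Decidable (flaggedPhase st x) := Classical.propDecidable _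

/-- The ball `ρ_t` selected in state `st` at context `x`: a widest flagged ball containing `x`
if there is one, and an active ball containing `x` with maximal UCB otherwise. -/
def selectBall (p : Params) (R : Rules K) (st : State K) (x : ℝ) : Ball K :=
  if flaggedPhase st x then
    R.pickBall ((containing st.flagged x).filter
      (fun ρ => ∀ ρ' ∈ containing st.flagged x, ρ'.width ≤ ρ.width))
  else
    R.pickBall ((containing st.active x).filter
      (fun ρ => ∀ ρ' ∈ containing st.active x, ucb p st.hist ρ' ≤ ucb p st.hist ρ))

/-- The arm `a_t` played in state `st` at context `x`: in a flagged ball the first arm without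
sufficient data, in an active ball the one given by the rule for active balls. -/
def selectArm (p : Params) (R : Rules K) (st : State K) (x : ℝ) : Fin K :=
  let ρ := selectBall p R st x
  if flaggedPhase st x then
    if hne : (ρ.arms.filter (fun a => ¬ SuffData p st.hist ρ a)).Nonempty then
      (ρ.arms.filter (fun a => ¬ SuffData p st.hist ρ a)).min' hne
    else R.ucbArm ρ 0
  else R.ucbArm ρ (plays st.hist ρ)

/-- One trial with context `x`, in which playing arm `a` gives the reward `π a`. -/
def step (p : Params) (R : Rules K) (st : State K) (x : ℝ) (π : Fin K → ℝ) : State K :=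
  let ρ := selectBall p R st x
  let a := selectArm p R st x
  if flaggedPhase st x then
    let h : List (Trial K) := ⟨ρ, a, x, π a, true⟩ :: st.hist
    if ∀ b ∈ ρ.arms, SuffData p h ρ b then
      ⟨st.active ∪ subPartition p R h ρ, st.flagged.erase ρ, h⟩
    else ⟨st.active, st.flagged, h⟩
  else
    let h : List (Trial K) := ⟨ρ, a, x, π a, false⟩ :: st.hist
    if 6 * p.σ ^ 2 * Real.log p.T / (p.L ^ 2 * ρ.width ^ 2) < plays st.hist ρ then
      ⟨st.active.erase ρ, insert ρ st.flagged, h⟩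
    else ⟨st.active, st.flagged, h⟩

/-- The state after the first `t` trials, for mean rewards `f`, contexts `x 0, x 1, …` and noise
terms `ε 0, ε 1, …`. The reward of arm `a` in trial `t` is `f a (x t) + ε t`. -/
def run (p : Params) (R : Rules K) (f : Fin K → ℝ → ℝ) (x ε : ℕ → ℝ) : ℕ → State K
  | 0 => State.init K
  | t + 1 => step p R (run p R f x ε t) (x t) (fun a => f a (x t) + ε t)

/-- The optimal mean reward `f*(x) = max_a f_a(x)`. -/
def optReward (f : Fin K → ℝ → ℝ) (x : ℝ) : ℝ := ⨆ a, f a x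

/-- The contextual regret `R(T) = ∑_t (f*(x_t) - f_{a_t}(x_t))` along one run. -/
def regret (p : Params) (R : Rules K) (f : Fin K → ℝ → ℝ) (x ε : ℕ → ℝ) : ℝ :=
  ∑ t ∈ Finset.range p.T,
    (optReward f (x t) - f (selectArm p R (run p R f x ε t) (x t)) (x t))

/-- The gap `κ(x) = f*(x) - max_a f_a(x) 1{f_a(x) ≠ f*(x)}`. -/
def gap (f : Fin K → ℝ → ℝ) (x : ℝ) : ℝ :=
  optReward f x - ⨆ a, (if f a x ≠ optReward f x then f a x else 0)

open Classical in
/-- `M_i`: the sum, over the intervals `[(ℓ-1) 2^{-i}, ℓ 2^{-i}]`, `1 ≤ ℓ ≤ 2^i`, which contain a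
point with `κ ≤ 20 L 2^{-i}`, of the number of arms `a` with
`f*(2^{-i} ℓ) - f_a(2^{-i} ℓ) ≤ 22 L 2^{-i}`. -/
def nearOptCount (L : ℝ) (f : Fin K → ℝ → ℝ) (i : ℕ) : ℕ :=
  ∑ l ∈ Finset.Icc (1 : ℕ) (2 ^ i),
    if ∃ x ∈ Set.Icc (((l : ℝ) - 1) / 2 ^ i) ((l : ℝ) / 2 ^ i), gap f x ≤ 20 * L / 2 ^ i then
      (Finset.univ.filter (fun a : Fin K =>
        optReward f ((l : ℝ) / 2 ^ i) - f a ((l : ℝ) / 2 ^ i) ≤ 22 * L / 2 ^ i)).card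
    else 0

/-- `σ² L⁻² K ln(TK) + min_m (L T 2^{-m} + ∑_{i=1}^{m-1} σ² L⁻¹ M_i 2^i ln(TK))`,
where `m` ranges over the positive integers. -/
def regretRate (K T : ℕ) (L σ : ℝ) (f : Fin K → ℝ → ℝ) : ℝ :=
  σ ^ 2 / L ^ 2 * K * Real.log (T * K)
    + ⨅ m : ℕ+, (L * T / 2 ^ (m : ℕ)
      + ∑ i ∈ Finset.Ico 1 (m : ℕ),
          σ ^ 2 / L * nearOptCount L f i * 2 ^ i * Real.log (T * K))

end

end ApproxZooming

/-! Two things are kept apart. On a single realization (`Path`) everything is deterministic, and the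
analysis needs only that the noise is small in the averages the algorithm computes (`Path.Good`).
Probability enters to show that this fails with probability at most 802/T, each failure costing at
most T, and to bound the expected time flagged balls need to collect their data.

Deterministic part. The balls form a tree in which, for each dyadic interval and each arm, at most
one ball ever occurs (`Inv.uniq`). When a flagged ball is partitioned, the nearest-neighbour
estimates are wrong by a small multiple of LΔ. Arms of one cluster are therefore close on average
over the grid, and by the Lipschitz condition all rewards of a new ball differ by at most 2LΔ
(`tight_of_kids`). Then the UCB index of an active ball dominates every reward in it. A ball
selected after so many plays that its confidence radius is at most LΔ has only arms within 8LΔ of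
the optimum (`Good.near_of_promotes`); its children have half the width, hence the factor 16. At
level i ≥ 2 a trial thus costs at most 16L2^{-i}, and a nonzero cost forces the small gap and the
nearly optimal arm that M_i counts (`Good.loss_cases`).

Number of plays of one arm over one dyadic interval of level i. In the active phase the promotion
rule bounds it by a multiple of σ² ln(T) 4^i / L², up to rounding. In the flagged phase an arm is
played only while one of the 64 parts lacks samples. The selected flagged ball and the arm depend on
the current context only through its dyadic cell, so the context falls into the lacking part with
conditional probability 1/64. At most k such hits are possible, hence at most 64k such trials in
expectation (`sum_measure_lacks_le`). Summing cost times plays over the levels below m, and charging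
16L2^{-m} per trial on finer levels, gives the rate.

Noise. The trials entering an average are chosen adaptively. For the UCB indices an exponential
martingale handles this (`Sampling.measure_sum_ge_le`), with a union bound over the first trial of a
ball and its number of plays. For the nearest neighbours, whose choice depends on later contexts,
the decisive fact is that rewards collected by a flagged ball influence nothing before that ball is
partitioned (`Path.parts_congr`). The event that a given set S of trials is used is therefore
independent of the noise on S, and the plain Gaussian tail bound applies
(`measure_nbrsEvent_inter`). -/

namespace ApproxZooming

variable {K : ℕ}

/-! ### Dyadic context intervals -/

namespace Ball

/-- The context interval of `ρ` contains `x`. -/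
def Has (ρ : Ball K) (x : ℝ) : Prop := ρ.c0 ≤ x ∧ x ≤ ρ.c1

lemma width_eq (ρ : Ball K) : ρ.width = 1 / 2 ^ ρ.level := by
  unfold width c1 c0; ring

lemma width_pos (ρ : Ball K) : 0 < ρ.width := by
  rw [width_eq]; positivity

lemma c1_eq (ρ : Ball K) : ρ.c1 = ρ.c0 + ρ.width := by
  unfold width; ring

lemma width_le_width {ρ ρ' : Ball K} : ρ.width ≤ ρ'.width ↔ ρ'.level ≤ ρ.level := by
  rw [width_eq, width_eq, one_div_le_one_div (by positivity) (by positivity)]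
  exact pow_le_pow_iff_right₀ (by norm_num)

/-- Irrational contexts avoid the common endpoints of neighbouring closed intervals, so these behave
like the half-open cells of the floor function and each level has exactly one position. -/
lemma has_iff_floor (ρ : Ball K) {x : ℝ} (h0 : 0 ≤ x) (hx : Irrational x) :
    ρ.Has x ↔ ⌊x * 2 ^ ρ.level⌋₊ = ρ.pos := by
  have hp : (0 : ℝ) < 2 ^ ρ.level := by positivity
  rw [Nat.floor_eq_iff (by positivity), Has, c0, c1, div_le_iff₀ hp, le_div_iff₀ hp]
  refine ⟨fun h => ⟨h.1, lt_of_le_of_ne h.2 ?_⟩, fun h => ⟨h.1, h.2.le⟩⟩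
  intro he
  refine hx ⟨((ρ.pos + 1 : ℕ) : ℚ) / 2 ^ ρ.level, ?_⟩
  push_cast
  rw [← he]
  field_simp

lemma pos_lt_of_has {ρ : Ball K} {x : ℝ} (h0 : 0 ≤ x) (h1 : x ≤ 1) (hx : Irrational x)
    (h : ρ.Has x) : ρ.pos < 2 ^ ρ.level := by
  have hx1 : x < 1 := lt_of_le_of_ne h1 (fun h => by
    rw [h] at hx; exact hx ⟨1, by norm_num⟩)
  rw [has_iff_floor ρ h0 hx] at h
  rw [← h, Nat.floor_lt (by positivity)]
  push_cast
  have : (0 : ℝ) < 2 ^ ρ.level := by positivity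
  nlinarith

/-- The context interval of `ρ` contains that of `ρ'`. -/
def Covers (ρ ρ' : Ball K) : Prop :=
  ρ.level ≤ ρ'.level ∧ ρ'.pos / 2 ^ (ρ'.level - ρ.level) = ρ.pos

lemma Covers.refl (ρ : Ball K) : ρ.Covers ρ := ⟨le_rfl, by simp⟩

lemma Covers.trans {ρ ρ' ρ'' : Ball K} (h : ρ.Covers ρ') (h' : ρ'.Covers ρ'') : ρ.Covers ρ'' := by
  obtain ⟨h1, h2⟩ := h
  obtain ⟨h3, h4⟩ := h'
  refine ⟨h1.trans h3, ?_⟩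
  rw [← h2, ← h4, Nat.div_div_eq_div_mul, ← pow_add]
  congr 2
  omega

/-- Dyadic intervals with a common dyadic subinterval are nested. -/
lemma covers_of_covers {ρ ρ' ρ'' : Ball K} (h : ρ.Covers ρ'') (h' : ρ'.Covers ρ'')
    (hl : ρ.level ≤ ρ'.level) : ρ.Covers ρ' := by
  refine ⟨hl, ?_⟩
  rw [← h'.2, ← h.2, Nat.div_div_eq_div_mul, ← pow_add]
  congr 2
  have := h'.1
  omega

lemma Covers.has {ρ ρ' : Ball K} {x : ℝ} (h : ρ.Covers ρ') (h' : ρ'.Has x) : ρ.Has x := by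
  obtain ⟨hl, hp⟩ := h
  obtain ⟨d, hd⟩ := Nat.exists_eq_add_of_le hl
  have hd' : ρ'.level - ρ.level = d := by omega
  rw [hd'] at hp
  have h1 : ρ.pos * 2 ^ d ≤ ρ'.pos := by rw [← hp]; exact Nat.div_mul_le_self _ _
  have h2 : ρ'.pos + 1 ≤ (ρ.pos + 1) * 2 ^ d := by
    have := Nat.lt_div_mul_add (a := ρ'.pos) (b := 2 ^ d) (by positivity)
    rw [hp] at this
    rw [add_mul, one_mul]; exact this
  have h1' : (ρ.pos : ℝ) * 2 ^ d ≤ ρ'.pos := by exact_mod_cast h1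
  have h2' : (ρ'.pos : ℝ) + 1 ≤ (ρ.pos + 1) * 2 ^ d := by exact_mod_cast h2
  have hp : (0 : ℝ) < 2 ^ ρ.level := by positivity
  have hp2 : (0 : ℝ) < 2 ^ d := by positivity
  refine ⟨le_trans ?_ h'.1, h'.2.trans ?_⟩
  · unfold c0
    rw [hd, pow_add, div_le_div_iff₀ hp (by positivity)]
    nlinarith
  · unfold c1
    rw [hd, pow_add, div_le_div_iff₀ (by positivity) hp]
    nlinarith

/-- `ρ'` is a possible part of `ρ`: its context interval is one of the halves. -/
structure IsChild (ρ ρ' : Ball K) : Prop where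
  level : ρ'.level = ρ.level + 1
  pos : ρ'.pos / 2 = ρ.pos
  arms : ρ'.arms ⊆ ρ.arms
  nonempty : ρ'.arms.Nonempty

lemma IsChild.covers {ρ ρ' : Ball K} (h : ρ.IsChild ρ') : ρ.Covers ρ' := by
  refine ⟨by rw [h.level]; omega, ?_⟩
  rw [h.level, ← h.pos]; simp

lemma IsChild.width {ρ ρ' : Ball K} (h : ρ.IsChild ρ') : ρ'.width = ρ.width / 2 := by
  rw [width_eq, width_eq, h.level, pow_succ]; field_simp

/-- A common arm of two balls. -/
def Meets (ρ ρ' : Ball K) : Prop := ∃ a, a ∈ ρ.arms ∧ a ∈ ρ'.arms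

end Ball

/-! ### Clustering -/

section Clustering

variable (R : Rules K) (d : Fin K → Fin K → ℝ) (thr : ℝ)

/-- The properties of a clustering of the arms in `S`. -/
structure Clustering.Good (S : Finset (Fin K)) (c : Clustering K) : Prop where
  centers_sub : c.centers ⊆ S
  members_sub : ∀ y, c.members y ⊆ S
  cover : ∀ a ∈ S, ∃ y ∈ c.centers, a ∈ c.members y
  disj : ∀ y y' a, a ∈ c.members y → a ∈ c.members y' → y = y'
  center_mem : ∀ y ∈ c.centers, y ∈ c.members y
  close : ∀ y, ∀ a ∈ c.members y, a = y ∨ d a y ≤ thr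

lemma Clustering.Good.add {S : Finset (Fin K)} {c : Clustering K} (h : c.Good d thr S)
    {a : Fin K} (ha : a ∉ S) : (Clustering.add R d thr c a).Good d thr (insert a S) := by
  unfold Clustering.add
  split_ifs with hc
  · have hmem : ∀ y, y ≠ a → Function.update c.members a {a} y = c.members y :=
      fun y hy => Function.update_of_ne hy _ _
    have hself : Function.update c.members a {a} a = {a} := Function.update_self _ _ _
    constructor
    · exact Finset.insert_subset_insert _ h.centers_sub
    · intro y
      by_cases hy : y = a
      · subst hy; simp only [hself]; simp
      · simp only [hmem y hy]; exact (h.members_sub y).trans (Finset.subset_insert _ _)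
    · intro b hb
      rcases Finset.mem_insert.1 hb with rfl | hb
      · exact ⟨b, Finset.mem_insert_self _ _, by simp⟩
      · obtain ⟨y, hy, hby⟩ := h.cover b hb
        have : y ≠ a := fun e => ha (e ▸ h.centers_sub hy)
        exact ⟨y, Finset.mem_insert_of_mem hy, by simp only [hmem y this]; exact hby⟩
    · intro y y' b hb hb'
      have key : ∀ z, b ∈ Function.update c.members a {a} z → (z = a ∧ b = a) ∨
          (z ≠ a ∧ b ∈ c.members z) := by
        intro z hz
        by_cases e : z = a
        · subst e; rw [hself] at hz; exact Or.inl ⟨rfl, by simpa using hz⟩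
        · rw [hmem z e] at hz; exact Or.inr ⟨e, hz⟩
      rcases key y hb with ⟨e, e'⟩ | ⟨e, e'⟩ <;> rcases key y' hb' with ⟨f, f'⟩ | ⟨f, f'⟩
      · rw [e, f]
      · exact absurd (h.members_sub _ f') (e' ▸ ha)
      · exact absurd (h.members_sub _ e') (f' ▸ ha)
      · exact h.disj _ _ _ e' f'
    · intro y hy
      by_cases e : y = a
      · subst e; simp
      · simp only [hmem y e]; exact h.center_mem y (Finset.mem_of_mem_insert_of_ne hy e)
    · intro y b hb
      by_cases e : y = a
      · subst e; simp only [hself] at hb; exact Or.inl (by simpa using hb)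
      · simp only [hmem y e] at hb; exact h.close y b hb
  · set F := c.centers.filter (fun y => ∀ y' ∈ c.centers, d a y ≤ d a y') with hF
    push Not at hc
    obtain ⟨y1, hy1, hy1d⟩ := hc
    have hFne : F.Nonempty := by
      obtain ⟨y, hy, hym⟩ := Finset.exists_min_image c.centers (d a) ⟨y1, hy1⟩
      exact ⟨y, Finset.mem_filter.2 ⟨hy, hym⟩⟩
    have hpick := R.pickCenter_mem F hFne
    set y0 := R.pickCenter F
    rw [hF, Finset.mem_filter] at hpick
    obtain ⟨hy0, hy0m⟩ := hpick
    have hmem : ∀ y, y ≠ y0 →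
        Function.update c.members y0 (insert a (c.members y0)) y = c.members y :=
      fun y hy => Function.update_of_ne hy _ _
    have hself : Function.update c.members y0 (insert a (c.members y0)) y0
      = insert a (c.members y0) := Function.update_self _ _ _
    have key : ∀ z b, b ∈ Function.update c.members y0 (insert a (c.members y0)) z →
        (z = y0 ∧ b = a) ∨ b ∈ c.members z := by
      intro z b hz
      by_cases e : z = y0
      · rw [e, hself, Finset.mem_insert] at hz
        rcases hz with hz | hz
        · exact Or.inl ⟨e, hz⟩
        · exact Or.inr (e ▸ hz)
      · rw [hmem z e] at hz; exact Or.inr hz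
    have key' : ∀ z b, b ∈ c.members z →
        b ∈ Function.update c.members y0 (insert a (c.members y0)) z := by
      intro z b hz
      by_cases e : z = y0
      · rw [e, hself]; exact Finset.mem_insert_of_mem (e ▸ hz)
      · rw [hmem z e]; exact hz
    constructor
    · exact h.centers_sub.trans (Finset.subset_insert _ _)
    · intro y b hb
      rcases key y b hb with ⟨_, rfl⟩ | hb
      · exact Finset.mem_insert_self _ _
      · exact Finset.mem_insert_of_mem (h.members_sub y hb)
    · intro b hb
      rcases Finset.mem_insert.1 hb with rfl | hb
      · exact ⟨y0, hy0, by simp⟩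
      · obtain ⟨y, hy, hby⟩ := h.cover b hb
        exact ⟨y, hy, key' y b hby⟩
    · intro y y' b hb hb'
      rcases key y b hb with ⟨e, e'⟩ | e' <;> rcases key y' b hb' with ⟨f, f'⟩ | f'
      · rw [e, f]
      · exact absurd (h.members_sub _ f') (e' ▸ ha)
      · exact absurd (h.members_sub _ e') (f' ▸ ha)
      · exact h.disj _ _ _ e' f'
    · intro y hy
      exact key' y y (h.center_mem y hy)
    · intro y b hb
      rcases key y b hb with ⟨rfl, rfl⟩ | hb
      -- Some center `y1` lies within the threshold, and the chosen center is at least as close.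
      · exact Or.inr ((hy0m y1 hy1).trans hy1d)
      · exact h.close y b hb

lemma Clustering.Good.foldl {l : List (Fin K)} : ∀ {S : Finset (Fin K)} {c : Clustering K},
    c.Good d thr S → l.Nodup → (∀ a ∈ l, a ∉ S) →
    (l.foldl (Clustering.add R d thr) c).Good d thr (S ∪ l.toFinset) := by
  induction l with
  | nil => intro S c h _ _; simpa using h
  | cons a l ih =>
    intro S c h hl hS
    rw [List.nodup_cons] at hl
    have := ih (h.add R d thr (hS a (by simp))) hl.2 (fun b hb => by
      rw [Finset.mem_insert, not_or]
      exact ⟨fun e => hl.1 (e ▸ hb), hS b (by simp [hb])⟩)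
    rw [List.foldl_cons, List.toFinset_cons, Finset.union_insert, ← Finset.insert_union]
    exact this

lemma clustering_good (ρ : Ball K) :
    ((R.order ρ).foldl (Clustering.add R d thr) ⟨∅, fun _ => ∅⟩).Good d thr ρ.arms := by
  have h0 : (⟨∅, fun _ => ∅⟩ : Clustering K).Good d thr ∅ := by constructor <;> simp
  have := h0.foldl R d thr (R.order_nodup ρ) (by simp)
  have he : (∅ : Finset (Fin K)) ∪ (R.order ρ).toFinset = ρ.arms := by
    ext a; simp [R.mem_order]
  rwa [he] at this

end Clustering

section SubPartition

variable (p : Params) (R : Rules K) (h : List (Trial K)) (ρ : Ball K)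

lemma half_c0 (j : ℕ) (S : Finset (Fin K)) :
    Ball.c0 ⟨ρ.level + 1, 2 * ρ.pos + j, S⟩ = ρ.c0 + ρ.width * j / 2 := by
  rw [Ball.width_eq]; unfold Ball.c0; push_cast; rw [pow_succ]; field_simp

lemma half_c1 (j : ℕ) (S : Finset (Fin K)) :
    Ball.c1 ⟨ρ.level + 1, 2 * ρ.pos + j, S⟩ = ρ.c0 + ρ.width * (1 + j) / 2 := by
  rw [Ball.width_eq]; unfold Ball.c0 Ball.c1; push_cast; rw [pow_succ]; field_simp; ring

lemma half_width (j : ℕ) (S : Finset (Fin K)) :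
    Ball.width ⟨ρ.level + 1, 2 * ρ.pos + j, S⟩ = ρ.width / 2 := by
  rw [Ball.width_eq, Ball.width_eq, pow_succ]; field_simp

lemma mem_halfPartition {j : Fin 2} {ρ' : Ball K} (hm : ρ' ∈ halfPartition p R h ρ j) :
    ∃ y ∈ ρ'.arms, ρ'.level = ρ.level + 1 ∧ ρ'.pos = 2 * ρ.pos + j ∧ ρ'.arms ⊆ ρ.arms ∧
      ∀ a ∈ ρ'.arms, a = y ∨ estDist p h ρ ρ'.c0 ρ'.c1 a y ≤ 3 / 16 * p.L * ρ'.width := by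
  unfold halfPartition at hm
  simp only [Finset.mem_image] at hm
  obtain ⟨y, hy, rfl⟩ := hm
  have hg := clustering_good R (estDist p h ρ (ρ.c0 + ρ.width * (j : ℕ) / 2)
    (ρ.c0 + ρ.width * (1 + (j : ℕ)) / 2)) (3 / 16 * p.L * ((ρ.c0 + ρ.width * (1 + (j : ℕ)) / 2)
      - (ρ.c0 + ρ.width * (j : ℕ) / 2))) ρ
  refine ⟨y, hg.center_mem y hy, rfl, rfl, hg.members_sub y, fun a ha => ?_⟩
  rcases hg.close y a ha with e | e
  · exact Or.inl e
  · right
    rw [half_c0, half_c1, half_width]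
    exact e.trans (le_of_eq (by ring))

lemma mem_subPartition {ρ' : Ball K} (hm : ρ' ∈ subPartition p R h ρ) : ρ.IsChild ρ' ∧
    ∃ y ∈ ρ'.arms, 
      ∀ a ∈ ρ'.arms, a = y ∨ estDist p h ρ ρ'.c0 ρ'.c1 a y ≤ 3 / 16 * p.L * ρ'.width := by
  have : ∃ j : Fin 2, ρ' ∈ halfPartition p R h ρ j := by
    rcases Finset.mem_union.1 hm with hm | hm
    · exact ⟨0, hm⟩
    · exact ⟨1, hm⟩
  obtain ⟨j, hj⟩ := this
  obtain ⟨y, hy, h1, h2, h3, h4⟩ := mem_halfPartition p R h ρ hj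
  refine ⟨⟨h1, by rw [h2]; omega, h3, ⟨y, hy⟩⟩, y, hy, h4⟩

/-- The position determines the half, and the clusters of one half are disjoint. -/
lemma subPartition_unique {ρ₁ ρ₂ : Ball K} (h₁ : ρ₁ ∈ subPartition p R h ρ)
    (h₂ : ρ₂ ∈ subPartition p R h ρ) (hp : ρ₁.pos = ρ₂.pos) (hm : ρ₁.Meets ρ₂) : ρ₁ = ρ₂ := by
  have key : ∀ {ρ'}, ρ' ∈ subPartition p R h ρ → ∃ j : Fin 2, ρ' ∈ halfPartition p R h ρ j := by
    intro ρ' hm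
    rcases Finset.mem_union.1 hm with hm | hm
    · exact ⟨0, hm⟩
    · exact ⟨1, hm⟩
  obtain ⟨j₁, hj₁⟩ := key h₁
  obtain ⟨j₂, hj₂⟩ := key h₂
  obtain ⟨_, _, _, hp₁, _⟩ := mem_halfPartition p R h ρ hj₁
  obtain ⟨_, _, _, hp₂, _⟩ := mem_halfPartition p R h ρ hj₂
  have hj : j₁ = j₂ := by
    apply Fin.ext; omega
  subst hj
  unfold halfPartition at hj₁ hj₂
  simp only [Finset.mem_image] at hj₁ hj₂
  obtain ⟨y₁, hy₁, rfl⟩ := hj₁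
  obtain ⟨y₂, hy₂, rfl⟩ := hj₂
  obtain ⟨a, ha₁, ha₂⟩ := hm
  have := (clustering_good R _ _ ρ).disj _ _ _ ha₁ ha₂
  rw [this]

lemma subPartition_cover {x : ℝ} (hx : ρ.Has x) {a : Fin K} (ha : a ∈ ρ.arms) :
    ∃ ρ' ∈ subPartition p R h ρ, a ∈ ρ'.arms ∧ ρ'.Has x := by
  have key : ∀ j : Fin 2, (2 * (ρ.pos : ℝ) + (j : ℕ)) / 2 ^ (ρ.level + 1) ≤ x →
      x ≤ (2 * (ρ.pos : ℝ) + (j : ℕ) + 1) / 2 ^ (ρ.level + 1) →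
      ∃ ρ' ∈ halfPartition p R h ρ j, a ∈ ρ'.arms ∧ ρ'.Has x := by
    intro j h0 h1
    unfold halfPartition
    obtain ⟨y, hy, hay⟩ := (clustering_good R (estDist p h ρ (ρ.c0 + ρ.width * (j : ℕ) / 2)
      (ρ.c0 + ρ.width * (1 + (j : ℕ)) / 2)) (3 / 16 * p.L * ((ρ.c0 + ρ.width * (1 + (j : ℕ)) / 2)
      - (ρ.c0 + ρ.width * (j : ℕ) / 2))) ρ).cover a ha
    refine ⟨_, Finset.mem_image_of_mem _ hy, hay, ?_, ?_⟩
    · unfold Ball.c0; push_cast; exact h0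
    · unfold Ball.c1; push_cast; exact h1
  obtain ⟨h0, h1⟩ := hx
  unfold Ball.c0 at h0
  unfold Ball.c1 at h1
  rcases le_total x ((2 * (ρ.pos : ℝ) + 1) / 2 ^ (ρ.level + 1)) with hx | hx
  · obtain ⟨ρ', hρ', h'⟩ := key 0 (by
      refine le_trans (le_of_eq ?_) h0
      simp only [Fin.val_zero, Nat.cast_zero, add_zero]; rw [pow_succ]; field_simp) (by simpa using hx)
    exact ⟨ρ', Finset.mem_union_left _ hρ', h'⟩
  · obtain ⟨ρ', hρ', h'⟩ := key 1 (by simpa using hx) (by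
      refine h1.trans (le_of_eq ?_)
      simp only [Fin.val_one, Nat.cast_one]; rw [pow_succ]; field_simp; ring)
    exact ⟨ρ', Finset.mem_union_right _ hρ', h'⟩

end SubPartition

end ApproxZooming

/-! ### The run of the algorithm and the invariants of its tree of balls -/

namespace ApproxZooming

noncomputable section

variable {K : ℕ}

/-- One realization: the problem instance, the rules, the contexts, and the noise terms. -/
structure Path (K : ℕ) where
  p : Params
  R : Rules K
  f : Fin K → ℝ → ℝ
  x : ℕ → ℝ
  ε : ℕ → ℝ

/-- With `T ≥ 2` the logarithm is positive even for a single arm. If k were zero, every arm would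
have sufficient data from the start. -/
lemma numNbr_pos {p : Params} {ρ : Ball K} (hT : 2 ≤ p.T) (hL : 0 < p.L) (hσ : 0 < p.σ)
    (hρ : ρ.arms.Nonempty) : 0 < numNbr p ρ := by
  unfold numNbr
  rw [Nat.ceil_pos]
  have h1 : (1 : ℝ) ≤ ρ.arms.card := by exact_mod_cast hρ.card_pos
  have h2 : (2 : ℝ) ≤ p.T := by exact_mod_cast hT
  have h3 : 0 < Real.log ((p.T : ℝ) * ρ.arms.card) := Real.log_pos (by nlinarith)
  have h4 := ρ.width_pos
  positivity

namespace Path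

variable (π : Path K)

/-- The state before trial `t`. -/
def state (t : ℕ) : State K := run π.p π.R π.f π.x π.ε t

/-- The history before trial `t`. -/
abbrev hist (t : ℕ) : List (Trial K) := (π.state t).hist

/-- The ball selected in trial `t`. -/
def ball (t : ℕ) : Ball K := selectBall π.p π.R (π.state t) (π.x t)

/-- The arm played in trial `t`. -/
def arm (t : ℕ) : Fin K := selectArm π.p π.R (π.state t) (π.x t)

/-- Whether a flagged ball is selected in trial `t`. -/
def flag (t : ℕ) : Prop := flaggedPhase (π.state t) (π.x t)

/-- The reward observed in trial `t`. -/
def rew (t : ℕ) : ℝ := π.f (π.arm t) (π.x t) + π.ε t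

open Classical in
/-- The record of trial `t`. -/
def trial (t : ℕ) : Trial K := ⟨π.ball t, π.arm t, π.x t, π.rew t, decide (π.flag t)⟩

@[simp] lemma trial_ball (t : ℕ) : (π.trial t).ball = π.ball t := rfl
@[simp] lemma trial_arm (t : ℕ) : (π.trial t).arm = π.arm t := rfl
@[simp] lemma trial_ctx (t : ℕ) : (π.trial t).ctx = π.x t := rfl
@[simp] lemma trial_reward (t : ℕ) : (π.trial t).reward = π.rew t := rfl
@[simp] lemma trial_inFlagged (t : ℕ) : (π.trial t).inFlagged = true ↔ π.flag t := by
  simp [trial]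

/-- In trial `t` the selected ball is partitioned. -/
def parts (t : ℕ) : Prop :=
  π.flag t ∧ ∀ b ∈ (π.ball t).arms, SuffData π.p (π.trial t :: π.hist t) (π.ball t) b

/-- The number of plays after which an active ball is flagged. -/
def thr (ρ : Ball K) : ℝ :=
  6 * π.p.σ ^ 2 * Real.log π.p.T / (π.p.L ^ 2 * ρ.width ^ 2)

/-- In trial `t` the selected active ball becomes flagged. -/
def promotes (t : ℕ) : Prop := ¬ π.flag t ∧ π.thr (π.ball t) < plays (π.hist t) (π.ball t)

open Classical in
lemma state_succ (t : ℕ) : π.state (t + 1) =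
    if π.parts t then ⟨(π.state t).active ∪ subPartition π.p π.R (π.trial t :: π.hist t) (π.ball t),
      (π.state t).flagged.erase (π.ball t), π.trial t :: π.hist t⟩
    else if π.promotes t then ⟨(π.state t).active.erase (π.ball t),
      insert (π.ball t) (π.state t).flagged, π.trial t :: π.hist t⟩
    else ⟨(π.state t).active, (π.state t).flagged, π.trial t :: π.hist t⟩ := by
  change step π.p π.R (π.state t) (π.x t) (fun a => π.f a (π.x t) + π.ε t) = _
  unfold step
  by_cases hf : π.flag t
  · have hf' : flaggedPhase (π.state t) (π.x t) := hf
    have htr : π.trial t = ⟨selectBall π.p π.R (π.state t) (π.x t),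
      selectArm π.p π.R (π.state t) (π.x t), π.x t,
      π.f (selectArm π.p π.R (π.state t) (π.x t)) (π.x t) + π.ε t, true⟩ := by
      simp only [trial, hf, decide_true]; rfl
    have hpr : ¬ π.promotes t := fun h => h.1 hf
    rw [if_neg hpr]
    simp only [if_pos hf', ← htr]
    by_cases hp : π.parts t
    · have := hp.2
      rw [if_pos hp, if_pos (by exact this)]; rfl
    · have : ¬ ∀ b ∈ (π.ball t).arms, SuffData π.p (π.trial t :: π.hist t) (π.ball t) b :=
        fun h => hp ⟨hf, h⟩
      rw [if_neg hp, if_neg (by exact this)]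
  · have hf' : ¬ flaggedPhase (π.state t) (π.x t) := hf
    have htr : π.trial t = ⟨selectBall π.p π.R (π.state t) (π.x t),
      selectArm π.p π.R (π.state t) (π.x t), π.x t,
      π.f (selectArm π.p π.R (π.state t) (π.x t)) (π.x t) + π.ε t, false⟩ := by
      simp only [trial, hf, decide_false]; rfl
    have hpa : ¬ π.parts t := fun h => hf h.1
    rw [if_neg hpa]
    simp only [if_neg hf', ← htr]
    by_cases hp : π.promotes t
    · have := hp.2
      rw [if_pos hp, if_pos (by exact this)]; rfl
    · have : ¬ π.thr (π.ball t) < plays (π.hist t) (π.ball t) :=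
        fun h => hp ⟨hf, h⟩
      rw [if_neg hp, if_neg (by exact this)]

lemma hist_zero : π.hist 0 = [] := rfl

lemma hist_succ (t : ℕ) : π.hist (t + 1) = π.trial t :: π.hist t := by
  rw [hist, state_succ]; split_ifs <;> rfl

/-- Statistics of the history list are turned into cardinalities and sums over sets of trial
indices, on which the later counting is done. -/
lemma filter_length (q : Trial K → Prop) [DecidablePred q] (t : ℕ) :
    ((π.hist t).filter q).length = ((Finset.range t).filter (fun s => q (π.trial s))).card := by
  induction t with
  | zero => simp [hist_zero]
  | succ t ih =>
    rw [hist_succ, List.filter_cons, Finset.range_add_one, Finset.filter_insert]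
    by_cases h : q (π.trial t)
    · simp [h, ih]
    · simp [h, ih]

lemma filter_map_sum (q : Trial K → Prop) [DecidablePred q] (g : Trial K → ℝ) (t : ℕ) :
    (((π.hist t).filter q).map g).sum
      = ∑ s ∈ (Finset.range t).filter (fun s => q (π.trial s)), g (π.trial s) := by
  induction t with
  | zero => simp [hist_zero]
  | succ t ih =>
    rw [hist_succ, List.filter_cons, Finset.range_add_one, Finset.filter_insert]
    by_cases h : q (π.trial t)
    · simp [h, ih]
    · simp [h, ih]

lemma plays_eq (t : ℕ) (ρ : Ball K) :
    plays (π.hist t) ρ = ((Finset.range t).filter (fun s => π.ball s = ρ)).card := by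
  unfold plays
  rw [filter_length]; rfl

lemma plays_succ_self (t : ℕ) :
    plays (π.hist (t + 1)) (π.ball t) = plays (π.hist t) (π.ball t) + 1 := by
  rw [hist_succ, plays, List.filter_cons]; simp [plays]

lemma plays_succ_of_ne {t : ℕ} {ρ : Ball K} (h : π.ball t ≠ ρ) :
    plays (π.hist (t + 1)) ρ = plays (π.hist t) ρ := by
  rw [hist_succ, plays, List.filter_cons]; simp [plays, h]

open Classical in
/-- The times before `t` at which arm `a` of the flagged ball `ρ` was played. -/
def samples (t : ℕ) (ρ : Ball K) (a : Fin K) : Finset ℕ :=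
  (Finset.range t).filter (fun s => π.ball s = ρ ∧ π.arm s = a ∧ π.flag s)

open Classical in
lemma samples_succ (t : ℕ) (ρ : Ball K) (a : Fin K) : π.samples (t + 1) ρ a =
    if π.ball t = ρ ∧ π.arm t = a ∧ π.flag t then insert t (π.samples t ρ a)
    else π.samples t ρ a := by
  unfold samples
  rw [Finset.range_add_one, Finset.filter_insert]

lemma mem_samples {s t : ℕ} {ρ : Ball K} {a : Fin K} :
    s ∈ π.samples t ρ a ↔ s < t ∧ π.ball s = ρ ∧ π.arm s = a ∧ π.flag s := by
  simp [samples]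

lemma lt_of_mem_samples {s t : ℕ} {ρ : Ball K} {a : Fin K} (h : s ∈ π.samples t ρ a) : s < t :=
  (π.mem_samples.1 h).1

open Classical in
lemma flaggedData_filter_length (q : ℝ × ℝ → Prop) [DecidablePred q] (t : ℕ) (ρ : Ball K)
    (a : Fin K) : ((flaggedData (π.hist t) ρ a).filter q).length
      = ((π.samples t ρ a).filter (fun s => q (π.x s, π.rew s))).card := by
  unfold flaggedData
  rw [List.filter_map, List.length_map, List.filter_filter]
  have := π.filter_length (fun s => q (s.ctx, s.reward) ∧
    (s.ball = ρ ∧ s.arm = a ∧ s.inFlagged = true)) t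
  simp only [Bool.decide_and] at this
  simp only [Bool.decide_and, Function.comp_def]
  rw [this, samples, Finset.filter_filter]
  congr 1
  ext s
  simp only [Finset.mem_filter, trial_ball, trial_arm, trial_inFlagged, trial_ctx, trial_reward]
  tauto

open Classical in
lemma flaggedData_filter_sum (q : ℝ × ℝ → Prop) [DecidablePred q] (t : ℕ) (ρ : Ball K)
    (a : Fin K) : (((flaggedData (π.hist t) ρ a).filter q).map Prod.snd).sum
      = ∑ s ∈ (π.samples t ρ a).filter (fun s => q (π.x s, π.rew s)), π.rew s := by
  unfold flaggedData
  rw [List.filter_map, List.map_map, List.filter_filter]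
  have := π.filter_map_sum
    (fun s => q (s.ctx, s.reward) ∧ (s.ball = ρ ∧ s.arm = a ∧ s.inFlagged = true)) Trial.reward t
  simp only [Bool.decide_and] at this
  simp only [Bool.decide_and, Function.comp_def]
  rw [this, samples, Finset.filter_filter]
  refine Finset.sum_congr ?_ (fun _ _ => rfl)
  ext s
  simp only [Finset.mem_filter, trial_ball, trial_arm, trial_inFlagged, trial_ctx, trial_reward]
  tauto

/-- `x` is in the `j`-th of the 64 equal parts of the context interval of `ρ`. -/
def inPart (ρ : Ball K) (j : ℕ) (x : ℝ) : Prop :=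
  ρ.c0 + ((j : ℝ) - 1) * ρ.width / 64 ≤ x ∧ x ≤ ρ.c0 + (j : ℝ) * ρ.width / 64

open Classical in
/-- The number of samples of arm `a` in the `j`-th part of `ρ`. -/
def partCount (t : ℕ) (ρ : Ball K) (a : Fin K) (j : ℕ) : ℕ :=
  ((π.samples t ρ a).filter (fun s => inPart ρ j (π.x s))).card

lemma suffData_iff (t : ℕ) (ρ : Ball K) (a : Fin K) : SuffData π.p (π.hist t) ρ a ↔
    ∀ j ∈ Finset.Icc (1 : ℕ) 64, numNbr π.p ρ ≤ π.partCount t ρ a j := by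
  unfold SuffData
  refine forall₂_congr fun j _ => ?_
  rw [flaggedData_filter_length]
  unfold partCount inPart
  congr!

/-- The active and the flagged balls. -/
def leaves (t : ℕ) : Finset (Ball K) := (π.state t).active ∪ (π.state t).flagged

/-- The balls which have been active or flagged at some time up to `t`. -/
def ever (t : ℕ) : Set (Ball K) := {ρ | ∃ s ≤ t, ρ ∈ π.leaves s}

lemma leaves_sub_ever {t : ℕ} {ρ : Ball K} (h : ρ ∈ π.leaves t) : ρ ∈ π.ever t := ⟨t, le_rfl, h⟩

lemma ever_mono {s t : ℕ} (h : s ≤ t) {ρ : Ball K} (hρ : ρ ∈ π.ever s) : ρ ∈ π.ever t := by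
  obtain ⟨u, hu, hm⟩ := hρ
  exact ⟨u, hu.trans h, hm⟩

lemma ever_succ {t : ℕ} {ρ : Ball K} (hρ : ρ ∈ π.ever (t + 1)) :
    ρ ∈ π.ever t ∨ ρ ∈ π.leaves (t + 1) := by
  obtain ⟨u, hu, hm⟩ := hρ
  rcases Nat.lt_or_ge t u with h | h
  · have : u = t + 1 := by omega
    exact Or.inr (this ▸ hm)
  · exact Or.inl ⟨u, h, hm⟩

/-- The properties of the contexts which hold almost surely. -/
structure Generic : Prop where
  mem : ∀ t, π.x t ∈ Set.Icc (0 : ℝ) 1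
  irr : ∀ t, Irrational (π.x t)
  inj : ∀ s t, s ≠ t → π.x s ≠ π.x t
  sum : ∀ s t, s ≠ t → Irrational (π.x s + π.x t)

lemma mem_containing {S : Finset (Ball K)} {x : ℝ} {ρ : Ball K} :
    ρ ∈ containing S x ↔ ρ ∈ S ∧ ρ.Has x := by
  unfold containing Ball.Has; simp

lemma ball_of_flag {t : ℕ} (h : π.flag t) : π.ball t ∈ (π.state t).flagged ∧
    (π.ball t).Has (π.x t) ∧
    ∀ ρ ∈ (π.state t).flagged, ρ.Has (π.x t) → (π.ball t).level ≤ ρ.level := by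
  have h' : flaggedPhase (π.state t) (π.x t) := h
  unfold ball selectBall
  rw [if_pos h']
  obtain ⟨ρ, hρ, hm⟩ := Finset.exists_max_image _ Ball.width h'
  have := π.R.pickBall_mem ((containing (π.state t).flagged (π.x t)).filter
      (fun ρ => ∀ ρ' ∈ containing (π.state t).flagged (π.x t), ρ'.width ≤ ρ.width))
      ⟨ρ, Finset.mem_filter.2 ⟨hρ, hm⟩⟩
  rw [Finset.mem_filter, mem_containing] at this
  refine ⟨this.1.1, this.1.2, fun ρ' h1 h2 => ?_⟩
  exact Ball.width_le_width.1 (this.2 ρ' (mem_containing.2 ⟨h1, h2⟩))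

lemma ball_of_not_flag {t : ℕ} (h : ¬ π.flag t)
    (hne : ∃ ρ ∈ π.leaves t, ρ.Has (π.x t)) : π.ball t ∈ (π.state t).active ∧
    (π.ball t).Has (π.x t) ∧ ∀ ρ ∈ (π.state t).active, ρ.Has (π.x t) →
      ucb π.p (π.hist t) ρ ≤ ucb π.p (π.hist t) (π.ball t) := by
  have h' : ¬ flaggedPhase (π.state t) (π.x t) := h
  unfold ball selectBall
  rw [if_neg h']
  have hne' : (containing (π.state t).active (π.x t)).Nonempty := by
    obtain ⟨ρ, h1, h2⟩ := hne
    rcases Finset.mem_union.1 h1 with h1 | h1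
    · exact ⟨ρ, mem_containing.2 ⟨h1, h2⟩⟩
    · exact absurd ⟨ρ, mem_containing.2 ⟨h1, h2⟩⟩ h'
  obtain ⟨ρ, hρ, hm⟩ := Finset.exists_max_image _ (ucb π.p (π.hist t)) hne'
  have := π.R.pickBall_mem ((containing (π.state t).active (π.x t)).filter
      (fun ρ => ∀ ρ' ∈ containing (π.state t).active (π.x t), 
        ucb π.p (π.hist t) ρ' ≤ ucb π.p (π.hist t) ρ))
      ⟨ρ, Finset.mem_filter.2 ⟨hρ, hm⟩⟩
  rw [Finset.mem_filter, mem_containing] at this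
  exact ⟨this.1.1, this.1.2, fun ρ' h1 h2 => this.2 ρ' (mem_containing.2 ⟨h1, h2⟩)⟩

/-- The invariants of the tree of balls. -/
structure Inv (t : ℕ) : Prop where
  disj : Disjoint (π.state t).active (π.state t).flagged
  nonempty : ∀ ρ ∈ π.ever t, ρ.arms.Nonempty
  leafmax : ∀ ρ ∈ π.leaves t, ∀ ρ' ∈ π.ever t, ρ.Meets ρ' → ρ.Covers ρ' → ρ' = ρ
  uniq : ∀ ρ ∈ π.ever t, ∀ ρ' ∈ π.ever t, ρ.level = ρ'.level → ρ.pos = ρ'.pos →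
    ρ.Meets ρ' → ρ = ρ'
  cover : ∀ a, ∀ y ∈ Set.Icc (0 : ℝ) 1, ∃ ρ ∈ π.leaves t, a ∈ ρ.arms ∧ ρ.Has y
  trials : ∀ s < t, π.ball s ∈ π.ever t
  active_not_flag : ∀ ρ ∈ (π.state t).active, ∀ s < t, π.ball s = ρ → ¬ π.flag s
  active_plays : ∀ ρ ∈ (π.state t).active, (plays (π.hist t) ρ : ℝ) ≤ π.thr ρ + 1
  unsat : ∀ ρ ∈ (π.state t).flagged, ∃ a ∈ ρ.arms, ¬ SuffData π.p (π.hist t) ρ a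

variable {π}

/-- `Inv.cover` supplies a candidate, so `pickBall` is applied to a nonempty set. -/
lemma Inv.mem_leaves {t : ℕ} (hI : π.Inv t) (ha : Nonempty (Fin K)) (hx : π.Generic) :
    π.ball t ∈ π.leaves t ∧ (π.ball t).Has (π.x t) := by
  by_cases h : π.flag t
  · have := π.ball_of_flag h
    exact ⟨Finset.mem_union_right _ this.1, this.2.1⟩
  · obtain ⟨a⟩ := ha
    obtain ⟨ρ, h1, _, h2⟩ := hI.cover a (π.x t) (hx.mem t)
    have := π.ball_of_not_flag h ⟨ρ, h1, h2⟩
    exact ⟨Finset.mem_union_left _ this.1, this.2.1⟩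

lemma inv_zero (hK : 0 < K) (hT : 2 ≤ π.p.T) (hL : 0 < π.p.L) (hσ : 0 < π.p.σ) : π.Inv 0 := by
  have hs : π.state 0 = State.init K := rfl
  have hl : π.leaves 0 = {Ball.whole K} := by simp [leaves, hs, State.init]
  have he : ∀ ρ, ρ ∈ π.ever 0 ↔ ρ = Ball.whole K := by
    intro ρ
    unfold ever
    constructor
    · rintro ⟨s, h, h'⟩
      have : s = 0 := by omega
      rw [this, hl] at h'
      simpa using h'
    · rintro rfl
      exact ⟨0, le_rfl, by simp [hl]⟩
  have hne : (Ball.whole K).arms.Nonempty := ⟨⟨0, hK⟩, by simp [Ball.whole]⟩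
  constructor
  · simp [hs, State.init]
  · intro ρ h; rw [he] at h; rw [h]; exact hne
  · intro ρ h ρ' h' _ _
    rw [he] at h'
    have := π.leaves_sub_ever h
    rw [he] at this
    rw [h', this]
  · intro ρ h ρ' h' _ _ _
    rw [he] at h h'; rw [h, h']
  · intro a y hy
    refine ⟨Ball.whole K, by simp [hl], by simp [Ball.whole], ?_, ?_⟩
    · simpa [Ball.c0, Ball.whole] using hy.1
    · simpa [Ball.c1, Ball.whole] using hy.2
  · intro s hs; omega
  · intro ρ h; simp [hs, State.init] at h
  · intro ρ h; simp [hs, State.init] at h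
  · intro ρ h
    have : ρ = Ball.whole K := by simpa [hs, State.init] using h
    subst this
    refine ⟨⟨0, hK⟩, by simp [Ball.whole], ?_⟩
    rw [suffData_iff]
    intro h
    have h1 := h 1 (by simp)
    have h2 : 0 < numNbr π.p (Ball.whole K) := numNbr_pos hT hL hσ hne
    have h3 : π.partCount 0 (Ball.whole K) ⟨0, hK⟩ 1 = 0 := by
      simp [partCount, samples]
    omega

end Path

end

end ApproxZooming

/-! ### Preservation of the invariants -/

namespace ApproxZooming

noncomputable section

variable {K : ℕ}

namespace Path

variable {π : Path K}

/-- The balls into which the selected ball is partitioned in trial `t`. -/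
abbrev kids (π : Path K) (t : ℕ) : Finset (Ball K) :=
  subPartition π.p π.R (π.trial t :: π.hist t) (π.ball t)

lemma state_parts {t : ℕ} (h : π.parts t) :
    (π.state (t + 1)).active = (π.state t).active ∪ π.kids t ∧
    (π.state (t + 1)).flagged = (π.state t).flagged.erase (π.ball t) := by
  rw [state_succ, if_pos h]; exact ⟨rfl, rfl⟩

lemma state_promotes {t : ℕ} (h : π.promotes t) :
    (π.state (t + 1)).active = (π.state t).active.erase (π.ball t) ∧
    (π.state (t + 1)).flagged = insert (π.ball t) (π.state t).flagged := by
  rw [state_succ, if_neg (fun h' => h.1 h'.1), if_pos h]; exact ⟨rfl, rfl⟩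

lemma state_same {t : ℕ} (h : ¬ π.parts t) (h' : ¬ π.promotes t) :
    (π.state (t + 1)).active = (π.state t).active ∧
    (π.state (t + 1)).flagged = (π.state t).flagged := by
  rw [state_succ, if_neg h, if_neg h']; exact ⟨rfl, rfl⟩

lemma Inv.leaves_parts {t : ℕ} (hI : π.Inv t) (h : π.parts t) (ρ : Ball K) :
    ρ ∈ π.leaves (t + 1) ↔ (ρ ∈ π.leaves t ∧ ρ ≠ π.ball t) ∨ ρ ∈ π.kids t := by
  unfold leaves
  rw [(state_parts h).1, (state_parts h).2]
  have hb := (π.ball_of_flag h.1).1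
  have : ∀ ρ ∈ (π.state t).active, ρ ≠ π.ball t :=
    fun ρ hρ e => Finset.disjoint_left.1 hI.disj hρ (e ▸ hb)
  simp only [Finset.mem_union, Finset.mem_erase]
  constructor
  · rintro ((h | h) | h)
    · exact Or.inl ⟨Or.inl h, this _ h⟩
    · exact Or.inr h
    · exact Or.inl ⟨Or.inr h.2, h.1⟩
  · rintro (⟨h | h, h'⟩ | h)
    · exact Or.inl (Or.inl h)
    · exact Or.inr ⟨h', h⟩
    · exact Or.inl (Or.inr h)

/-- Promotion only moves a ball from the active to the flagged set. -/
lemma leaves_not_parts {t : ℕ} (hb : π.ball t ∈ π.leaves t) (h : ¬ π.parts t) :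
    π.leaves (t + 1) = π.leaves t := by
  by_cases hp : π.promotes t
  · unfold leaves at *
    rw [(state_promotes hp).1, (state_promotes hp).2]
    ext ρ
    simp only [Finset.mem_union, Finset.mem_erase, Finset.mem_insert] at *
    by_cases e : ρ = π.ball t
    · rw [e]; tauto
    · tauto
  · unfold leaves
    rw [(state_same h hp).1, (state_same h hp).2]

lemma samples_succ_of_ne {t : ℕ} {ρ : Ball K} (h : π.ball t ≠ ρ ∨ ¬ π.flag t) (a : Fin K) :
    π.samples (t + 1) ρ a = π.samples t ρ a := by
  rw [samples_succ, if_neg (by tauto)]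

lemma suffData_succ_of_ne {t : ℕ} {ρ : Ball K} (h : π.ball t ≠ ρ ∨ ¬ π.flag t) (a : Fin K) :
    SuffData π.p (π.hist (t + 1)) ρ a ↔ SuffData π.p (π.hist t) ρ a := by
  rw [suffData_iff, suffData_iff]; unfold partCount; rw [samples_succ_of_ne h]

lemma isChild_of_kids {t : ℕ} {ρ : Ball K} (h : ρ ∈ π.kids t) : (π.ball t).IsChild ρ :=
  (mem_subPartition _ _ _ _ h).1

/-- A ball covered by a child is also covered by the leaf being partitioned; `leafmax` makes it
equal to that leaf, which is one level too coarse. -/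
lemma kids_not_ever {t : ℕ} (hI : π.Inv t) (hb : π.ball t ∈ π.leaves t) {ρ ρ' : Ball K}
    (h : ρ ∈ π.kids t) (hρ' : ρ' ∈ π.ever t) (hm : ρ.Meets ρ') : ¬ ρ.Covers ρ' := by
  intro hc
  have hch := isChild_of_kids h
  obtain ⟨a, ha, ha'⟩ := hm
  have := hI.leafmax _ hb _ hρ' ⟨a, hch.arms ha, ha'⟩ (hch.covers.trans hc)
  have h1 := hc.1
  rw [this, hch.level] at h1
  omega

lemma kids_not_mem_ever {t : ℕ} (hI : π.Inv t) (hb : π.ball t ∈ π.leaves t) {ρ : Ball K}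
    (h : ρ ∈ π.kids t) : ρ ∉ π.ever t := by
  intro h'
  obtain ⟨a, ha⟩ := (isChild_of_kids h).nonempty
  exact kids_not_ever hI hb h h' ⟨a, ha, ha⟩ (Ball.Covers.refl _)

/-- Only the children are new, and they replace a leaf, so the new cases are pairs involving a
child. That leaves have no proper descendants (`leafmax`) is what carries `uniq` along, through
`kids_not_ever`. -/
lemma Inv.succ {t : ℕ} (hK : Nonempty (Fin K)) (hT : 2 ≤ π.p.T) (hL : 0 < π.p.L) (hσ : 0 < π.p.σ)
    (hx : π.Generic) (hI : π.Inv t) : π.Inv (t + 1) := by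
  obtain ⟨hb, hhas⟩ := hI.mem_leaves hK hx
  have hbe := π.leaves_sub_ever hb
  have hever : ∀ ρ ∈ π.ever (t + 1), ρ ∈ π.ever t ∨ (π.parts t ∧ ρ ∈ π.kids t) := by
    intro ρ hρ
    rcases π.ever_succ hρ with h | h
    · exact Or.inl h
    · by_cases hp : π.parts t
      · rcases (hI.leaves_parts hp ρ).1 h with h | h
        · exact Or.inl (π.leaves_sub_ever h.1)
        · exact Or.inr ⟨hp, h⟩
      · rw [leaves_not_parts hb hp] at h
        exact Or.inl (π.leaves_sub_ever h)
  have hleaf : ∀ ρ ∈ π.leaves (t + 1), (ρ ∈ π.leaves t ∧ (π.parts t → ρ ≠ π.ball t)) ∨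
      (π.parts t ∧ ρ ∈ π.kids t) := by
    intro ρ hρ
    by_cases hp : π.parts t
    · rcases (hI.leaves_parts hp ρ).1 hρ with h | h
      · exact Or.inl ⟨h.1, fun _ => h.2⟩
      · exact Or.inr ⟨hp, h⟩
    · rw [leaves_not_parts hb hp] at hρ
      exact Or.inl ⟨hρ, fun h => absurd h hp⟩
  constructor
  · by_cases hp : π.parts t
    · rw [(state_parts hp).1, (state_parts hp).2, Finset.disjoint_left]
      intro ρ h1 h2
      have h2' := Finset.mem_of_mem_erase h2
      rcases Finset.mem_union.1 h1 with h1 | h1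
      · exact Finset.disjoint_left.1 hI.disj h1 h2'
      · exact kids_not_mem_ever hI hb h1 (π.leaves_sub_ever (Finset.mem_union_right _ h2'))
    · by_cases hq : π.promotes t
      · rw [(state_promotes hq).1, (state_promotes hq).2, Finset.disjoint_left]
        intro ρ h1 h2
        rw [Finset.mem_erase] at h1
        rcases Finset.mem_insert.1 h2 with h2 | h2
        · exact h1.1 h2
        · exact Finset.disjoint_left.1 hI.disj h1.2 h2
      · rw [(state_same hp hq).1, (state_same hp hq).2]; exact hI.disj
  · intro ρ hρ
    rcases hever ρ hρ with h | ⟨_, h⟩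
    · exact hI.nonempty ρ h
    · exact (isChild_of_kids h).nonempty
  · intro ρ hρ ρ' hρ' hm hc
    rcases hleaf ρ hρ with ⟨h, hne⟩ | ⟨hp, h⟩ <;> rcases hever ρ' hρ' with h' | ⟨hp', h'⟩
    · exact hI.leafmax ρ h ρ' h' hm hc
    · exfalso
      obtain ⟨a, ha, ha'⟩ := hm
      have hch := isChild_of_kids h'
      -- Both intervals contain that of the child, so they are nested; either way `leafmax`
      -- identifies `ρ` with the leaf just removed.
      rcases Nat.lt_or_ge (π.ball t).level ρ.level with hl | hl
      · have := hI.leafmax _ hb ρ (π.leaves_sub_ever h) ⟨a, hch.arms ha', ha⟩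
          (Ball.covers_of_covers hch.covers hc hl.le)
        exact hne hp' this
      · have := hI.leafmax ρ h _ hbe ⟨a, ha, hch.arms ha'⟩
          (Ball.covers_of_covers hc hch.covers hl)
        exact hne hp' this.symm
    · exact absurd hc (kids_not_ever hI hb h h' hm)
    · have h1 := isChild_of_kids h
      have h2 := isChild_of_kids h'
      refine (subPartition_unique _ _ _ _ h h' ?_ hm).symm
      have := hc.2
      rw [h1.level, h2.level] at this
      simpa using this.symm
  · intro ρ hρ ρ' hρ' hl hp hm
    have hc : ρ.Covers ρ' := ⟨hl.le, by rw [hl, hp]; simp⟩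
    have hc' : ρ'.Covers ρ := ⟨hl.ge, by rw [hl, hp]; simp⟩
    have hm' : ρ'.Meets ρ := by obtain ⟨a, h, h'⟩ := hm; exact ⟨a, h', h⟩
    rcases hever ρ hρ with h | ⟨_, h⟩ <;> rcases hever ρ' hρ' with h' | ⟨_, h'⟩
    · exact hI.uniq ρ h ρ' h' hl hp hm
    · exact absurd hc' (kids_not_ever hI hb h' h hm')
    · exact absurd hc (kids_not_ever hI hb h h' hm)
    · exact subPartition_unique _ _ _ _ h h' hp hm
  · intro a y hy
    obtain ⟨ρ, hρ, ha, hρy⟩ := hI.cover a y hy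
    by_cases hp : π.parts t
    · by_cases e : ρ = π.ball t
      · subst e
        obtain ⟨ρ', h1, h2⟩ := subPartition_cover π.p π.R (π.trial t :: π.hist t) _ hρy ha
        exact ⟨ρ', (hI.leaves_parts hp ρ').2 (Or.inr h1), h2⟩
      · exact ⟨ρ, (hI.leaves_parts hp ρ).2 (Or.inl ⟨hρ, e⟩), ha, hρy⟩
    · rw [leaves_not_parts hb hp]; exact ⟨ρ, hρ, ha, hρy⟩
  · intro s hs
    rcases Nat.lt_succ_iff_lt_or_eq.1 hs with h | rfl
    · exact π.ever_mono (Nat.le_succ t) (hI.trials s h)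
    · exact π.ever_mono (Nat.le_succ _) hbe
  · intro ρ hρ s hs he
    -- Either the ball was active already, and then it cannot have been selected as a flagged one,
    -- or it is new and has no past trials.
    have hcase : (ρ ∈ (π.state t).active ∧ (π.ball t = ρ → ¬ π.flag t)) ∨ ρ ∉ π.ever t := by
      by_cases hp : π.parts t
      · rw [(state_parts hp).1] at hρ
        rcases Finset.mem_union.1 hρ with h | h
        · refine Or.inl ⟨h, fun e => ?_⟩
          have := (π.ball_of_flag hp.1).1
          exact absurd (e ▸ this) (Finset.disjoint_left.1 hI.disj h)
        · exact Or.inr (kids_not_mem_ever hI hb h)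
      · have hρ' : ρ ∈ (π.state t).active := by
          by_cases hq : π.promotes t
          · rw [(state_promotes hq).1] at hρ; exact Finset.mem_of_mem_erase hρ
          · rwa [(state_same hp hq).1] at hρ
        refine Or.inl ⟨hρ', fun e hf => ?_⟩
        have := (π.ball_of_flag hf).1
        exact absurd (e ▸ this) (Finset.disjoint_left.1 hI.disj hρ')
    rcases hcase with ⟨h, h'⟩ | h
    · rcases Nat.lt_succ_iff_lt_or_eq.1 hs with hst | rfl
      · exact hI.active_not_flag ρ h s hst he
      · exact h' he
    · rcases Nat.lt_succ_iff_lt_or_eq.1 hs with hst | rfl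
      · exact absurd (he ▸ hI.trials s hst) h
      · exact absurd (he ▸ hbe) h
  · intro ρ hρ
    have hthr : 0 ≤ π.thr ρ := by
      unfold thr
      have : (1 : ℝ) ≤ π.p.T := by exact_mod_cast (by omega : 1 ≤ π.p.T)
      have := Real.log_nonneg this
      positivity
    by_cases hp : π.parts t
    · have hfl := (π.ball_of_flag hp.1).1
      rw [(state_parts hp).1] at hρ
      rcases Finset.mem_union.1 hρ with h | h
      · have hne : π.ball t ≠ ρ := fun e => Finset.disjoint_left.1 hI.disj h (e ▸ hfl)
        rw [plays_succ_of_ne π hne]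
        exact hI.active_plays ρ h
      · have hnot := kids_not_mem_ever hI hb h
        have hne : π.ball t ≠ ρ := fun e => hnot (e ▸ hbe)
        rw [plays_succ_of_ne π hne, plays_eq, Finset.filter_eq_empty_iff.2]
        · simp; linarith
        · intro s hs e
          exact hnot (e ▸ hI.trials s (Finset.mem_range.1 hs))
    · by_cases hq : π.promotes t
      · rw [(state_promotes hq).1, Finset.mem_erase] at hρ
        rw [plays_succ_of_ne π (Ne.symm hρ.1)]
        exact hI.active_plays ρ hρ.2
      · rw [(state_same hp hq).1] at hρ
        by_cases e : π.ball t = ρ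
        · subst e
          have hf : ¬ π.flag t := fun hf =>
            Finset.disjoint_left.1 hI.disj hρ (π.ball_of_flag hf).1
          -- Without promotion the count before this trial was at most `thr`; the trial itself
          -- accounts for the `+ 1`.
          have : ¬ π.thr (π.ball t) < plays (π.hist t) (π.ball t) := fun h => hq ⟨hf, h⟩
          rw [plays_succ_self]
          push_cast
          linarith
        · rw [plays_succ_of_ne π e]; exact hI.active_plays ρ hρ
  · intro ρ hρ
    by_cases hp : π.parts t
    · rw [(state_parts hp).2, Finset.mem_erase] at hρ
      obtain ⟨a, ha, hs⟩ := hI.unsat ρ hρ.2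
      exact ⟨a, ha, by rwa [suffData_succ_of_ne (Or.inl (Ne.symm hρ.1))]⟩
    · have hold : ρ ∈ (π.state t).flagged →
          ∃ a ∈ ρ.arms, ¬ SuffData π.p (π.hist (t + 1)) ρ a := by
        intro h
        obtain ⟨a, ha, hs⟩ := hI.unsat ρ h
        by_cases e : π.ball t = ρ ∧ π.flag t
        · have : ¬ ∀ b ∈ (π.ball t).arms, SuffData π.p (π.trial t :: π.hist t) (π.ball t) b :=
            fun h => hp ⟨e.2, h⟩
          push Not at this
          rw [← e.1, hist_succ]
          exact this
        · exact ⟨a, ha, by rwa [suffData_succ_of_ne (by tauto)]⟩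
      by_cases hq : π.promotes t
      · rw [(state_promotes hq).2] at hρ
        rcases Finset.mem_insert.1 hρ with h | h
        · subst h
          have hac : π.ball t ∈ (π.state t).active := by
            rcases Finset.mem_union.1 hb with h | h
            · exact h
            · exact absurd ⟨_, mem_containing.2 ⟨h, hhas⟩⟩ hq.1
          obtain ⟨a, ha⟩ := hI.nonempty _ hbe
          refine ⟨a, ha, ?_⟩
          rw [suffData_succ_of_ne (Or.inr hq.1), suffData_iff]
          intro h
          have h1 := h 1 (by simp)
          have h2 := numNbr_pos hT hL hσ (hI.nonempty _ hbe)
          -- A ball that is still active has no flagged samples, so right after its promotion every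
          -- arm lacks data.
          have h3 : π.samples t (π.ball t) a = ∅ := by
            refine Finset.eq_empty_of_forall_notMem fun s hs => ?_
            obtain ⟨hs, h1, -, h2⟩ := π.mem_samples.1 hs
            exact hI.active_not_flag _ hac s hs h1 h2
          have h4 : π.partCount t (π.ball t) a 1 = 0 := by simp [partCount, h3]
          omega
        · exact hold h
      · rw [(state_same hp hq).2] at hρ
        exact hold hρ

/-- The standing assumptions on a path. -/
structure Valid (π : Path K) : Prop where
  hK : Nonempty (Fin K)
  hT : 2 ≤ π.p.T
  hL : 0 < π.p.L
  hσ : 0 < π.p.σ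
  gen : π.Generic

lemma Valid.inv (hv : π.Valid) (t : ℕ) : π.Inv t := by
  have hK := Fin.pos_iff_nonempty.2 hv.hK
  induction t with
  | zero => exact inv_zero hK hv.hT hv.hL hv.hσ
  | succ t ih => exact ih.succ hv.hK hv.hT hv.hL hv.hσ hv.gen

lemma Valid.ball_mem (hv : π.Valid) (t : ℕ) : π.ball t ∈ π.leaves t :=
  ((hv.inv t).mem_leaves hv.hK hv.gen).1

lemma Valid.ball_has (hv : π.Valid) (t : ℕ) : (π.ball t).Has (π.x t) :=
  ((hv.inv t).mem_leaves hv.hK hv.gen).2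

lemma Valid.not_flag_iff (hv : π.Valid) (t : ℕ) :
    ¬ π.flag t ↔ π.ball t ∈ (π.state t).active := by
  constructor
  · intro h
    exact (π.ball_of_not_flag h ⟨_, hv.ball_mem t, hv.ball_has t⟩).1
  · intro h h'
    exact Finset.disjoint_left.1 (hv.inv t).disj h (π.ball_of_flag h').1

/-- A ball that has ceased to be a leaf never becomes one again. -/
lemma Valid.leaves_of_succ (hv : π.Valid) {t : ℕ} {ρ : Ball K} (he : ρ ∈ π.ever t)
    (hl : ρ ∈ π.leaves (t + 1)) : ρ ∈ π.leaves t := by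
  by_cases hp : π.parts t
  · rcases ((hv.inv t).leaves_parts hp ρ).1 hl with h | h
    · exact h.1
    · exact absurd he (kids_not_mem_ever (hv.inv t) (hv.ball_mem t) h)
  · rwa [leaves_not_parts (hv.ball_mem t) hp] at hl

lemma Valid.leaves_of_le (hv : π.Valid) {s t : ℕ} (hst : s ≤ t) {ρ : Ball K} (he : ρ ∈ π.ever s)
    (hl : ρ ∈ π.leaves t) : ρ ∈ π.leaves s := by
  induction t, hst using Nat.le_induction with
  | base => exact hl
  | succ t h ih => exact ih (hv.leaves_of_succ (π.ever_mono h he) hl)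

lemma Valid.not_leaf_of_parts (hv : π.Valid) {s t : ℕ} (hst : s < t) (hp : π.parts s) :
    π.ball s ∉ π.leaves t := by
  intro h
  have h1 := hv.leaves_of_le (Nat.succ_le_of_lt hst)
    (π.ever_mono (Nat.le_succ s) (π.leaves_sub_ever (hv.ball_mem s))) h
  rcases ((hv.inv s).leaves_parts hp _).1 h1 with h | h
  · exact h.2 rfl
  · exact kids_not_mem_ever (hv.inv s) (hv.ball_mem s) h (π.leaves_sub_ever (hv.ball_mem s))

/-- A partitioned ball is never a leaf again, whereas a selected ball is one. -/
lemma Valid.eq_of_parts (hv : π.Valid) {s t : ℕ} (hs : π.parts s) (ht : π.parts t)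
    (h : π.ball s = π.ball t) : s = t := by
  rcases lt_trichotomy s t with hst | hst | hst
  · exact absurd (h ▸ hv.ball_mem t) (hv.not_leaf_of_parts hst hs)
  · exact hst
  · exact absurd (h ▸ hv.ball_mem s) (hv.not_leaf_of_parts hst ht)

/-- By `unsat` some arm lacks data, so the fallback branch of `selectArm` is never reached. -/
lemma Valid.arm_of_flag (hv : π.Valid) {t : ℕ} (h : π.flag t) :
    π.arm t ∈ (π.ball t).arms ∧ ¬ SuffData π.p (π.hist t) (π.ball t) (π.arm t) := by
  have h' : flaggedPhase (π.state t) (π.x t) := h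
  have hne :
      ((π.ball t).arms.filter (fun a => ¬ SuffData π.p (π.hist t) (π.ball t) a)).Nonempty := by
    obtain ⟨a, ha, hs⟩ := (hv.inv t).unsat _ (π.ball_of_flag h).1
    exact ⟨a, Finset.mem_filter.2 ⟨ha, hs⟩⟩
  have : π.arm t = ((π.ball t).arms.filter
      (fun a => ¬ SuffData π.p (π.hist t) (π.ball t) a)).min' hne := by
    unfold arm selectArm
    rw [if_pos h', dif_pos (by exact hne)]
    rfl
  rw [this]
  exact Finset.mem_filter.1 (Finset.min'_mem _ hne)

lemma Valid.arm_mem (hv : π.Valid) (t : ℕ) : π.arm t ∈ (π.ball t).arms := by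
  by_cases h : π.flag t
  · exact (hv.arm_of_flag h).1
  · have h' : ¬ flaggedPhase (π.state t) (π.x t) := h
    have : π.arm t = π.R.ucbArm (π.ball t) (plays (π.hist t) (π.ball t)) := by
      unfold arm selectArm; rw [if_neg h']; rfl
    rw [this]
    exact π.R.ucbArm_mem _ _ ((hv.inv t).nonempty _ (π.leaves_sub_ever (hv.ball_mem t)))

end Path

end

end ApproxZooming

/-! ### Nearest-neighbour estimates and the quality of the clusters -/

namespace ApproxZooming

noncomputable section

variable {K : ℕ}

/-- Among `S`, exactly `k` elements have rank at most `k` if the distances are distinct. -/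
lemma card_rank_le {S : Finset ℕ} {d : ℕ → ℝ} (hd : Set.InjOn d S) {k : ℕ} (hk : k ≤ S.card) :
    (S.filter (fun s => (S.filter (fun s' => d s' ≤ d s)).card ≤ k)).card = k := by
  set r : ℕ → ℕ := fun s => (S.filter (fun s' => d s' ≤ d s)).card with hr
  have hlt : ∀ s ∈ S, ∀ s' ∈ S, d s < d s' → r s < r s' := by
    intro s _ s' hs' h
    apply Finset.card_lt_card
    rw [Finset.ssubset_iff_of_subset (Finset.monotone_filter_right _ fun u _ hu => hu.trans h.le)]
    exact ⟨s', by simp [hs'], by simp [h]⟩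
  have hinj : Set.InjOn r S := by
    intro s hs s' hs' h
    rcases lt_trichotomy (d s) (d s') with h' | h' | h'
    · exact absurd h (hlt s hs s' hs' h').ne
    · exact hd hs hs' h'
    · exact absurd h (hlt s' hs' s hs h').ne'
  -- Distinct distances make the rank a bijection of `S` onto `1, …, |S|`.
  have himg : S.image r = Finset.Icc 1 S.card := by
    apply Finset.eq_of_subset_of_card_le
    · intro n hn
      obtain ⟨s, hs, rfl⟩ := Finset.mem_image.1 hn
      rw [Finset.mem_Icc]
      exact ⟨Finset.card_pos.2 ⟨s, by simp [hs]⟩, Finset.card_filter_le _ _⟩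
    · rw [Finset.card_image_of_injOn hinj]; simp
  have himg' : (S.filter (fun s => r s ≤ k)).image r = Finset.Icc 1 k := by
    ext n
    simp only [Finset.mem_image, Finset.mem_filter, Finset.mem_Icc]
    constructor
    · rintro ⟨s, ⟨hs, hsk⟩, rfl⟩
      have := Finset.mem_image_of_mem r hs
      rw [himg, Finset.mem_Icc] at this
      exact ⟨this.1, hsk⟩
    · rintro ⟨h1, h2⟩
      have : n ∈ S.image r := by rw [himg, Finset.mem_Icc]; exact ⟨h1, h2.trans hk⟩
      obtain ⟨s, hs, rfl⟩ := Finset.mem_image.1 this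
      exact ⟨s, ⟨hs, h2⟩, rfl⟩
  have h2 := Finset.card_image_of_injOn
    (hinj.mono (Finset.coe_subset.2 (Finset.filter_subset (fun s => r s ≤ k) S)))
  rw [himg'] at h2
  simpa using h2.symm

/-- The reward functions are Lipschitz with values in `[0, 1]`. -/
structure Regular (L : ℝ) (f : Fin K → ℝ → ℝ) : Prop where
  bdd : ∀ a, ∀ x ∈ Set.Icc (0 : ℝ) 1, f a x ∈ Set.Icc (0 : ℝ) 1
  lip : ∀ a, ∀ x ∈ Set.Icc (0 : ℝ) 1, ∀ y ∈ Set.Icc (0 : ℝ) 1, |f a x - f a y| ≤ L * |x - y|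

namespace Path

variable {π : Path K}

open Classical in
/-- The times of the `k` samples of arm `a` of `ρ` nearest to `z`. -/
def nbrs (π : Path K) (t : ℕ) (ρ : Ball K) (a : Fin K) (z : ℝ) : Finset ℕ :=
  (π.samples t ρ a).filter (fun s =>
    ((π.samples t ρ a).filter (fun s' => |π.x s' - z| ≤ |π.x s - z|)).card ≤ numNbr π.p ρ)

lemma knn_eq (t : ℕ) (ρ : Ball K) (a : Fin K) (z : ℝ) :
    knn (numNbr π.p ρ) (flaggedData (π.hist t) ρ a) z
      = (∑ s ∈ π.nbrs t ρ a z, π.rew s) / numNbr π.p ρ := by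
  unfold knn
  congr 1
  rw [flaggedData_filter_sum π (fun d => ((flaggedData (π.hist t) ρ a).filter
    (fun e => |e.1 - z| ≤ |d.1 - z|)).length ≤ numNbr π.p ρ)]
  refine Finset.sum_congr ?_ (fun _ _ => rfl)
  ext s
  simp only [nbrs, Finset.mem_filter]
  rw [flaggedData_filter_length π (fun e => |e.1 - z| ≤ |π.x s - z|)]

/-- With ties `knn` might use fewer than k samples. Two samples are equally far from z only if their
contexts coincide or add up to 2z; the latter is impossible because z is rational and sums of two
contexts are irrational. -/
lemma card_nbrs (hx : π.Generic) {t : ℕ} {ρ : Ball K} {a : Fin K} {z : ℝ} (hz : ¬ Irrational z)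
    (hk : numNbr π.p ρ ≤ (π.samples t ρ a).card) :
    (π.nbrs t ρ a z).card = numNbr π.p ρ := by
  have hd : Set.InjOn (fun s => |π.x s - z|) (π.samples t ρ a) := by
    intro s _ s' _ h
    by_contra hne
    rcases abs_eq_abs.1 h with h | h
    · exact hx.inj s s' hne (by linarith)
    · have h1 : π.x s + π.x s' = 2 * z := by linarith
      have h2 := hx.sum s s' hne
      rw [h1] at h2
      unfold Irrational at hz
      push Not at hz
      obtain ⟨q, hq⟩ := hz
      exact h2 ⟨2 * q, by push_cast; rw [hq]⟩
  have := card_rank_le hd hk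
  unfold nbrs
  convert this

open Classical in
lemma partCount_le_card (t : ℕ) (ρ : Ball K) (a : Fin K) (j : ℕ) :
    π.partCount t ρ a j ≤ (π.samples t ρ a).card := Finset.card_filter_le _ _

open Classical in
-- The part containing z holds at least k samples, all within Δ/64 of z. A neighbour further away
-- would have these and itself at most as far as itself, hence rank above k.
lemma nbrs_near {t : ℕ} {ρ : Ball K} {a : Fin K} {z : ℝ} {j : ℕ} (hz : inPart ρ j z)
    (hk : numNbr π.p ρ ≤ π.partCount t ρ a j) {s : ℕ} (hs : s ∈ π.nbrs t ρ a z) :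
    |π.x s - z| ≤ ρ.width / 64 := by
  by_contra hlt
  push Not at hlt
  unfold nbrs at hs
  rw [Finset.mem_filter] at hs
  obtain ⟨hs1, hs2⟩ := hs
  have hnear : ∀ s', inPart ρ j (π.x s') → |π.x s' - z| ≤ ρ.width / 64 := by
    intro s' h
    obtain ⟨h1, h2⟩ := h
    obtain ⟨h3, h4⟩ := hz
    rw [abs_le]
    constructor <;> linarith
  have hsub : insert s ((π.samples t ρ a).filter (fun s => inPart ρ j (π.x s))) ⊆
      (π.samples t ρ a).filter (fun s' => |π.x s' - z| ≤ |π.x s - z|) := by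
    intro u hu
    rcases Finset.mem_insert.1 hu with rfl | hu
    · exact Finset.mem_filter.2 ⟨hs1, le_rfl⟩
    · rw [Finset.mem_filter] at hu ⊢
      exact ⟨hu.1, (hnear u hu.2).trans hlt.le⟩
  have hnot : s ∉ (π.samples t ρ a).filter (fun s => inPart ρ j (π.x s)) := by
    intro h
    exact absurd (hnear s (Finset.mem_filter.1 h).2) (not_le.2 hlt)
  have := Finset.card_le_card hsub
  rw [Finset.card_insert_of_notMem hnot] at this
  unfold partCount at hk
  omega

lemma exists_inPart {ρ : Ball K} {z : ℝ} (hz : ρ.Has z) : ∃ j ∈ Finset.Icc (1 : ℕ) 64,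
    inPart ρ j z := by
  have hw := ρ.width_pos
  obtain ⟨h0, h1⟩ := hz
  rw [Ball.c1_eq] at h1
  rcases eq_or_lt_of_le h0 with h | h
  · refine ⟨1, by simp, ?_⟩
    unfold inPart
    push_cast
    rw [← h]
    constructor <;> linarith
  · set y := (z - ρ.c0) * 64 / ρ.width with hy
    have hypos : 0 < y := by
      have : 0 < z - ρ.c0 := by linarith
      positivity
    have hy64 : y ≤ 64 := by rw [hy, div_le_iff₀ hw]; nlinarith
    have hzy : z = ρ.c0 + y * ρ.width / 64 := by rw [hy]; field_simp; ring
    refine ⟨⌈y⌉₊, ?_, ?_⟩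
    · rw [Finset.mem_Icc]
      exact ⟨Nat.ceil_pos.2 hypos, Nat.ceil_le.2 (by exact_mod_cast hy64)⟩
    · have h1 := Nat.le_ceil y
      have h2 := Nat.ceil_lt_add_one hypos.le
      unfold inPart
      constructor
      · have : ((⌈y⌉₊ : ℝ) - 1) * ρ.width ≤ y * ρ.width :=
          mul_le_mul_of_nonneg_right (by linarith) hw.le
        linarith
      · have : y * ρ.width ≤ (⌈y⌉₊ : ℝ) * ρ.width := mul_le_mul_of_nonneg_right h1 hw.le
        linarith

/-- The `i`-th of the 200 grid points of the `j`-th half of `ρ`. -/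
def gridPt (ρ : Ball K) (j i : ℕ) : ℝ :=
  (1 - (i : ℝ) / 200) * (ρ.c0 + ρ.width * j / 2) + (i : ℝ) / 200 * (ρ.c0 + ρ.width * (1 + j) / 2)

lemma gridPt_not_irrational (ρ : Ball K) (j i : ℕ) : ¬ Irrational (gridPt ρ j i) := by
  unfold Irrational
  push Not
  refine ⟨(1 - (i : ℚ) / 200) * ((ρ.pos : ℚ) / 2 ^ ρ.level + 1 / 2 ^ ρ.level * j / 2) + 
    (i : ℚ) / 200 * ((ρ.pos : ℚ) / 2 ^ ρ.level + 1 / 2 ^ ρ.level * (1 + j) / 2), ?_⟩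
  unfold gridPt
  rw [Ball.width_eq, Ball.c0]
  push_cast
  ring

/-- The noise in the estimates used when `ball t` is partitioned is small. -/
def PartNoise (π : Path K) (t : ℕ) : Prop :=
  π.parts t → ∀ a ∈ (π.ball t).arms, ∀ j < 2, ∀ i ∈ Finset.Icc (1 : ℕ) 200,
    |∑ s ∈ π.nbrs (t + 1) (π.ball t) a (gridPt (π.ball t) j i), π.ε s|
      ≤ numNbr π.p (π.ball t) * (π.p.L * (π.ball t).width / 32)

lemma has_mem_Icc {ρ : Ball K} (h : ρ.pos < 2 ^ ρ.level) {z : ℝ} (hz : ρ.Has z) :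
    z ∈ Set.Icc (0 : ℝ) 1 := by
  obtain ⟨h0, h1⟩ := hz
  refine ⟨le_trans ?_ h0, h1.trans ?_⟩
  · unfold Ball.c0; positivity
  · unfold Ball.c1
    rw [div_le_one (by positivity)]
    exact_mod_cast h

lemma gridPt_eq (ρ : Ball K) (j i : ℕ) :
    gridPt ρ j i = ρ.c0 + ρ.width * ((j : ℝ) / 2 + i / 400) := by
  unfold gridPt; ring

lemma gridPt_has {ρ : Ball K} {j i : ℕ} (hj : j < 2) (hi : i ∈ Finset.Icc (1 : ℕ) 200) :
    ρ.Has (gridPt ρ j i) := by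
  have hw := ρ.width_pos
  have h1 : (i : ℝ) ≤ 200 := by exact_mod_cast (Finset.mem_Icc.1 hi).2
  have h2 : (j : ℝ) ≤ 1 := by exact_mod_cast (by omega : j ≤ 1)
  have h3 : (0 : ℝ) ≤ j := by positivity
  have h4 : (0 : ℝ) ≤ i := by positivity
  unfold Ball.Has
  rw [Ball.c1_eq, gridPt_eq]
  constructor
  · have : 0 ≤ ρ.width * ((j : ℝ) / 2 + i / 400) := by positivity
    linarith
  · have : ρ.width * ((j : ℝ) / 2 + i / 400) ≤ ρ.width * 1 :=
      mul_le_mul_of_nonneg_left (by linarith) hw.le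
    linarith

/-- The bias is at most LΔ/64 by the Lipschitz condition and `nbrs_near`, the averaged noise at most
LΔ/32 by `PartNoise`. -/
lemma abs_sub_knn_le (hv : π.Valid) (hf : Regular π.p.L π.f) {t : ℕ} (hp : π.parts t)
    (hn : π.PartNoise t) {a : Fin K} (ha : a ∈ (π.ball t).arms) {j i : ℕ} (hj : j < 2)
    (hi : i ∈ Finset.Icc (1 : ℕ) 200) :
    |knn (numNbr π.p (π.ball t)) (flaggedData (π.hist (t + 1)) (π.ball t) a)
      (gridPt (π.ball t) j i) - π.f a (gridPt (π.ball t) j i)|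
      ≤ 3 / 64 * (π.p.L * (π.ball t).width) := by
  set ρ := π.ball t with hρ
  set z := gridPt ρ j i with hz
  have hhas : ρ.Has z := gridPt_has hj hi
  have hpos : ρ.pos < 2 ^ ρ.level :=
    Ball.pos_lt_of_has (hv.gen.mem t).1 (hv.gen.mem t).2 (hv.gen.irr t) (hv.ball_has t)
  have hz01 := has_mem_Icc hpos hhas
  obtain ⟨l, hl, hlz⟩ := exists_inPart hhas
  have hsuff : SuffData π.p (π.hist (t + 1)) ρ a := by rw [hist_succ]; exact hp.2 a ha
  have hk := (π.suffData_iff _ _ _).1 hsuff l hl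
  have hcard : (π.nbrs (t + 1) ρ a z).card = numNbr π.p ρ :=
    card_nbrs hv.gen (gridPt_not_irrational _ _ _)
      (hk.trans (partCount_le_card _ _ _ _))
  have hkpos : 0 < numNbr π.p ρ :=
    numNbr_pos hv.hT hv.hL hv.hσ ((hv.inv t).nonempty _ (π.leaves_sub_ever (hv.ball_mem t)))
  have hkpos' : (0 : ℝ) < numNbr π.p ρ := by exact_mod_cast hkpos
  rw [knn_eq]
  have hrew : ∑ s ∈ π.nbrs (t + 1) ρ a z, π.rew s - numNbr π.p ρ * π.f a z =
      ∑ s ∈ π.nbrs (t + 1) ρ a z, (π.f a (π.x s) - π.f a z)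
        + ∑ s ∈ π.nbrs (t + 1) ρ a z, π.ε s := by
    rw [Finset.sum_sub_distrib, Finset.sum_const, hcard, nsmul_eq_mul, sub_add_eq_add_sub,
      ← Finset.sum_add_distrib]
    congr 1
    refine Finset.sum_congr rfl fun s hs => ?_
    have := (π.mem_samples.1 (Finset.mem_filter.1 hs).1).2.2.1
    unfold rew
    rw [this]
  have h1 : |∑ s ∈ π.nbrs (t + 1) ρ a z, (π.f a (π.x s) - π.f a z)|
      ≤ numNbr π.p ρ * (π.p.L * ρ.width / 64) := by
    refine (Finset.abs_sum_le_sum_abs _ _).trans ?_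
    rw [← hcard, ← nsmul_eq_mul]
    refine Finset.sum_le_card_nsmul _ _ _ fun s hs => ?_
    refine (hf.lip a _ (hv.gen.mem s) _ hz01).trans ?_
    have := mul_le_mul_of_nonneg_left (nbrs_near hlz hk hs) hv.hL.le
    linarith
  have h2 := hn hp a ha j hj i hi
  have h3 : (∑ s ∈ π.nbrs (t + 1) ρ a z, π.rew s) / numNbr π.p ρ - π.f a z
      = (∑ s ∈ π.nbrs (t + 1) ρ a z, π.rew s - numNbr π.p ρ * π.f a z) / numNbr π.p ρ := by
    field_simp
  rw [h3, hrew, abs_div, abs_of_pos hkpos', div_le_iff₀ hkpos']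
  refine (abs_add_le _ _).trans ((add_le_add h1 h2).trans (le_of_eq ?_))
  ring

/-- `estDist` subtracts 2σ²/k from a mean square. The factor is (1/5)² - (3/16)², so that `estDist`
within the threshold 3/16 implies a root mean square of at most 1/5, in units of L times the child's
width. -/
lemma two_mul_div_numNbr_le {ρ : Ball K} (hT : 2 ≤ π.p.T) (hL : 0 < π.p.L) (hσ : 0 < π.p.σ)
    (hρ : ρ.arms.Nonempty) :
    2 * π.p.σ ^ 2 / numNbr π.p ρ ≤ (1 / 25 - 9 / 256) * (π.p.L * (ρ.width / 2)) ^ 2 := by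
  have hk : (0 : ℝ) < numNbr π.p ρ := by exact_mod_cast numNbr_pos hT hL hσ hρ
  have h1 : (1 : ℝ) ≤ ρ.arms.card := by exact_mod_cast hρ.card_pos
  have h2 : (2 : ℝ) ≤ π.p.T := by exact_mod_cast hT
  have h3 : Real.log 2 ≤ Real.log ((π.p.T : ℝ) * ρ.arms.card) :=
    Real.log_le_log (by norm_num) (by nlinarith)
  have h4 := Real.log_two_gt_d9
  have h5 := Nat.le_ceil (5431 * π.p.σ ^ 2 * Real.log ((π.p.T : ℝ) * ρ.arms.card)
    / (π.p.L ^ 2 * ρ.width ^ 2))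
  have hw := ρ.width_pos
  change _ ≤ (numNbr π.p ρ : ℝ) at h5
  rw [div_le_iff₀ (by positivity)] at h5
  rw [div_le_iff₀ hk]
  have h6 : π.p.σ ^ 2 * (1 / 2) ≤ π.p.σ ^ 2 * Real.log ((π.p.T : ℝ) * ρ.arms.card) :=
    mul_le_mul_of_nonneg_left (by linarith) (by positivity)
  have h7 : 5431 / 2 * π.p.σ ^ 2 ≤ (numNbr π.p ρ : ℝ) * (π.p.L ^ 2 * ρ.width ^ 2) := by linarith
  nlinarith

/-- With w = LΔ/2, the estimated differences have root mean square at most w/5, hence mean at most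
w/5 by Cauchy–Schwarz. Passing to the true rewards costs twice 3LΔ/64, that is 3w/16, and 1/5 + 3/16
= 31/80. -/
lemma sum_grid_abs_le (hv : π.Valid) (hf : Regular π.p.L π.f) {t : ℕ} (hp : π.parts t)
    (hn : π.PartNoise t) {a y : Fin K} (ha : a ∈ (π.ball t).arms) (hy : y ∈ (π.ball t).arms)
    {j : ℕ} (hj : j < 2)
    (hd : estDist π.p (π.hist (t + 1)) (π.ball t) ((π.ball t).c0 + (π.ball t).width * j / 2)
      ((π.ball t).c0 + (π.ball t).width * (1 + j) / 2) a y
        ≤ 3 / 16 * π.p.L * ((π.ball t).width / 2)) :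
    ∑ i ∈ Finset.Icc (1 : ℕ) 200,
      |π.f a (gridPt (π.ball t) j i) - π.f y (gridPt (π.ball t) j i)|
      ≤ 200 * (31 / 80 * (π.p.L * ((π.ball t).width / 2))) := by
  set ρ := π.ball t with hρ
  set w := π.p.L * (ρ.width / 2) with hw
  have hwpos : 0 < w := by
    have := ρ.width_pos
    have := hv.hL
    positivity
  set g : ℕ → ℝ := fun i => knn (numNbr π.p ρ) (flaggedData (π.hist (t + 1)) ρ a) (gridPt ρ j i)
    - knn (numNbr π.p ρ) (flaggedData (π.hist (t + 1)) ρ y) (gridPt ρ j i) with hg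
  have hsq : ∑ i ∈ Finset.Icc (1 : ℕ) 200, (g i) ^ 2 ≤ 200 * (w / 5) ^ 2 := by
    unfold estDist at hd
    have h1 := Real.sqrt_le_left (by positivity) |>.1 (hd.trans (le_of_eq (by
      rw [hw]; ring : 3 / 16 * π.p.L * (ρ.width / 2) = 3 / 16 * w)))
    have h2 := two_mul_div_numNbr_le hv.hT hv.hL hv.hσ
      ((hv.inv t).nonempty _ (π.leaves_sub_ever (hv.ball_mem t)))
    rw [← hρ, ← hw] at h2
    change (1 / 200) * ∑ i ∈ Finset.Icc (1 : ℕ) 200, (g i) ^ 2 - _ ≤ _ at h1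
    nlinarith
  have habs : ∑ i ∈ Finset.Icc (1 : ℕ) 200, |g i| ≤ 200 * (w / 5) := by
    have := sq_sum_le_card_mul_sum_sq (s := Finset.Icc (1 : ℕ) 200) (f := fun i => |g i|)
    simp only [sq_abs, Nat.card_Icc] at this
    push_cast at this
    refine abs_le_of_sq_le_sq' ?_ (by positivity) |>.2
    nlinarith
  calc _ ≤ ∑ i ∈ Finset.Icc (1 : ℕ) 200, (|g i| + 3 / 16 * w) := by
        refine Finset.sum_le_sum fun i hi => ?_
        have h1 := abs_sub_knn_le hv hf hp hn ha hj hi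
        have h2 := abs_sub_knn_le hv hf hp hn hy hj hi
        rw [abs_sub_comm] at h1
        have h3 : π.f a (gridPt ρ j i) - π.f y (gridPt ρ j i) = g i +
          (π.f a (gridPt ρ j i) - knn (numNbr π.p ρ) (flaggedData (π.hist (t + 1)) ρ a)
            (gridPt ρ j i)) + (knn (numNbr π.p ρ) (flaggedData (π.hist (t + 1)) ρ y)
            (gridPt ρ j i) - π.f y (gridPt ρ j i)) := by rw [hg]; ring
        rw [h3]
        refine (abs_add_le _ _).trans ((add_le_add (abs_add_le _ _) le_rfl).trans ?_)
        rw [hw]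
        linarith
    _ = ∑ i ∈ Finset.Icc (1 : ℕ) 200, |g i| + 200 * (3 / 16 * w) := by
        rw [Finset.sum_add_distrib]; simp
    _ ≤ _ := by linarith

/-- For θ, u in [0,1] one has |θ - u| ≤ θ(1 - u) + u(1 - θ), which is affine in u. The sum of the
bounds over the grid is 100.5 - θ. -/
lemma sum_abs_grid_sub_le {θ : ℝ} (h0 : 0 ≤ θ) (h1 : θ ≤ 1) :
    ∑ i ∈ Finset.Icc (1 : ℕ) 200, |θ - (i : ℝ) / 200| ≤ 100.5 := by
  have hs : ∑ i ∈ Finset.Icc (1 : ℕ) 200, (i : ℝ) / 200 = 100.5 := by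
    rw [← Finset.sum_div]
    have key : ∀ n : ℕ, ∑ i ∈ Finset.Icc 1 n, (i : ℝ) = n * (n + 1) / 2 := by
      intro n
      induction n with
      | zero => simp
      | succ n ih => rw [Finset.sum_Icc_succ_top (by omega), ih]; push_cast; ring
    rw [key]; norm_num
  calc _ ≤ ∑ i ∈ Finset.Icc (1 : ℕ) 200, (θ + (1 - 2 * θ) * ((i : ℝ) / 200)) := by
        refine Finset.sum_le_sum fun i hi => ?_
        have h2 : (i : ℝ) / 200 ≤ 1 := by
          rw [div_le_one (by norm_num)]; exact_mod_cast (Finset.mem_Icc.1 hi).2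
        have h3 : (0 : ℝ) ≤ (i : ℝ) / 200 := by positivity
        rw [abs_le]
        constructor <;> nlinarith
    _ = 200 * θ + (1 - 2 * θ) * 100.5 := by
        rw [Finset.sum_add_distrib, ← Finset.mul_sum, hs]; simp
    _ ≤ _ := by linarith

/-- All rewards expected from a ball differ by at most `2 L Δ`. -/
def Tight (π : Path K) (ρ : Ball K) : Prop :=
  ∀ a ∈ ρ.arms, ∀ b ∈ ρ.arms, ∀ y z, ρ.Has y → ρ.Has z →
    |π.f a y - π.f b z| ≤ 2 * π.p.L * ρ.width

/-- Average over the grid points g the chain f_a(y), f_a(g), f_c(g), f_b(g), f_b(z), where c is the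
center of the cluster. In units of L times the child's width the outer steps average at most
100.5/200 each and the inner ones 31/80 each, in total 1.78 < 2. -/
lemma tight_of_kids (hv : π.Valid) (hf : Regular π.p.L π.f) {t : ℕ} (hp : π.parts t)
    (hn : π.PartNoise t) {ρ' : Ball K} (hk : ρ' ∈ π.kids t) : π.Tight ρ' := by
  obtain ⟨hch, c, hc, hclose⟩ := mem_subPartition _ _ _ _ hk
  rw [← hist_succ] at hclose
  set ρ := π.ball t with hρ
  -- The parity of the position tells which half of the parent the child occupies.
  set j := ρ'.pos % 2 with hj
  have hj2 : j < 2 := Nat.mod_lt _ (by norm_num)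
  have he : ρ' = ⟨ρ.level + 1, 2 * ρ.pos + j, ρ'.arms⟩ := by
    have h1 := hch.level
    have h2 : ρ'.pos = 2 * ρ.pos + j := by rw [← hch.pos]; omega
    rcases ρ' with ⟨l, q, A⟩
    simp only at h1 h2 ⊢
    rw [← h1, ← h2]
  have hc0 : ρ'.c0 = ρ.c0 + ρ.width * j / 2 := by rw [he]; exact half_c0 ρ j _
  have hc1 : ρ'.c1 = ρ.c0 + ρ.width * (1 + j) / 2 := by rw [he]; exact half_c1 ρ j _
  have hw' : ρ'.width = ρ.width / 2 := hch.width
  have hwpos := ρ.width_pos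
  have hL := hv.hL
  have hpos : ρ.pos < 2 ^ ρ.level :=
    Ball.pos_lt_of_has (hv.gen.mem t).1 (hv.gen.mem t).2 (hv.gen.irr t) (hv.ball_has t)
  have hsum : ∀ a ∈ ρ'.arms, ∑ i ∈ Finset.Icc (1 : ℕ) 200,
      |π.f a (gridPt ρ j i) - π.f c (gridPt ρ j i)|
      ≤ 200 * (31 / 80 * (π.p.L * (ρ.width / 2))) := by
    intro a ha
    rcases hclose a ha with rfl | h
    · simp only [sub_self, abs_zero, Finset.sum_const_zero]; positivity
    · rw [hc0, hc1, hw'] at h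
      exact sum_grid_abs_le hv hf hp hn (hch.arms ha) (hch.arms hc) hj2 h
  have hdist : ∀ y, ρ'.Has y → ∑ i ∈ Finset.Icc (1 : ℕ) 200, |y - gridPt ρ j i|
      ≤ (ρ.width / 2) * 100.5 := by
    intro y hy
    obtain ⟨h0, h1⟩ := hy
    rw [hc0] at h0
    rw [hc1] at h1
    set θ := (y - (ρ.c0 + ρ.width * j / 2)) / (ρ.width / 2) with hθ
    have hyθ : y = ρ.c0 + ρ.width * j / 2 + θ * (ρ.width / 2) := by rw [hθ]; field_simp; ring
    have h2 := sum_abs_grid_sub_le (θ := θ) (div_nonneg (by linarith) (by linarith))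
      (by rw [hθ, div_le_one (by positivity)]; linarith)
    refine le_trans (le_of_eq ?_) (mul_le_mul_of_nonneg_left h2 (by positivity : 0 ≤ ρ.width / 2))
    rw [Finset.mul_sum]
    refine Finset.sum_congr rfl fun i _ => ?_
    rw [gridPt_eq, hyθ]
    have : (ρ.c0 + ρ.width * j / 2 + θ * (ρ.width / 2) - (ρ.c0 + ρ.width * ((j : ℝ) / 2 + i / 400)))
      = ρ.width / 2 * (θ - i / 200) := by ring
    rw [this, abs_mul, abs_of_pos (by positivity : 0 < ρ.width / 2)]
  intro a ha b hb y z hy hz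
  have hy01 := has_mem_Icc hpos (hch.covers.has hy)
  have hz01 := has_mem_Icc hpos (hch.covers.has hz)
  have hmain : ∑ i ∈ Finset.Icc (1 : ℕ) 200, |π.f a y - π.f b z| ≤
      ∑ i ∈ Finset.Icc (1 : ℕ) 200, (π.p.L * |y - gridPt ρ j i|
        + |π.f a (gridPt ρ j i) - π.f c (gridPt ρ j i)|
        + |π.f b (gridPt ρ j i) - π.f c (gridPt ρ j i)| + π.p.L * |z - gridPt ρ j i|) := by
    refine Finset.sum_le_sum fun i hi => ?_
    have hg01 := has_mem_Icc hpos (gridPt_has (ρ := ρ) hj2 hi)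
    have h1 := hf.lip a y hy01 _ hg01
    have h2 := hf.lip b z hz01 _ hg01
    rw [abs_sub_comm (π.f b (gridPt ρ j i))]
    rw [abs_sub_comm (π.f b z)] at h2
    have h3 : π.f a y - π.f b z = (π.f a y - π.f a (gridPt ρ j i))
      + (π.f a (gridPt ρ j i) - π.f c (gridPt ρ j i))
      + (π.f c (gridPt ρ j i) - π.f b (gridPt ρ j i)) + (π.f b (gridPt ρ j i) - π.f b z) := by ring
    rw [h3]
    refine (abs_add_le _ _).trans (add_le_add ((abs_add_le _ _).trans (add_le_add
      ((abs_add_le _ _).trans (add_le_add h1 le_rfl)) le_rfl)) h2)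
  rw [Finset.sum_add_distrib, Finset.sum_add_distrib, Finset.sum_add_distrib, ← Finset.mul_sum,
    ← Finset.mul_sum, Finset.sum_const, Nat.card_Icc] at hmain
  have h1 := hsum a ha
  have h2 := hsum b hb
  have h3 := mul_le_mul_of_nonneg_left (hdist y hy) hL.le
  have h4 := mul_le_mul_of_nonneg_left (hdist z hz) hL.le
  norm_num at hmain h3 h4
  rw [hw']
  have : 0 < π.p.L * ρ.width := by positivity
  linarith

end Path

end

end ApproxZooming

/-! ### Confidence bounds and near-optimality of the balls -/

namespace ApproxZooming

noncomputable section

variable {K : ℕ}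

namespace Path

variable {π : Path K}

/-- The confidence bounds used in trial `t` hold. -/
def UcbNoise (π : Path K) (t : ℕ) : Prop :=
  ∀ ρ ∈ (π.state t).active, 0 < plays (π.hist t) ρ →
    |∑ s ∈ (Finset.range t).filter (fun s => π.ball s = ρ), π.ε s|
      ≤ Real.sqrt (6 * π.p.σ ^ 2 * Real.log π.p.T * plays (π.hist t) ρ)

/-- The noise is small wherever the algorithm uses it. -/
structure Good (π : Path K) : Prop where
  ucb : ∀ t < π.p.T, π.UcbNoise t
  part : ∀ t < π.p.T, π.PartNoise t

lemma Valid.ever_succ (hv : π.Valid) {t : ℕ} {ρ : Ball K} (h : ρ ∈ π.ever (t + 1)) :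
    ρ ∈ π.ever t ∨ (π.parts t ∧ ρ ∈ π.kids t) := by
  rcases π.ever_succ h with h | h
  · exact Or.inl h
  · by_cases hp : π.parts t
    · rcases ((hv.inv t).leaves_parts hp ρ).1 h with h | h
      · exact Or.inl (π.leaves_sub_ever h.1)
      · exact Or.inr ⟨hp, h⟩
    · rw [leaves_not_parts (hv.ball_mem t) hp] at h
      exact Or.inl (π.leaves_sub_ever h)

lemma ever_zero {ρ : Ball K} (h : ρ ∈ π.ever 0) : ρ = Ball.whole K := by
  obtain ⟨s, hs, h⟩ := h
  have : s = 0 := by omega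
  subst this
  simpa [leaves, state, run, State.init] using h

/-- The root starts flagged and active balls arise only as children, so `Good.tight` applies to all
of them. -/
lemma level_ne_zero_of_active {t : ℕ} {ρ : Ball K} (h : ρ ∈ (π.state t).active) :
    ρ.level ≠ 0 := by
  induction t with
  | zero => simp [state, run, State.init] at h
  | succ t ih =>
    by_cases hp : π.parts t
    · rw [(state_parts hp).1] at h
      rcases Finset.mem_union.1 h with h | h
      · exact ih h
      · rw [(isChild_of_kids h).level]; omega
    · by_cases hq : π.promotes t
      · rw [(state_promotes hq).1] at h; exact ih (Finset.mem_of_mem_erase h)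
      · rw [(state_same hp hq).1] at h; exact ih h

lemma Good.tight (hg : π.Good) (hv : π.Valid) (hf : Regular π.p.L π.f) {t : ℕ} (ht : t ≤ π.p.T)
    {ρ : Ball K} (h : ρ ∈ π.ever t) (hl : ρ.level ≠ 0) : π.Tight ρ := by
  induction t with
  | zero => rw [ever_zero h] at hl; exact absurd rfl hl
  | succ t ih =>
    rcases hv.ever_succ h with h | ⟨hp, h⟩
    · exact ih (by omega) h
    · exact tight_of_kids hv hf hp (hg.part t (by omega)) h

/-- The mean reward of an active ball is within its confidence radius. -/
lemma abs_meanReward_sub_le (hv : π.Valid) {t : ℕ} (hu : π.UcbNoise t) {ρ : Ball K}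
    (hρ : ρ ∈ (π.state t).active) (ht : π.Tight ρ) (hn : 0 < plays (π.hist t) ρ) {a : Fin K}
    (ha : a ∈ ρ.arms) {y : ℝ} (hy : ρ.Has y) :
    |meanReward (π.hist t) ρ - π.f a y| ≤ 2 * π.p.L * ρ.width
      + Real.sqrt (6 * π.p.σ ^ 2 * Real.log π.p.T / plays (π.hist t) ρ) := by
  have hn' : (0 : ℝ) < plays (π.hist t) ρ := by exact_mod_cast hn
  set n := plays (π.hist t) ρ with hndef
  set S := (Finset.range t).filter (fun s => π.ball s = ρ) with hS
  have hcard : S.card = n := by rw [hndef, plays_eq]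
  have hmean : meanReward (π.hist t) ρ = (∑ s ∈ S, π.rew s) / n := by
    unfold meanReward
    rw [filter_map_sum]
    rfl
  have h1 : |∑ s ∈ S, (π.f (π.arm s) (π.x s) - π.f a y)| ≤ n * (2 * π.p.L * ρ.width) := by
    refine (Finset.abs_sum_le_sum_abs _ _).trans ?_
    rw [← hcard, ← nsmul_eq_mul]
    refine Finset.sum_le_card_nsmul _ _ _ fun s hs => ?_
    have hb := (Finset.mem_filter.1 hs).2
    exact ht _ (hb ▸ hv.arm_mem s) _ ha _ _ (hb ▸ hv.ball_has s) hy
  have h2 := hu ρ hρ hn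
  have h3 : Real.sqrt (6 * π.p.σ ^ 2 * Real.log π.p.T * n)
      = n * Real.sqrt (6 * π.p.σ ^ 2 * Real.log π.p.T / n) := by
    have : 6 * π.p.σ ^ 2 * Real.log π.p.T * n =
        (n : ℝ) ^ 2 * (6 * π.p.σ ^ 2 * Real.log π.p.T / n) := by
      field_simp
    rw [this, Real.sqrt_mul (by positivity), Real.sqrt_sq hn'.le]
  have h4 : meanReward (π.hist t) ρ - π.f a y =
      (∑ s ∈ S, (π.f (π.arm s) (π.x s) - π.f a y) + ∑ s ∈ S, π.ε s) / n := by
    rw [hmean, eq_div_iff hn'.ne', sub_mul, div_mul_cancel₀ _ hn'.ne', Finset.sum_sub_distrib,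
      Finset.sum_const, hcard, nsmul_eq_mul, sub_add_eq_add_sub, ← Finset.sum_add_distrib]
    rw [mul_comm]; rfl
  rw [h4, abs_div, abs_of_pos hn', div_le_iff₀ hn']
  refine (abs_add_le _ _).trans ((add_le_add h1 h2).trans (le_of_eq ?_))
  rw [h3]; ring

/-- Every arm of `ρ` is within `c` widths of the best arm everywhere. -/
def Near (π : Path K) (c : ℝ) (ρ : Ball K) : Prop :=
  ∀ a ∈ ρ.arms, ∀ y, ρ.Has y → ∀ b, π.f b y ≤ π.f a y + c * π.p.L * ρ.width

lemma Valid.pos_lt (hv : π.Valid) (t : ℕ) : (π.ball t).pos < 2 ^ (π.ball t).level :=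
  Ball.pos_lt_of_has (hv.gen.mem t).1 (hv.gen.mem t).2 (hv.gen.irr t) (hv.ball_has t)

lemma abs_sub_le_width {ρ : Ball K} {y z : ℝ} (hy : ρ.Has y) (hz : ρ.Has z) :
    |y - z| ≤ ρ.width := by
  obtain ⟨h0, h1⟩ := hy
  obtain ⟨h2, h3⟩ := hz
  rw [Ball.c1_eq] at h1 h3
  rw [abs_le]; constructor <;> linarith

/-- Let ρ' be an active ball containing the context x and the arm b. Then f_b(x) ≤ UCB(ρ') ≤ UCB(ρ)
≤ f_a(x) + 4LΔ + 2r with the confidence radius r ≤ LΔ of ρ. Moving both rewards from x to y adds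
another 2LΔ, giving 8LΔ. -/
lemma Good.near_of_promotes (hg : π.Good) (hv : π.Valid) (hf : Regular π.p.L π.f) {t : ℕ}
    (ht : t < π.p.T) (hq : π.promotes t) : π.Near 8 (π.ball t) := by
  set ρ := π.ball t with hρ
  have hact : ρ ∈ (π.state t).active := (hv.not_flag_iff t).1 hq.1
  have hL := hv.hL
  have hw := ρ.width_pos
  have hT : (1 : ℝ) ≤ π.p.T := by exact_mod_cast (by have := hv.hT; omega : 1 ≤ π.p.T)
  have hlog := Real.log_nonneg hT
  have hthr : 0 ≤ π.thr ρ := by unfold thr; positivity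
  have hn : 0 < plays (π.hist t) ρ := by
    have := hthr.trans_lt hq.2
    exact_mod_cast this
  have hn' : (0 : ℝ) < plays (π.hist t) ρ := by exact_mod_cast hn
  -- The promotion threshold is the number of plays at which the confidence radius equals LΔ.
  have hconf : Real.sqrt (6 * π.p.σ ^ 2 * Real.log π.p.T / plays (π.hist t) ρ)
      ≤ π.p.L * ρ.width := by
    refine Real.sqrt_le_iff.2 ⟨by positivity, ?_⟩
    have := hq.2
    unfold thr at this
    rw [← hρ, div_lt_iff₀ (by positivity)] at this
    rw [div_le_iff₀ hn']
    nlinarith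
  have htight : ∀ ρ ∈ (π.state t).active, π.Tight ρ := fun ρ h =>
    hg.tight hv hf ht.le (π.leaves_sub_ever (Finset.mem_union_left _ h)) (level_ne_zero_of_active h)
  intro a ha y hy b
  have hy01 := has_mem_Icc (hv.pos_lt t) hy
  obtain ⟨ρ', h1, hb, hhas⟩ := (hv.inv t).cover b (π.x t) (hv.gen.mem t)
  have hact' : ρ' ∈ (π.state t).active := by
    rcases Finset.mem_union.1 h1 with h1 | h1
    · exact h1
    · exact absurd ⟨_, mem_containing.2 ⟨h1, hhas⟩⟩ hq.1
  have hmax := (π.ball_of_not_flag hq.1 ⟨ρ', h1, hhas⟩).2.2 ρ' hact' hhas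
  have hub := abs_le.1 (abs_meanReward_sub_le hv (hg.ucb t ht) hact (htight _ hact) hn ha
    (hv.ball_has t)) |>.2
  rw [← hρ] at hmax
  unfold ApproxZooming.ucb at hmax
  rw [if_neg hn.ne'] at hmax
  -- A ball never played has infinite index and could not lose against `ρ`, whose index is finite.
  by_cases hn0 : plays (π.hist t) ρ' = 0
  · rw [if_pos hn0] at hmax
    exact absurd (top_le_iff.1 hmax) (EReal.coe_ne_top _)
  rw [if_neg hn0, EReal.coe_le_coe_iff] at hmax
  have hlb := abs_le.1 (abs_meanReward_sub_le hv (hg.ucb t ht) hact' (htight _ hact')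
    (Nat.pos_of_ne_zero hn0) hb hhas) |>.1
  have h2 : π.f b (π.x t) ≤ π.f a (π.x t) + 6 * (π.p.L * ρ.width) := by linarith
  have h3 := abs_le.1 (hf.lip b y hy01 _ (hv.gen.mem t)) |>.2
  have h4 := abs_le.1 (hf.lip a y hy01 _ (hv.gen.mem t)) |>.1
  have h5 := mul_le_mul_of_nonneg_left (abs_sub_le_width hy (hv.ball_has t)) hL.le
  linarith

lemma Good.near_of_flagged (hg : π.Good) (hv : π.Valid) (hf : Regular π.p.L π.f) {t : ℕ}
    (ht : t ≤ π.p.T) {ρ : Ball K} (h : ρ ∈ (π.state t).flagged) (hl : ρ.level ≠ 0) :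
    π.Near 8 ρ := by
  induction t with
  | zero =>
    have : ρ = Ball.whole K := by simpa [state, run, State.init] using h
    rw [this] at hl
    exact absurd rfl hl
  | succ t ih =>
    by_cases hp : π.parts t
    · rw [(state_parts hp).2] at h; exact ih (by omega) (Finset.mem_of_mem_erase h)
    · by_cases hq : π.promotes t
      · rw [(state_promotes hq).2] at h
        rcases Finset.mem_insert.1 h with h | h
        · rw [h]; exact hg.near_of_promotes hv hf (by omega) hq
        · exact ih (by omega) h
      · rw [(state_same hp hq).2] at h; exact ih (by omega) h

/-- The parent was flagged and is not the root, hence within 8 of its own widths, which are 16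
widths of the child. At level 1 the parent is the root, about which nothing is known. -/
lemma Good.near (hg : π.Good) (hv : π.Valid) (hf : Regular π.p.L π.f) {t : ℕ}
    (ht : t ≤ π.p.T) {ρ : Ball K} (h : ρ ∈ π.ever t) (hl : 2 ≤ ρ.level) : π.Near 16 ρ := by
  induction t with
  | zero => rw [ever_zero h] at hl; exact absurd hl (by simp [Ball.whole])
  | succ t ih =>
    rcases hv.ever_succ h with h | ⟨hp, h⟩
    · exact ih (by omega) h
    · have hch := isChild_of_kids h
      have hfl := (π.ball_of_flag hp.1).1
      have hn := hg.near_of_flagged hv hf (by omega) hfl (by have := hch.level; omega)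
      intro a ha y hy b
      have := hn a (hch.arms ha) y (hch.covers.has hy) b
      rw [hch.width]
      linarith

/-! ### Regret of a single trial -/

lemma le_optReward (f : Fin K → ℝ → ℝ) (a : Fin K) (x : ℝ) : f a x ≤ optReward f x :=
  le_ciSup (f := fun a => f a x) (Set.finite_range _).bddAbove a

lemma optReward_le [Nonempty (Fin K)] {f : Fin K → ℝ → ℝ} {x c : ℝ} (h : ∀ a, f a x ≤ c) :
    optReward f x ≤ c := ciSup_le h

lemma gap_le_of_ne {f : Fin K → ℝ → ℝ} {a : Fin K} {x : ℝ} (h : f a x ≠ optReward f x) :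
    gap f x ≤ optReward f x - f a x := by
  unfold gap
  have := le_ciSup (f := fun a => if f a x ≠ optReward f x then f a x else 0)
    (Set.finite_range _).bddAbove a
  simp only [if_pos h] at this
  linarith

/-- The regret of trial `t`. -/
def loss (π : Path K) (t : ℕ) : ℝ := optReward π.f (π.x t) - π.f (π.arm t) (π.x t)

lemma regret_eq_sum_loss :
    regret π.p π.R π.f π.x π.ε = ∑ t ∈ Finset.range π.p.T, π.loss t := rfl

lemma loss_nonneg (π : Path K) (t : ℕ) : 0 ≤ π.loss t := sub_nonneg.2 (le_optReward _ _ _)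

lemma loss_le_one [Nonempty (Fin K)] {L : ℝ} (hf : Regular L π.f) {t : ℕ}
    (hx : π.x t ∈ Set.Icc (0 : ℝ) 1) : π.loss t ≤ 1 := by
  have h1 : optReward π.f (π.x t) ≤ 1 := optReward_le fun a => (hf.bdd a _ hx).2
  have h2 := (hf.bdd (π.arm t) _ hx).1
  unfold loss
  linarith

/-- The interval at position `l` of level `i` contributes to `M_i`. -/
def Contributes (L : ℝ) (f : Fin K → ℝ → ℝ) (i l : ℕ) : Prop :=
  ∃ x ∈ Set.Icc (((l : ℝ) - 1) / 2 ^ i) ((l : ℝ) / 2 ^ i), gap f x ≤ 20 * L / 2 ^ i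

/-- Arm `a` is nearly optimal at the right end of the interval at position `l` of level `i`. -/
def NearOpt (L : ℝ) (f : Fin K → ℝ → ℝ) (i l : ℕ) (a : Fin K) : Prop :=
  optReward f ((l : ℝ) / 2 ^ i) - f a ((l : ℝ) / 2 ^ i) ≤ 22 * L / 2 ^ i

/-- A nonzero loss means that the arm is suboptimal at the context, so the gap there is at most the
loss. The right end of the interval belongs to the ball, so the arm is nearly optimal there too; 16
is below both 20 and 22. The `+ 1` appears because M_i labels an interval by its right end. -/
lemma Good.loss_cases (hg : π.Good) (hv : π.Valid) (hf : Regular π.p.L π.f) {t : ℕ}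
    (ht : t < π.p.T) (hl : 2 ≤ (π.ball t).level) :
    π.loss t ≤ 16 * π.p.L / 2 ^ (π.ball t).level ∧
    (π.loss t = 0 ∨ (Contributes π.p.L π.f (π.ball t).level ((π.ball t).pos + 1) ∧
      NearOpt π.p.L π.f (π.ball t).level ((π.ball t).pos + 1) (π.arm t))) := by
  have := hv.hK
  set ρ := π.ball t with hρ
  have hnear := hg.near hv hf ht.le (π.leaves_sub_ever (hv.ball_mem t)) hl
  rw [← hρ] at hnear
  have harm := hv.arm_mem t
  have hhas := hv.ball_has t
  rw [← hρ] at harm hhas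
  have hopt : ∀ y, ρ.Has y → optReward π.f y - π.f (π.arm t) y ≤ 16 * π.p.L / 2 ^ ρ.level := by
    intro y hy
    have h1 := optReward_le (hnear _ harm y hy)
    rw [Ball.width_eq, mul_one_div] at h1
    linarith
  have hpow : (0 : ℝ) < 2 ^ ρ.level := by positivity
  have hL := hv.hL
  have hc1 : ρ.c1 = (((ρ.pos + 1 : ℕ) : ℝ)) / 2 ^ ρ.level := by unfold Ball.c1; push_cast; rfl
  refine ⟨hopt _ hhas, ?_⟩
  by_cases he : π.f (π.arm t) (π.x t) = optReward π.f (π.x t)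
  · left; unfold loss; rw [he]; ring
  · right
    constructor
    · refine ⟨π.x t, ⟨?_, ?_⟩, ?_⟩
      · have := hhas.1
        unfold Ball.c0 at this
        push_cast
        simpa using this
      · rw [← hc1]; exact hhas.2
      · refine (gap_le_of_ne he).trans ((hopt _ hhas).trans ?_)
        gcongr
        norm_num
    · unfold NearOpt
      rw [← hc1]
      refine (hopt _ ⟨?_, le_rfl⟩).trans ?_
      · rw [Ball.c1_eq]; linarith [ρ.width_pos]
      · gcongr
        norm_num

end Path

end

end ApproxZooming

/-! ### Counting plays, and the regret on a good path -/

namespace ApproxZooming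

noncomputable section

variable {K : ℕ}

namespace Path

variable {π : Path K}

/-- In trial `t` the arm `a` of a ball at level `i` and position `l` is played. -/
def At (π : Path K) (i l : ℕ) (a : Fin K) (t : ℕ) : Prop :=
  (π.ball t).level = i ∧ (π.ball t).pos = l ∧ π.arm t = a

/-- A flagged ball at level `i` and position `l` is selected, arm `a` is played, and the
`j`-th part of the ball still lacks samples of `a`. -/
def Lacks (π : Path K) (i l : ℕ) (a : Fin K) (j t : ℕ) : Prop :=
  π.At i l a t ∧ π.flag t ∧ π.partCount t (π.ball t) a j < numNbr π.p (π.ball t)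

/-- A bound for the number of plays of an active ball of level `i`. -/
def actBound (p : Params) (i : ℕ) : ℝ :=
  6 * p.σ ^ 2 * Real.log p.T / (p.L ^ 2 * (1 / 2 ^ i) ^ 2) + 2

/-- A bound for the number of nearest neighbours at level `i`. -/
def nbrBound (p : Params) (K i : ℕ) : ℝ :=
  5431 * p.σ ^ 2 * Real.log (p.T * K) / (p.L ^ 2 * (1 / 2 ^ i) ^ 2) + 1

/-- By `uniq` all plays of an arm at a given level and position belong to one ball, so bounds per
ball become bounds per triple (i, l, a). -/
lemma Valid.ball_eq (hv : π.Valid) {i l s t : ℕ} {a : Fin K} (hs : π.At i l a s)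
    (ht : π.At i l a t) : π.ball s = π.ball t := by
  refine (hv.inv (max s t)).uniq _
    (π.ever_mono (le_max_left _ _) (π.leaves_sub_ever (hv.ball_mem s)))
    _ (π.ever_mono (le_max_right _ _) (π.leaves_sub_ever (hv.ball_mem t)))
    (hs.1.trans ht.1.symm) (hs.2.1.trans ht.2.1.symm) ⟨a, ?_, ?_⟩
  · rw [← hs.2.2]; exact hv.arm_mem s
  · rw [← ht.2.2]; exact hv.arm_mem t

lemma numNbr_le (hv : π.Valid) {ρ : Ball K} (hρ : ρ.arms.Nonempty) :
    (numNbr π.p ρ : ℝ) ≤ nbrBound π.p K ρ.level := by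
  have hT : (2 : ℝ) ≤ π.p.T := by exact_mod_cast hv.hT
  have h1 : (1 : ℝ) ≤ ρ.arms.card := by exact_mod_cast hρ.card_pos
  have h2 : (ρ.arms.card : ℝ) ≤ K := by
    have := Finset.card_le_univ ρ.arms
    rw [Fintype.card_fin] at this
    exact_mod_cast this
  have h3 : 0 ≤ Real.log ((π.p.T : ℝ) * ρ.arms.card) := Real.log_nonneg (by nlinarith)
  have h4 : Real.log ((π.p.T : ℝ) * ρ.arms.card) ≤ Real.log ((π.p.T : ℝ) * K) :=
    Real.log_le_log (by positivity) (by gcongr)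
  have hw := ρ.width_pos
  have hL := hv.hL
  unfold numNbr nbrBound
  refine (Nat.ceil_lt_add_one (by positivity)).le.trans ?_
  rw [← Ball.width_eq]
  gcongr

open Classical in
-- In the last such trial the ball is still active, so its earlier plays number at most `thr + 1`;
-- the last trial adds one more.
lemma Valid.card_active_le (hv : π.Valid) (i l : ℕ) (a : Fin K) (n : ℕ) :
    (((Finset.range n).filter (fun t => π.At i l a t ∧ ¬ π.flag t)).card : ℝ)
      ≤ actBound π.p i := by
  set S := (Finset.range n).filter (fun t => π.At i l a t ∧ ¬ π.flag t) with hS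
  have hT : (1 : ℝ) ≤ π.p.T := by exact_mod_cast (by have := hv.hT; omega : 1 ≤ π.p.T)
  have hlog := Real.log_nonneg hT
  rcases S.eq_empty_or_nonempty with h | h
  · rw [h]; unfold actBound; simp; positivity
  · have hm := S.max'_mem h
    set t := S.max' h with ht
    obtain ⟨hat, hfl⟩ := (Finset.mem_filter.1 hm).2
    have hsub : S.erase t ⊆ (Finset.range t).filter (fun s => π.ball s = π.ball t) := by
      intro s hs
      obtain ⟨hne, hs⟩ := Finset.mem_erase.1 hs
      refine Finset.mem_filter.2 ⟨Finset.mem_range.2 (lt_of_le_of_ne (S.le_max' s hs) hne), ?_⟩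
      exact hv.ball_eq (Finset.mem_filter.1 hs).2.1 hat
    have hc := Finset.card_le_card hsub
    rw [Finset.card_erase_of_mem hm, ← plays_eq] at hc
    have hpl := (hv.inv t).active_plays _ ((hv.not_flag_iff t).1 hfl)
    have hc' : (S.card : ℝ) ≤ plays (π.hist t) (π.ball t) + 1 := by
      exact_mod_cast (by omega : S.card ≤ plays (π.hist t) (π.ball t) + 1)
    unfold thr at hpl
    rw [Ball.width_eq, hat.1] at hpl
    unfold actBound
    linarith

open Classical in
-- At the last hit the part still holds fewer than k samples, and every earlier hit is one of them.
lemma Valid.card_hits_le (hv : π.Valid) (i l : ℕ) (a : Fin K) (j n : ℕ) :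
    (((Finset.range n).filter (fun t => π.Lacks i l a j t ∧ inPart (π.ball t) j (π.x t))).card : ℝ)
      ≤ nbrBound π.p K i := by
  set S := (Finset.range n).filter (fun t => π.Lacks i l a j t ∧ inPart (π.ball t) j (π.x t))
    with hS
  have hT : (1 : ℝ) ≤ π.p.T := by exact_mod_cast (by have := hv.hT; omega : 1 ≤ π.p.T)
  have hK : (1 : ℝ) ≤ K := by exact_mod_cast (Fin.pos_iff_nonempty.2 hv.hK)
  have hlog := Real.log_nonneg (by nlinarith : (1 : ℝ) ≤ π.p.T * K)
  rcases S.eq_empty_or_nonempty with h | h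
  · rw [h]; unfold nbrBound; simp; positivity
  · have hm := S.max'_mem h
    set t := S.max' h with ht
    obtain ⟨⟨hat, hfl, hlt⟩, hin⟩ := (Finset.mem_filter.1 hm).2
    have hsub : S.erase t ⊆ (π.samples t (π.ball t) a).filter
        (fun s => inPart (π.ball t) j (π.x s)) := by
      intro s hs
      obtain ⟨hne, hs⟩ := Finset.mem_erase.1 hs
      obtain ⟨⟨hat', hfl', _⟩, hin'⟩ := (Finset.mem_filter.1 hs).2
      have he := hv.ball_eq hat' hat
      refine Finset.mem_filter.2 ⟨π.mem_samples.2 ⟨lt_of_le_of_ne (S.le_max' s hs) hne, he,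
        hat'.2.2, hfl'⟩, he ▸ hin'⟩
    have hc := Finset.card_le_card hsub
    rw [Finset.card_erase_of_mem hm] at hc
    change _ ≤ π.partCount t (π.ball t) a j at hc
    have h1 := numNbr_le hv ((hv.inv t).nonempty _ (π.leaves_sub_ever (hv.ball_mem t)))
    rw [hat.1] at h1
    have h2 : (S.card : ℝ) ≤ numNbr π.p (π.ball t) := by
      exact_mod_cast (by omega : S.card ≤ numNbr π.p (π.ball t))
    exact h2.trans h1

open Classical in
-- In a flagged trial the played arm has insufficient data, so one of the 64 parts lacks samples.
-- Neither the path nor goodness bounds the lacking trials; they are left for the expectation.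
lemma Valid.card_at_le (hv : π.Valid) (i l : ℕ) (a : Fin K) (n : ℕ) :
    (((Finset.range n).filter (fun t => π.At i l a t)).card : ℝ) ≤ actBound π.p i
      + ∑ j ∈ Finset.Icc (1 : ℕ) 64,
        (((Finset.range n).filter (fun t => π.Lacks i l a j t)).card : ℝ) := by
  obtain ⟨J, hJ⟩ : ∃ J, J = Finset.Icc (1 : ℕ) 64 := ⟨_, rfl⟩
  rw [← hJ]
  have hsub : (Finset.range n).filter (fun t => π.At i l a t) ⊆
      (Finset.range n).filter (fun t => π.At i l a t ∧ ¬ π.flag t) ∪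
      J.biUnion
        (fun j => (Finset.range n).filter (fun t => π.Lacks i l a j t)) := by
    intro t ht
    obtain ⟨htn, hat⟩ := Finset.mem_filter.1 ht
    by_cases hf : π.flag t
    · have h := (hv.arm_of_flag hf).2
      rw [suffData_iff, ← hJ] at h
      push Not at h
      obtain ⟨j, hj, hlt⟩ := h
      rw [hat.2.2] at hlt
      exact Finset.mem_union_right _ (Finset.mem_biUnion.2 ⟨j, hj, Finset.mem_filter.2
        ⟨htn, hat, hf, hlt⟩⟩)
    · exact Finset.mem_union_left _ (Finset.mem_filter.2 ⟨htn, hat, hf⟩)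
  have h1 := (Finset.card_le_card hsub).trans ((Finset.card_union_le _ _).trans
    (add_le_add le_rfl Finset.card_biUnion_le))
  have h2 := hv.card_active_le i l a n
  have h3 : (((Finset.range n).filter (fun t => π.At i l a t)).card : ℝ) ≤
    ((Finset.range n).filter (fun t => π.At i l a t ∧ ¬ π.flag t)).card
      + ∑ j ∈ J, (((Finset.range n).filter (fun t => π.Lacks i l a j t)).card : ℝ) := by
    exact_mod_cast h1
  linarith

open Classical in
/-- The weight with which the plays of arm `a` at level `i` and position `l` enter the bound. -/
def weight (L : ℝ) (f : Fin K → ℝ → ℝ) (m i l : ℕ) (a : Fin K) : ℝ :=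
  if i < 2 then 1 else
    if i < m ∧ Contributes L f i (l + 1) ∧ NearOpt L f i (l + 1) a then 16 * L / 2 ^ i else 0

lemma weight_nonneg {L : ℝ} (hL : 0 ≤ L) (f : Fin K → ℝ → ℝ) (m i l : ℕ) (a : Fin K) :
    0 ≤ weight L f m i l a := by
  unfold weight; split_ifs <;> positivity

lemma Good.loss_le (hg : π.Good) (hv : π.Valid) (hf : Regular π.p.L π.f) {t : ℕ}
    (ht : t < π.p.T) (m : ℕ) : π.loss t ≤
      weight π.p.L π.f m (π.ball t).level (π.ball t).pos (π.arm t) + 16 * π.p.L / 2 ^ m := by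
  have := hv.hK
  have hL := hv.hL
  have hm : 0 ≤ 16 * π.p.L / 2 ^ m := by positivity
  have hw := weight_nonneg hL.le π.f m (π.ball t).level (π.ball t).pos (π.arm t)
  rcases Nat.lt_or_ge (π.ball t).level 2 with hl | hl
  · have := loss_le_one hf (hv.gen.mem t)
    unfold weight
    rw [if_pos hl]
    linarith
  · obtain ⟨h1, h2⟩ := hg.loss_cases hv hf ht hl
    rcases h2 with h2 | h2
    · linarith
    · rcases Nat.lt_or_ge (π.ball t).level m with hlm | hlm
      · unfold weight
        rw [if_neg (by omega), if_pos ⟨hlm, h2⟩]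
        linarith
      · have : 16 * π.p.L / 2 ^ (π.ball t).level ≤ 16 * π.p.L / 2 ^ m := by
          gcongr
          norm_num
        linarith

open Classical in
/-- The bound for the regret on a good path. -/
lemma Good.regret_le (hg : π.Good) (hv : π.Valid) (hf : Regular π.p.L π.f) (m : ℕ) :
    regret π.p π.R π.f π.x π.ε ≤ ∑ i ∈ Finset.range (m + 2), ∑ l ∈ Finset.range (2 ^ i), ∑ a,
      weight π.p.L π.f m i l a * (actBound π.p i + ∑ j ∈ Finset.Icc (1 : ℕ) 64,
        (((Finset.range π.p.T).filter (fun t => π.Lacks i l a j t)).card : ℝ))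
      + 16 * π.p.L * π.p.T / 2 ^ m := by
  have hL := hv.hL
  rw [regret_eq_sum_loss]
  have h1 : ∑ t ∈ Finset.range π.p.T, π.loss t ≤ ∑ t ∈ Finset.range π.p.T,
      (weight π.p.L π.f m (π.ball t).level (π.ball t).pos (π.arm t) + 16 * π.p.L / 2 ^ m) :=
    Finset.sum_le_sum fun t ht => hg.loss_le hv hf (Finset.mem_range.1 ht) m
  refine h1.trans ?_
  rw [Finset.sum_add_distrib, Finset.sum_const, Finset.card_range, nsmul_eq_mul]
  have h2 : (π.p.T : ℝ) * (16 * π.p.L / 2 ^ m) = 16 * π.p.L * π.p.T / 2 ^ m := by ring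
  rw [h2]
  refine add_le_add ?_ le_rfl
  -- The range `m + 2` contains levels 0 and 1 as well as all levels below m; elsewhere the weight
  -- vanishes.
  have h3 : ∀ t, weight π.p.L π.f m (π.ball t).level (π.ball t).pos (π.arm t) ≤
      ∑ i ∈ Finset.range (m + 2), ∑ l ∈ Finset.range (2 ^ i), ∑ a,
        weight π.p.L π.f m i l a * (if π.At i l a t then 1 else 0) := by
    intro t
    have hnn : ∀ i l a, 0 ≤ weight π.p.L π.f m i l a * (if π.At i l a t then (1 : ℝ) else 0) :=
      fun i l a => mul_nonneg (weight_nonneg hL.le _ _ _ _ _) (by split_ifs <;> norm_num)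
    by_cases hi : (π.ball t).level < m + 2
    · have e : weight π.p.L π.f m (π.ball t).level (π.ball t).pos (π.arm t) =
          weight π.p.L π.f m (π.ball t).level (π.ball t).pos (π.arm t) *
            (if π.At (π.ball t).level (π.ball t).pos (π.arm t) t then (1 : ℝ) else 0) := by
        rw [if_pos ⟨rfl, rfl, rfl⟩, mul_one]
      rw [e]
      refine le_trans ?_ (Finset.single_le_sum (f := fun i => ∑ l ∈ Finset.range (2 ^ i), ∑ a,
        weight π.p.L π.f m i l a * (if π.At i l a t then (1 : ℝ) else 0))
        (fun i _ => Finset.sum_nonneg fun l _ => Finset.sum_nonneg fun a _ => hnn i l a)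
        (Finset.mem_range.2 hi))
      refine le_trans ?_ (Finset.single_le_sum (f := fun l => ∑ a,
        weight π.p.L π.f m (π.ball t).level l a *
          (if π.At (π.ball t).level l a t then (1 : ℝ) else 0))
        (fun l _ => Finset.sum_nonneg fun a _ => hnn _ l a)
        (Finset.mem_range.2 (hv.pos_lt t)))
      exact Finset.single_le_sum (f := fun a =>
        weight π.p.L π.f m (π.ball t).level (π.ball t).pos a *
          (if π.At (π.ball t).level (π.ball t).pos a t then (1 : ℝ) else 0))
        (fun a _ => hnn _ _ a) (Finset.mem_univ _)
    · have : weight π.p.L π.f m (π.ball t).level (π.ball t).pos (π.arm t) = 0 := by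
        unfold weight
        rw [if_neg (by omega), if_neg (by omega)]
      rw [this]
      exact Finset.sum_nonneg fun i _ => Finset.sum_nonneg fun l _ =>
        Finset.sum_nonneg fun a _ => hnn i l a
  refine (Finset.sum_le_sum fun t _ => h3 t).trans ?_
  rw [Finset.sum_comm]
  refine Finset.sum_le_sum fun i _ => ?_
  rw [Finset.sum_comm]
  refine Finset.sum_le_sum fun l _ => ?_
  rw [Finset.sum_comm]
  refine Finset.sum_le_sum fun a _ => ?_
  rw [← Finset.mul_sum, Finset.sum_boole]
  exact mul_le_mul_of_nonneg_left (hv.card_at_le i l a _) (weight_nonneg hL.le _ _ _ _ _)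

/-- Whether a flagged ball is selected, and which one, is the same for all contexts in the
interior of its context interval. -/
lemma flagged_select_congr {p : Params} {R : Rules K} {st : State K} {x y : ℝ} (hx0 : 0 ≤ x)
    (hx : Irrational x) {i l : ℕ} (hxl : ⌊x * 2 ^ i⌋₊ = l) (hy0 : 0 ≤ y)
    (hy : Irrational y) (hyl : ⌊y * 2 ^ i⌋₊ = l) (hflag : flaggedPhase st x)
    (hi : (selectBall p R st x).level = i) :
    flaggedPhase st y ∧ selectBall p R st y = selectBall p R st x := by
  -- Two contexts in one cell of level i lie in the same cells of all coarser levels.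
  have hiff : ∀ ρ : Ball K, ρ.level ≤ i → (ρ.Has x ↔ ρ.Has y) := by
    intro ρ hρ
    rw [ρ.has_iff_floor hx0 hx, ρ.has_iff_floor hy0 hy]
    have key : ∀ z : ℝ, ⌊z * 2 ^ ρ.level⌋₊ = ⌊z * 2 ^ i⌋₊ / 2 ^ (i - ρ.level) := by
      intro z
      rw [← Nat.floor_div_natCast]
      congr 1
      push_cast
      rw [eq_div_iff (by positivity), mul_assoc, ← pow_add]
      congr 2
      omega
    rw [key, key, hxl, hyl]
  have hsel : ∀ z, flaggedPhase st z → selectBall p R st z = R.pickBall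
      ((containing st.flagged z).filter
        (fun ρ => ∀ ρ' ∈ containing st.flagged z, ρ'.width ≤ ρ.width)) := by
    intro z hz
    unfold selectBall
    rw [if_pos hz]
  set W := fun z => (containing st.flagged z).filter
        (fun ρ => ∀ ρ' ∈ containing st.flagged z, ρ'.width ≤ ρ.width) with hW
  have hWne : (W x).Nonempty := by
    obtain ⟨ρ, hρ, hm⟩ := Finset.exists_max_image _ Ball.width hflag
    exact ⟨ρ, Finset.mem_filter.2 ⟨hρ, hm⟩⟩
  have hmem := R.pickBall_mem _ hWne
  have hmem' : selectBall p R st x ∈ W x := by rw [hsel x hflag]; exact hmem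
  obtain ⟨hm1, hm2⟩ := Finset.mem_filter.1 hmem'
  have hmin : ∀ ρ ∈ containing st.flagged x, i ≤ ρ.level := by
    intro ρ hρ
    rw [← hi]
    exact Ball.width_le_width.1 (hm2 ρ hρ)
  -- A coarser flagged ball containing y would also contain x and be wider than the selected one.
  have hminy : ∀ ρ ∈ containing st.flagged y, i ≤ ρ.level := by
    intro ρ hρ
    by_contra hlt
    push Not at hlt
    obtain ⟨h1, h2⟩ := mem_containing.1 hρ
    have := hmin ρ (mem_containing.2 ⟨h1, (hiff ρ hlt.le).2 h2⟩)
    omega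
  have hmemy : selectBall p R st x ∈ containing st.flagged y := by
    obtain ⟨h1, h2⟩ := mem_containing.1 hm1
    exact mem_containing.2 ⟨h1, (hiff _ hi.le).1 h2⟩
  have hfy : flaggedPhase st y := ⟨_, hmemy⟩
  refine ⟨hfy, ?_⟩
  have hWx : ∀ ρ, ρ ∈ W x ↔ ρ ∈ containing st.flagged x ∧ ρ.level = i := by
    intro ρ
    rw [hW, Finset.mem_filter]
    refine and_congr_right fun hρ => ⟨fun h => ?_, fun h ρ' hρ' => ?_⟩
    · have := Ball.width_le_width.1 (h _ hm1)
      rw [hi] at this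
      exact le_antisymm this (hmin ρ hρ)
    · rw [Ball.width_le_width, h]; exact hmin ρ' hρ'
  have hWy : ∀ ρ, ρ ∈ W y ↔ ρ ∈ containing st.flagged y ∧ ρ.level = i := by
    intro ρ
    rw [hW, Finset.mem_filter]
    refine and_congr_right fun hρ => ⟨fun h => ?_, fun h ρ' hρ' => ?_⟩
    · have := Ball.width_le_width.1 (h _ hmemy)
      rw [hi] at this
      exact le_antisymm this (hminy ρ hρ)
    · rw [Ball.width_le_width, h]; exact hminy ρ' hρ'
  have : W y = W x := by
    ext ρ
    rw [hWx, hWy, mem_containing, mem_containing]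
    constructor
    · rintro ⟨⟨h1, h2⟩, h3⟩
      exact ⟨⟨h1, (hiff ρ h3.le).2 h2⟩, h3⟩
    · rintro ⟨⟨h1, h2⟩, h3⟩
      exact ⟨⟨h1, (hiff ρ h3.le).1 h2⟩, h3⟩
  rw [hsel x hflag, hsel y hfy]
  exact congrArg R.pickBall this

end Path

end

end ApproxZooming

/-! ### Rewards collected in the flagged phase stay unused until the partition -/

namespace ApproxZooming

noncomputable section

variable {K : ℕ}

/-- Forget the reward of a trial in which `ρ` was selected while flagged. -/
def mask (ρ : Ball K) (s : Trial K) : Trial K :=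
  if s.ball = ρ ∧ s.inFlagged = true then ⟨s.ball, s.arm, s.ctx, 0, s.inFlagged⟩ else s

@[simp] lemma mask_ball (ρ : Ball K) (s : Trial K) : (mask ρ s).ball = s.ball := by
  unfold mask; split_ifs <;> rfl
@[simp] lemma mask_arm (ρ : Ball K) (s : Trial K) : (mask ρ s).arm = s.arm := by
  unfold mask; split_ifs <;> rfl
@[simp] lemma mask_ctx (ρ : Ball K) (s : Trial K) : (mask ρ s).ctx = s.ctx := by
  unfold mask; split_ifs <;> rfl
@[simp] lemma mask_inFlagged (ρ : Ball K) (s : Trial K) :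
    (mask ρ s).inFlagged = s.inFlagged := by
  unfold mask; split_ifs <;> rfl
lemma mask_of_ne {ρ : Ball K} {s : Trial K} (h : s.ball ≠ ρ) : mask ρ s = s := by
  unfold mask; rw [if_neg (fun h' => h h'.1)]

lemma plays_mask (ρ : Ball K) (h : List (Trial K)) (ρ' : Ball K) :
    plays (h.map (mask ρ)) ρ' = plays h ρ' := by
  unfold plays
  rw [List.filter_map, List.length_map]
  simp [Function.comp_def]

lemma meanReward_mask {ρ ρ' : Ball K} (hne : ρ' ≠ ρ) (h : List (Trial K)) :
    meanReward (h.map (mask ρ)) ρ' = meanReward h ρ' := by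
  unfold meanReward
  rw [plays_mask, List.filter_map, List.map_map]
  simp only [Function.comp_def, mask_ball]
  congr 2
  refine List.map_congr_left fun s hs => ?_
  have : s.ball = ρ' := by simpa using (List.mem_filter.1 hs).2
  rw [mask_of_ne (this ▸ hne)]

lemma flaggedData_mask {ρ ρ' : Ball K} (hne : ρ' ≠ ρ) (h : List (Trial K)) (a : Fin K) :
    flaggedData (h.map (mask ρ)) ρ' a = flaggedData h ρ' a := by
  unfold flaggedData
  rw [List.filter_map, List.map_map]
  simp only [Function.comp_def, mask_ball, mask_arm, mask_inFlagged, mask_ctx]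
  refine List.map_congr_left fun s hs => ?_
  have := (List.mem_filter.1 hs).2
  have : s.ball = ρ' := by simp at this; exact this.1
  rw [mask_of_ne (this ▸ hne)]

/-- Sufficiency of data is a matter of contexts, which the mask keeps; this holds also for `ρ' = ρ`.
-/
lemma suffData_mask (p : Params) (ρ : Ball K) (h : List (Trial K)) (ρ' : Ball K) (a : Fin K) :
    SuffData p (h.map (mask ρ)) ρ' a ↔ SuffData p h ρ' a := by
  unfold SuffData
  refine forall₂_congr fun j _ => ?_
  unfold flaggedData
  simp only [List.filter_map, List.length_map, Function.comp_def, mask_ball, mask_arm,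
    mask_inFlagged, mask_ctx]

lemma subPartition_congr (p : Params) (R : Rules K) {h h' : List (Trial K)} {ρ : Ball K}
    (hd : ∀ a, flaggedData h ρ a = flaggedData h' ρ a) :
    subPartition p R h ρ = subPartition p R h' ρ := by
  have : ∀ u v, estDist p h ρ u v = estDist p h' ρ u v := by
    intro u v
    funext a a'
    unfold estDist
    rw [hd, hd]
  unfold subPartition halfPartition
  simp only [this]

namespace Path

variable {π π' : Path K}

/-- The states of two runs agree except for rewards of `ρ` obtained while it was flagged. -/
structure Agree (π π' : Path K) (ρ : Ball K) (n : ℕ) : Prop where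
  active : (π.state n).active = (π'.state n).active
  flagged : (π.state n).flagged = (π'.state n).flagged
  hist : (π.hist n).map (mask ρ) = (π'.hist n).map (mask ρ)

/-- Two realizations which differ at most in the noise. -/
structure SameInput (π π' : Path K) : Prop where
  p : π.p = π'.p
  R : π.R = π'.R
  f : π.f = π'.f
  x : π.x = π'.x

lemma Agree.flag {ρ : Ball K} {n : ℕ} (h : Agree π π' ρ n) (hs : SameInput π π') :
    π.flag n ↔ π'.flag n := by
  unfold Path.flag flaggedPhase
  rw [h.flagged, hs.x]

/-- The index of a ball other than ρ is a function of the masked history. If ρ itself is active, it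
has not yet been selected while flagged, and the mask removes nothing. -/
lemma Agree.ball {ρ : Ball K} {n : ℕ} (h : Agree π π' ρ n) (hs : SameInput π π')
    (hv : π.Valid) : π.ball n = π'.ball n := by
  have hf := h.flag hs
  unfold Path.ball selectBall
  by_cases hfl : π.flag n
  · have h1 : flaggedPhase (π.state n) (π.x n) := hfl
    have h2 : flaggedPhase (π'.state n) (π'.x n) := hf.1 hfl
    rw [if_pos h1, if_pos h2, h.flagged, hs.x, hs.R]
  · have h1 : ¬ flaggedPhase (π.state n) (π.x n) := hfl
    have h2 : ¬ flaggedPhase (π'.state n) (π'.x n) := fun h' => hfl (hf.2 h')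
    rw [if_neg h1, if_neg h2]
    have hucb : ∀ ρ' ∈ (π.state n).active, ucb π.p (π.hist n) ρ' = ucb π'.p (π'.hist n) ρ' := by
      intro ρ' hρ'
      by_cases e : ρ' = ρ
      · have hno : ∀ s ∈ π.hist n, ¬ (s.ball = ρ ∧ s.inFlagged = true) := by
          have key : ∀ m, m ≤ n → ∀ s ∈ π.hist m, ∃ u < n, s = π.trial u := by
            intro m
            induction m with
            | zero => intro _ s hs'; rw [hist_zero] at hs'; simp at hs'
            | succ m ih =>
              intro hm s hs'
              rw [hist_succ] at hs'
              rcases List.mem_cons.1 hs' with rfl | hs'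
              · exact ⟨m, hm, rfl⟩
              · exact ih (by omega) s hs'
          intro s hs' ⟨hb, hfs⟩
          obtain ⟨u, hu, rfl⟩ := key n le_rfl s hs'
          exact (hv.inv n).active_not_flag ρ (e ▸ hρ') u hu hb ((π.trial_inFlagged u).1 hfs)
        have h3 : (π.hist n).map (mask ρ) = π.hist n := by
          conv_rhs => rw [← List.map_id (π.hist n)]
          refine List.map_congr_left fun s hs' => ?_
          unfold mask; rw [if_neg (hno s hs')]; rfl
        have h4 : (π'.hist n).map (mask ρ) = π'.hist n := by
          conv_rhs => rw [← List.map_id (π'.hist n)]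
          refine List.map_congr_left fun s hs' => ?_
          unfold mask
          rw [if_neg]
          · rfl
          · intro hbad
            -- A flagged trial of `ρ` in the second history would show up, masked, in the first.
            have : mask ρ s ∈ π.hist n := by
              rw [← h3, h.hist]; exact List.mem_map_of_mem hs'
            exact hno _ this (by simpa using hbad)
        have h5 := h.hist
        rw [h3, h4] at h5
        rw [h5, hs.p]
      · unfold ucb
        rw [← plays_mask ρ (π.hist n), ← plays_mask ρ (π'.hist n), ← meanReward_mask e (π.hist n),
          ← meanReward_mask e (π'.hist n), h.hist, hs.p]
    have hfilt : (containing (π.state n).active (π.x n)).filter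
        (fun ρ => ∀ ρ' ∈ containing (π.state n).active (π.x n),
          ucb π.p (π.hist n) ρ' ≤ ucb π.p (π.hist n) ρ) =
        (containing (π'.state n).active (π'.x n)).filter
        (fun ρ => ∀ ρ' ∈ containing (π'.state n).active (π'.x n),
          ucb π'.p (π'.hist n) ρ' ≤ ucb π'.p (π'.hist n) ρ) := by
      rw [← h.active, ← hs.x]
      refine Finset.filter_congr fun ρ₁ h₁ => forall₂_congr fun ρ₂ h₂ => ?_
      rw [hucb _ (mem_containing.1 h₁).1, hucb _ (mem_containing.1 h₂).1]
    rw [hs.R]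
    exact congrArg π'.R.pickBall hfilt

lemma Agree.suffData {ρ : Ball K} {n : ℕ} (h : Agree π π' ρ n) (hs : SameInput π π')
    (ρ' : Ball K) (a : Fin K) :
    SuffData π.p (π.hist n) ρ' a ↔ SuffData π'.p (π'.hist n) ρ' a := by
  rw [← suffData_mask π.p ρ (π.hist n), ← suffData_mask π'.p ρ (π'.hist n), h.hist, hs.p]

open Classical in
lemma arm_eq (π : Path K) (n : ℕ) : π.arm n = 
    if π.flag n then
      if hne : ((π.ball n).arms.filter
        (fun a => ¬ SuffData π.p (π.hist n) (π.ball n) a)).Nonempty then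
          ((π.ball n).arms.filter (fun a => ¬ SuffData π.p (π.hist n) (π.ball n) a)).min' hne
      else π.R.ucbArm (π.ball n) 0
    else π.R.ucbArm (π.ball n) (plays (π.hist n) (π.ball n)) := rfl

lemma Agree.arm {ρ : Ball K} {n : ℕ} (h : Agree π π' ρ n) (hs : SameInput π π')
    (hv : π.Valid) : π.arm n = π'.arm n := by
  have hb := h.ball hs hv
  have hf := h.flag hs
  have hfilt : (π.ball n).arms.filter (fun a => ¬ SuffData π.p (π.hist n) (π.ball n) a) =
      (π'.ball n).arms.filter (fun a => ¬ SuffData π'.p (π'.hist n) (π'.ball n) a) := by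
    rw [hb]
    refine Finset.filter_congr fun a _ => ?_
    rw [h.suffData hs]
  have hpl : plays (π.hist n) (π.ball n) = plays (π'.hist n) (π'.ball n) := by
    rw [← plays_mask ρ (π.hist n), ← plays_mask ρ (π'.hist n), h.hist, hb]
  rw [arm_eq, arm_eq]
  by_cases hfl : π.flag n
  · rw [if_pos hfl, if_pos (hf.1 hfl)]
    simp only [hfilt, hs.R]
    simp only [hb]
  · rw [if_neg hfl, if_neg (fun h' => hfl (hf.2 h')), hpl, hs.R, hb]

lemma Agree.trial {ρ : Ball K} {n : ℕ} (h : Agree π π' ρ n) (hs : SameInput π π')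
    (hv : π.Valid) (hε : π.ε n = π'.ε n ∨ (π.ball n = ρ ∧ π.flag n)) :
    mask ρ (π.trial n) = mask ρ (π'.trial n) := by
  have hb := h.ball hs hv
  have ha := h.arm hs hv
  have hf := h.flag hs
  rcases hε with hε | hε
  · have : π.trial n = π'.trial n := by
      unfold Path.trial Path.rew
      simp only [hb, ha, hs.x, hs.f, hε]
      congr 1
      exact decide_eq_decide.2 hf
    rw [this]
  · unfold mask
    rw [if_pos ⟨hε.1, (π.trial_inFlagged n).2 hε.2⟩, if_pos]
    · simp only [trial_ball, trial_arm, trial_ctx, hb, ha, hs.x]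
      unfold Path.trial
      rw [propext hf]
    · exact ⟨hb.symm.trans hε.1, (π'.trial_inFlagged n).2 (hf.1 hε.2)⟩

lemma Agree.parts {ρ : Ball K} {n : ℕ} (h : Agree π π' ρ n) (hs : SameInput π π')
    (hv : π.Valid) (hε : π.ε n = π'.ε n ∨ (π.ball n = ρ ∧ π.flag n)) :
    π.parts n ↔ π'.parts n := by
  have hcons : (π.trial n :: π.hist n).map (mask ρ) = (π'.trial n :: π'.hist n).map (mask ρ) := by
    rw [List.map_cons, List.map_cons, h.hist, h.trial hs hv hε]
  unfold Path.parts
  rw [h.flag hs, h.ball hs hv]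
  refine and_congr_right fun _ => forall₂_congr fun b _ => ?_
  rw [← suffData_mask π.p ρ (π.trial n :: π.hist n), ← suffData_mask π'.p ρ
    (π'.trial n :: π'.hist n), hcons, hs.p]

/-- The noise may differ only in flagged trials of ρ, and only the partition of ρ itself reads those
rewards; `hp` excludes it. -/
lemma Agree.succ {ρ : Ball K} {n : ℕ} (h : Agree π π' ρ n) (hs : SameInput π π')
    (hv : π.Valid) (hε : π.ε n = π'.ε n ∨ (π.ball n = ρ ∧ π.flag n))
    (hp : π.parts n → π.ball n ≠ ρ) : Agree π π' ρ (n + 1) := by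
  have hb := h.ball hs hv
  have hcons : (π.trial n :: π.hist n).map (mask ρ) = (π'.trial n :: π'.hist n).map (mask ρ) := by
    rw [List.map_cons, List.map_cons, h.hist, h.trial hs hv hε]
  have hpa := h.parts hs hv hε
  have hpr : π.promotes n ↔ π'.promotes n := by
    unfold Path.promotes thr
    rw [h.flag hs, hb, ← plays_mask ρ (π.hist n), ← plays_mask ρ (π'.hist n), h.hist, hs.p]
  have hhist : (π.hist (n + 1)).map (mask ρ) = (π'.hist (n + 1)).map (mask ρ) := by
    rw [hist_succ, hist_succ, hcons]
  by_cases hpn : π.parts n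
  · have hkids : π.kids n = π'.kids n := by
      unfold kids
      rw [← hb, ← hs.p, ← hs.R]
      refine subPartition_congr _ _ fun a => ?_
      rw [← flaggedData_mask (hp hpn) (π.trial n :: π.hist n),
        ← flaggedData_mask (hp hpn) (π'.trial n :: π'.hist n), hcons]
    refine ⟨?_, ?_, hhist⟩
    · rw [(state_parts hpn).1, (state_parts (hpa.1 hpn)).1, h.active, hkids]
    · rw [(state_parts hpn).2, (state_parts (hpa.1 hpn)).2, h.flagged, hb]
  · have hpn' := fun h' => hpn (hpa.2 h')
    by_cases hq : π.promotes n
    · refine ⟨?_, ?_, hhist⟩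
      · rw [(state_promotes hq).1, (state_promotes (hpr.1 hq)).1, h.active, hb]
      · rw [(state_promotes hq).2, (state_promotes (hpr.1 hq)).2, h.flagged, hb]
    · have hq' := fun h' => hq (hpr.2 h')
      refine ⟨?_, ?_, hhist⟩
      · rw [(state_same hpn hq).1, (state_same hpn' hq').1, h.active]
      · rw [(state_same hpn hq).2, (state_same hpn' hq').2, h.flagged]

/-- The samples of a ball when it is partitioned do not depend on their noise. -/
lemma parts_congr (hs : SameInput π π') (hv : π.Valid) {t : ℕ} (hp : π.parts t) (a : Fin K) (z : ℝ)
    (hε : ∀ s, s ∉ π.nbrs (t + 1) (π.ball t) a z → π.ε s = π'.ε s) :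
    π'.parts t ∧ π'.ball t = π.ball t ∧
      π'.nbrs (t + 1) (π.ball t) a z = π.nbrs (t + 1) (π.ball t) a z := by
  have hε' : ∀ s, π.ε s = π'.ε s ∨ (π.ball s = π.ball t ∧ π.flag s) := by
    intro s
    by_cases h : s ∈ π.nbrs (t + 1) (π.ball t) a z
    · have := π.mem_samples.1 (Finset.mem_filter.1 h).1
      exact Or.inr ⟨this.2.1, this.2.2.2⟩
    · exact Or.inl (hε s h)
  -- The ball is partitioned in trial `t`, so by `eq_of_parts` in no earlier one.
  have hag : ∀ n ≤ t, Agree π π' (π.ball t) n := by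
    intro n
    induction n with
    | zero => intro _; exact ⟨rfl, rfl, rfl⟩
    | succ n ih =>
      intro hn
      refine (ih (by omega)).succ hs hv (hε' n) fun hpn e => ?_
      have := hv.eq_of_parts hpn hp e
      omega
  have ht := hag t le_rfl
  refine ⟨(ht.parts hs hv (hε' t)).1 hp, (ht.ball hs hv).symm, ?_⟩
  have hsam : π'.samples (t + 1) (π.ball t) a = π.samples (t + 1) (π.ball t) a := by
    ext s
    rw [mem_samples, mem_samples]
    refine and_congr_right fun h => ?_
    have hgs := hag s (by omega)
    rw [hgs.ball hs hv, hgs.arm hs hv, hgs.flag hs]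
  unfold nbrs
  rw [hsam, hs.x, hs.p]

end Path

end

end ApproxZooming

/-! ### Measurability of the decisions of the algorithm -/

namespace ApproxZooming

noncomputable section

variable {K : ℕ}

instance : Countable (Ball K) :=
  Function.Injective.countable (f := fun ρ : Ball K => (ρ.level, ρ.pos, ρ.arms)) (by
    rintro ⟨a, b, c⟩ ⟨a', b', c'⟩ h
    simpa using h)

instance : Countable (Clustering K) :=
  Function.Injective.countable (f := fun c : Clustering K => (c.centers, c.members)) (by
    rintro ⟨a, b⟩ ⟨a', b'⟩ h
    simpa using h)

/-! ### Random variables with countably many values -/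

section Disc

variable {Ω : Type*} {mΩ : MeasurableSpace Ω} {α β γ : Type*}

/-- All level sets of `X` are measurable. -/
def Disc (mΩ : MeasurableSpace Ω) (X : Ω → β) : Prop := ∀ b, MeasurableSet[mΩ] {ω | X ω = b}

lemma disc_const (b : β) : Disc mΩ (fun _ : Ω => b) := fun c => by
  by_cases h : b = c <;> simp [h]

/-- Splitting along the countably many values of `X` lets a random ball or arm be treated as a fixed
one. -/
lemma Disc.setOf_bind [Countable β] {X : Ω → β} (hX : Disc mΩ X) {P : β → Ω → Prop}
    (hP : ∀ b, MeasurableSet {ω | P b ω}) : MeasurableSet {ω | P (X ω) ω} := by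
  have : {ω | P (X ω) ω} = ⋃ b, {ω | X ω = b} ∩ {ω | P b ω} := by
    ext ω; simp
  rw [this]
  exact MeasurableSet.iUnion fun b => (hX b).inter (hP b)

lemma Disc.setOf [Countable β] {X : Ω → β} (hX : Disc mΩ X) (P : β → Prop) :
    MeasurableSet {ω | P (X ω)} :=
  hX.setOf_bind (P := fun b _ => P b) fun b => by by_cases h : P b <;> simp [h]

lemma Disc.bind [Countable β] {X : Ω → β} (hX : Disc mΩ X) {F : β → Ω → γ}
    (hF : ∀ b, Disc mΩ (F b)) : Disc mΩ (fun ω => F (X ω) ω) :=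
  fun c => hX.setOf_bind (P := fun b ω => F b ω = c) fun b => hF b c

lemma Disc.map [Countable β] {X : Ω → β} (hX : Disc mΩ X) (g : β → γ) :
    Disc mΩ (fun ω => g (X ω)) :=
  hX.bind (F := fun b _ => g b) fun b => disc_const (g b)

lemma Disc.map₂ [Countable α] [Countable β] {X : Ω → α} {Y : Ω → β} (hX : Disc mΩ X)
    (hY : Disc mΩ Y) (g : α → β → γ) : Disc mΩ (fun ω => g (X ω) (Y ω)) :=
  hX.bind (F := fun b ω => g b (Y ω)) fun b => hY.map (g b)

lemma Disc.measurable_bind [Countable β] {X : Ω → β} (hX : Disc mΩ X) {δ : Type*}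
    [MeasurableSpace δ] {F : β → Ω → δ} (hF : ∀ b, Measurable (F b)) :
    Measurable (fun ω => F (X ω) ω) := by
  intro s hs
  exact hX.setOf_bind (P := fun b ω => F b ω ∈ s) fun b => hF b hs

lemma Disc.ite {P : Ω → Prop} [∀ ω, Decidable (P ω)] (hP : MeasurableSet {ω | P ω}) {X Y : Ω → β}
    (hX : Disc mΩ X) (hY : Disc mΩ Y) : Disc mΩ (fun ω => if P ω then X ω else Y ω) := by
  intro b
  have : {ω | (if P ω then X ω else Y ω) = b} =
      ({ω | P ω} ∩ {ω | X ω = b}) ∪ ({ω | P ω}ᶜ ∩ {ω | Y ω = b}) := by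
    ext ω
    by_cases h : P ω <;> simp [h]
  rw [this]
  exact (hP.inter (hX b)).union (hP.compl.inter (hY b))

lemma disc_filter (S : Finset β) {q : β → Ω → Prop} [∀ ω, DecidablePred fun b => q b ω]
    (hq : ∀ b ∈ S, MeasurableSet {ω | q b ω}) : Disc mΩ (fun ω => S.filter (fun b => q b ω)) := by
  intro S'
  have : {ω | S.filter (fun b => q b ω) = S'} =
      {_ω | S' ⊆ S} ∩ ⋂ b ∈ S, {ω | q b ω ↔ b ∈ S'} := by
    ext ω
    simp only [Set.mem_ofPred_eq, Set.mem_inter_iff, Set.mem_iInter]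
    constructor
    · rintro rfl
      exact ⟨Finset.filter_subset _ _, fun b hb => by simp [hb]⟩
    · rintro ⟨h1, h2⟩
      ext b
      rw [Finset.mem_filter]
      constructor
      · rintro ⟨h3, h4⟩; exact (h2 b h3).1 h4
      · intro h; exact ⟨h1 h, (h2 b (h1 h)).2 h⟩
  rw [this]
  refine MeasurableSet.inter (MeasurableSet.const _) (Finset.measurableSet_biInter _ fun b hb => ?_)
  by_cases hbS : b ∈ S'
  · simpa [hbS] using hq b hb
  · have := (hq b hb).compl
    simpa [hbS, Set.compl_def] using this

lemma measurableSet_ball_forall {β : Type*} (S : Finset β) {P : β → Ω → Prop}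
    (h : ∀ b ∈ S, MeasurableSet {ω | P b ω}) : MeasurableSet {ω | ∀ b ∈ S, P b ω} := by
  have : {ω | ∀ b ∈ S, P b ω} = ⋂ b ∈ S, {ω | P b ω} := by ext ω; simp
  rw [this]
  exact Finset.measurableSet_biInter _ h

lemma measurable_sum_disc {n : ℕ} {S : Ω → Finset ℕ} (hS : Disc mΩ S)
    (hsub : ∀ ω, S ω ⊆ Finset.range n) {g : ℕ → Ω → ℝ} (hg : ∀ s < n, Measurable (g s)) :
    Measurable (fun ω => ∑ s ∈ S ω, g s ω) := by
  have : (fun ω => ∑ s ∈ S ω, g s ω) = fun ω => ∑ s ∈ Finset.range n,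
      if s ∈ S ω then g s ω else 0 := by
    funext ω
    rw [← Finset.sum_filter]
    congr 1
    ext s
    rw [Finset.mem_filter]
    exact ⟨fun h => ⟨hsub ω h, h⟩, fun h => h.2⟩
  rw [this]
  refine Finset.measurable_sum _ fun s hs => ?_
  refine hS.measurable_bind (F := fun S ω => if s ∈ S then g s ω else 0) fun S => ?_
  by_cases h : s ∈ S
  · simpa [h] using hg s (Finset.mem_range.1 hs)
  · simp [h]

lemma disc_add (R : Rules K) {d : Ω → Fin K → Fin K → ℝ} (hd : ∀ a b, Measurable fun ω => d ω a b)
    (thr : ℝ) (c : Clustering K) (a : Fin K) :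
    Disc mΩ (fun ω => Clustering.add R (d ω) thr c a) := by
  unfold Clustering.add
  refine Disc.ite ?_ (disc_const _) ?_
  · exact measurableSet_ball_forall _ fun y _ => measurableSet_lt measurable_const (hd a y)
  · have : Disc mΩ (fun ω => c.centers.filter (fun y => ∀ y' ∈ c.centers, d ω a y ≤ d ω a y')) :=
      disc_filter _ fun y _ => measurableSet_ball_forall _ fun y' _ =>
        measurableSet_le (hd a y) (hd a y')
    exact this.map (fun F => (⟨c.centers, Function.update c.members (R.pickCenter F)
      (insert a (c.members (R.pickCenter F)))⟩ : Clustering K))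

lemma disc_foldl (R : Rules K) {d : Ω → Fin K → Fin K → ℝ}
    (hd : ∀ a b, Measurable fun ω => d ω a b) (thr : ℝ) (l : List (Fin K)) :
    ∀ {X : Ω → Clustering K}, Disc mΩ X →
      Disc mΩ (fun ω => l.foldl (Clustering.add R (d ω) thr) (X ω)) := by
  induction l with
  | nil => intro X hX; exact hX
  | cons a l ih =>
    intro X hX
    exact ih (X := fun ω => Clustering.add R (d ω) thr (X ω) a)
      (hX.bind (F := fun c ω => Clustering.add R (d ω) thr c a) fun c => disc_add R hd thr c a)

end Disc

/-! ### Measurability of the run -/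

section Run

variable {Ω : Type*} {mΩ : MeasurableSpace Ω} {p : Params} {R : Rules K} {f : Fin K → ℝ → ℝ}
  {x ε : ℕ → Ω → ℝ}

/-- The realization at `ω`. -/
def path (p : Params) (R : Rules K) (f : Fin K → ℝ → ℝ) (x ε : ℕ → Ω → ℝ) (ω : Ω) : Path K :=
  ⟨p, R, f, fun t => x t ω, fun t => ε t ω⟩

variable (mΩ p R f x ε) in
/-- The decisions of the first `n` trials are measurable. -/
structure MeasRun (n : ℕ) : Prop where
  ctx : ∀ s < n, Measurable[mΩ] (x s)
  rew : ∀ s < n, Measurable[mΩ] (fun ω => (path p R f x ε ω).rew s)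
  ball : ∀ s < n, Disc mΩ (fun ω => (path p R f x ε ω).ball s)
  arm : ∀ s < n, Disc mΩ (fun ω => (path p R f x ε ω).arm s)
  flag : ∀ s < n, MeasurableSet[mΩ] {ω | (path p R f x ε ω).flag s}
  active : Disc mΩ (fun ω => ((path p R f x ε ω).state n).active)
  flagged : Disc mΩ (fun ω => ((path p R f x ε ω).state n).flagged)

section Hist

variable {n : ℕ} (hx : ∀ s < n, Measurable[mΩ] (x s))
  (hrew : ∀ s < n, Measurable[mΩ] (fun ω => (path p R f x ε ω).rew s))
  (hball : ∀ s < n, Disc mΩ (fun ω => (path p R f x ε ω).ball s))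
  (harm : ∀ s < n, Disc mΩ (fun ω => (path p R f x ε ω).arm s))
  (hflag : ∀ s < n, MeasurableSet[mΩ] {ω | (path p R f x ε ω).flag s})

include hball

lemma disc_playSet (ρ : Ball K) : Disc mΩ (fun ω =>
    (Finset.range n).filter (fun s => (path p R f x ε ω).ball s = ρ)) :=
  disc_filter _ fun s hs => hball s (Finset.mem_range.1 hs) ρ

lemma disc_plays (ρ : Ball K) : Disc mΩ (fun ω => plays ((path p R f x ε ω).hist n) ρ) := by
  simp only [Path.plays_eq]
  exact (disc_playSet hball ρ).map Finset.card

include hrew in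
lemma measurable_ucb (ρ : Ball K) :
    Measurable[mΩ] (fun ω => ucb p ((path p R f x ε ω).hist n) ρ) := by
  have hmean : Measurable[mΩ] (fun ω => meanReward ((path p R f x ε ω).hist n) ρ) := by
    unfold meanReward
    simp only [Path.filter_map_sum]
    refine Measurable.div ?_ ?_
    · exact measurable_sum_disc (disc_playSet hball ρ) (fun ω => Finset.filter_subset _ _) hrew
    · exact (disc_plays hball ρ).measurable_bind (F := fun k _ => (k : ℝ))
        fun k => measurable_const
  unfold ucb
  refine (disc_plays hball ρ).measurable_bind (F := fun k ω => if k = 0 then ⊤ else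
    ((meanReward ((path p R f x ε ω).hist n) ρ + 2 * p.L * ρ.width
    + Real.sqrt (6 * p.σ ^ 2 * Real.log p.T / k) : ℝ) : EReal)) fun k => ?_
  by_cases h : k = 0
  · simp [h]
  · simp only [h, if_false]
    exact measurable_coe_real_ereal.comp ((hmean.add_const _).add_const _)

include harm hflag

lemma disc_samples (ρ : Ball K) (a : Fin K) :
    Disc mΩ (fun ω => (path p R f x ε ω).samples n ρ a) := by
  unfold Path.samples
  classical
  refine disc_filter _ fun s hs => ?_
  have hs' := Finset.mem_range.1 hs
  exact (hball s hs' ρ).inter ((harm s hs' a).inter (hflag s hs'))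

include hx

lemma disc_partCount (ρ : Ball K) (a : Fin K) (j : ℕ) :
    Disc mΩ (fun ω => (path p R f x ε ω).partCount n ρ a j) := by
  unfold Path.partCount
  classical
  -- For an arbitrary value `S` only trials before `n` have measurable contexts, hence the
  -- intersection; genuine sample sets are unchanged by it.
  have := (disc_samples hball harm hflag ρ a).bind (F := fun S ω =>
    (S ∩ Finset.range n).filter (fun s => Path.inPart ρ j (x s ω))) fun S => by
      refine disc_filter _ fun s hs => ?_
      have hs' := hx s (Finset.mem_range.1 (Finset.mem_inter.1 hs).2)
      exact (measurableSet_le measurable_const hs').inter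
        (measurableSet_le hs' measurable_const)
  have h2 := this.map Finset.card
  convert h2 using 3 with ω
  congr 1
  ext s
  simp only [Finset.mem_inter, Finset.mem_range]
  exact ⟨fun h => ⟨h, Path.lt_of_mem_samples _ h⟩, fun h => h.1⟩

lemma measurableSet_suffData (ρ : Ball K) (a : Fin K) :
    MeasurableSet[mΩ] {ω | SuffData p ((path p R f x ε ω).hist n) ρ a} := by
  have : ∀ ω, SuffData p ((path p R f x ε ω).hist n) ρ a ↔ _ :=
    fun ω => (path p R f x ε ω).suffData_iff n ρ a
  simp only [this]
  exact measurableSet_ball_forall _ fun j _ =>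
    (disc_partCount hx hball harm hflag ρ a j).setOf (fun k => numNbr p ρ ≤ k)

lemma disc_nbrs (ρ : Ball K) (a : Fin K) (z : ℝ) :
    Disc mΩ (fun ω => (path p R f x ε ω).nbrs n ρ a z) := by
  classical
  unfold Path.nbrs
  have := (disc_samples hball harm hflag ρ a).bind (F := fun S ω =>
    (S ∩ Finset.range n).filter (fun s => ((S ∩ Finset.range n).filter
      (fun s' => |x s' ω - z| ≤ |x s ω - z|)).card ≤ numNbr p ρ)) fun S => by
      refine disc_filter _ fun s hs => ?_
      have hs' := hx s (Finset.mem_range.1 (Finset.mem_inter.1 hs).2)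
      have hd : Disc mΩ (fun ω => (S ∩ Finset.range n).filter
          (fun s' => |x s' ω - z| ≤ |x s ω - z|)) := disc_filter _ fun s' hs'' => by
        have h' := hx s' (Finset.mem_range.1 (Finset.mem_inter.1 hs'').2)
        exact measurableSet_le (measurable_norm.comp (h'.sub_const z))
          (measurable_norm.comp (hs'.sub_const z))
      exact hd.setOf (fun F => F.card ≤ numNbr p ρ)
  have hS : ∀ ω, (path p R f x ε ω).samples n ρ a ∩ Finset.range n
      = (path p R f x ε ω).samples n ρ a := fun ω => Finset.inter_eq_left.2 fun s hs =>
    Finset.mem_range.2 (Path.lt_of_mem_samples _ hs)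
  simp only [hS] at this
  convert this <;> rfl

include hrew

lemma disc_subPartition (ρ : Ball K) :
    Disc mΩ (fun ω => subPartition p R ((path p R f x ε ω).hist n) ρ) := by
  have hknn : ∀ a z, Measurable[mΩ] (fun ω => knn (numNbr p ρ)
      (flaggedData ((path p R f x ε ω).hist n) ρ a) z) := by
    intro a z
    have : ∀ ω, knn (numNbr p ρ) (flaggedData ((path p R f x ε ω).hist n) ρ a) z = _ :=
      fun ω => (path p R f x ε ω).knn_eq n ρ a z
    simp only [this]
    exact (measurable_sum_disc (disc_nbrs hx hball harm hflag ρ a z) (fun ω s hs =>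
      Finset.mem_range.2 (Path.lt_of_mem_samples _ (Finset.mem_filter.1 hs).1)) hrew).div_const
      (numNbr p ρ : ℝ)
  have hest : ∀ u v a b, Measurable[mΩ]
      (fun ω => estDist p ((path p R f x ε ω).hist n) ρ u v a b) := by
    intro u v a b
    unfold estDist
    refine Measurable.sqrt ((Measurable.const_mul (Finset.measurable_sum _ fun i _ =>
      ((hknn _ _).sub (hknn _ _)).pow_const 2) _).sub_const _)
  have hhalf : ∀ j, Disc mΩ (fun ω => halfPartition p R ((path p R f x ε ω).hist n) ρ j) := by
    intro j
    unfold halfPartition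
    exact (disc_foldl R (hest _ _) _ (R.order ρ) (disc_const ⟨∅, fun _ => ∅⟩)).map
      (fun c => c.centers.image (fun y => (⟨ρ.level + 1, 2 * ρ.pos + j, c.members y⟩ : Ball K)))
  exact (hhalf 0).map₂ (hhalf 1) (· ∪ ·)

end Hist

variable {n : ℕ}

lemma disc_containing {S : Finset (Ball K)} {y : Ω → ℝ} (hy : Measurable y) :
    Disc mΩ (fun ω => containing S (y ω)) := by
  unfold containing
  exact disc_filter _ fun ρ _ => (measurableSet_le measurable_const hy).inter
    (measurableSet_le hy measurable_const)

lemma MeasRun.flaggedPhase (h : MeasRun mΩ p R f x ε n) {y : Ω → ℝ} (hy : Measurable[mΩ] y) :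
    MeasurableSet[mΩ] {ω | flaggedPhase ((path p R f x ε ω).state n) (y ω)} :=
  h.flagged.setOf_bind (P := fun S ω => (containing S (y ω)).Nonempty) fun _ =>
    (disc_containing hy).setOf _

lemma MeasRun.selectBall (h : MeasRun mΩ p R f x ε n) {y : Ω → ℝ} (hy : Measurable[mΩ] y) :
    Disc mΩ (fun ω => selectBall p R ((path p R f x ε ω).state n) (y ω)) := by
  unfold ApproxZooming.selectBall
  refine Disc.ite (h.flaggedPhase hy) ?_ ?_
  · refine Disc.map ?_ R.pickBall
    refine h.flagged.bind (F := fun S ω => (containing S (y ω)).filter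
      (fun ρ => ∀ ρ' ∈ containing S (y ω), ρ'.width ≤ ρ.width)) fun S => ?_
    exact (disc_containing hy).map (fun C : Finset (Ball K) =>
      C.filter (fun ρ : Ball K => ∀ ρ' ∈ C, ρ'.width ≤ ρ.width))
  · refine Disc.map ?_ R.pickBall
    refine h.active.bind (F := fun S ω => (containing S (y ω)).filter
      (fun ρ => ∀ ρ' ∈ containing S (y ω), ucb p ((path p R f x ε ω).hist n) ρ'
        ≤ ucb p ((path p R f x ε ω).hist n) ρ)) fun S => ?_
    refine (disc_containing hy).bind (F := fun C ω => C.filter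
      (fun ρ => ∀ ρ' ∈ C, ucb p ((path p R f x ε ω).hist n) ρ'
        ≤ ucb p ((path p R f x ε ω).hist n) ρ)) fun C => ?_
    exact disc_filter _ fun ρ _ => measurableSet_ball_forall _ fun ρ' _ =>
      measurableSet_le (measurable_ucb h.rew h.ball ρ') (measurable_ucb h.rew h.ball ρ)

lemma MeasRun.selectArm (h : MeasRun mΩ p R f x ε n) {y : Ω → ℝ} (hy : Measurable[mΩ] y) :
    Disc mΩ (fun ω => selectArm p R ((path p R f x ε ω).state n) (y ω)) := by
  unfold ApproxZooming.selectArm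
  refine (h.selectBall hy).bind (F := fun ρ ω => if ApproxZooming.flaggedPhase
    ((path p R f x ε ω).state n) (y ω) then
    if hne : (ρ.arms.filter (fun a => ¬ SuffData p ((path p R f x ε ω).hist n) ρ a)).Nonempty then
      (ρ.arms.filter (fun a => ¬ SuffData p ((path p R f x ε ω).hist n) ρ a)).min' hne
    else R.ucbArm ρ 0
    else R.ucbArm ρ (plays ((path p R f x ε ω).hist n) ρ)) fun ρ => ?_
  refine Disc.ite (h.flaggedPhase hy) ?_ ((disc_plays h.ball ρ).map _)
  have : Disc mΩ (fun ω => ρ.arms.filter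
      (fun a => ¬ SuffData p ((path p R f x ε ω).hist n) ρ a)) := disc_filter _ fun a _ =>
    (measurableSet_suffData h.ctx h.ball h.arm h.flag ρ a).compl
  exact this.map (fun F => if hne : F.Nonempty then F.min' hne else R.ucbArm ρ 0)

lemma MeasRun.succ (h : MeasRun mΩ p R f x ε n) (hx : Measurable[mΩ] (x n))
    (hε : Measurable[mΩ] (ε n)) (hf : ∀ a, Measurable (f a)) : MeasRun mΩ p R f x ε (n + 1) := by
  have hball : Disc mΩ (fun ω => (path p R f x ε ω).ball n) := h.selectBall hx
  have harm : Disc mΩ (fun ω => (path p R f x ε ω).arm n) := h.selectArm hx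
  have hflag : MeasurableSet[mΩ] {ω | (path p R f x ε ω).flag n} := h.flaggedPhase hx
  have hrew : Measurable[mΩ] (fun ω => (path p R f x ε ω).rew n) :=
    (harm.measurable_bind (F := fun a ω => f a (x n ω)) fun a => (hf a).comp hx).add hε
  have ext : ∀ {Q : ℕ → Prop}, (∀ s < n, Q s) → Q n → ∀ s < n + 1, Q s := by
    intro Q h1 h2 s hs
    rcases Nat.lt_succ_iff_lt_or_eq.1 hs with h | rfl
    · exact h1 s h
    · exact h2
  have hx' := ext h.ctx hx
  have hrew' := ext h.rew hrew
  have hball' := ext h.ball hball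
  have harm' := ext h.arm harm
  have hflag' := ext h.flag hflag
  have hparts : MeasurableSet[mΩ] {ω | (path p R f x ε ω).parts n} := by
    unfold Path.parts
    refine hflag.inter ?_
    simp only [← Path.hist_succ]
    exact hball.setOf_bind (P := fun ρ ω => ∀ b ∈ ρ.arms,
      SuffData p ((path p R f x ε ω).hist (n + 1)) ρ b) fun ρ =>
      measurableSet_ball_forall _ fun b _ => measurableSet_suffData hx' hball' harm' hflag' ρ b
  have hprom : MeasurableSet[mΩ] {ω | (path p R f x ε ω).promotes n} := by
    unfold Path.promotes
    refine hflag.compl.inter ?_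
    exact hball.setOf_bind (P := fun ρ ω => (6 * p.σ ^ 2 * Real.log p.T / (p.L ^ 2 * ρ.width ^ 2))
      < plays ((path p R f x ε ω).hist n) ρ) fun ρ => (disc_plays h.ball ρ).setOf
        (fun k : ℕ => 6 * p.σ ^ 2 * Real.log p.T / (p.L ^ 2 * ρ.width ^ 2) < (k : ℝ))
  classical
  refine ⟨hx', hrew', hball', harm', hflag', ?_, ?_⟩
  · simp only [Path.state_succ, apply_ite State.active]
    refine Disc.ite hparts ?_ (Disc.ite hprom ?_ h.active)
    · refine h.active.map₂ ?_ (· ∪ ·)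
      simp only [← Path.hist_succ]
      exact hball.bind (F := fun ρ ω => subPartition p R ((path p R f x ε ω).hist (n + 1)) ρ)
        fun ρ => disc_subPartition hx' hrew' hball' harm' hflag' ρ
    · exact h.active.map₂ hball Finset.erase
  · simp only [Path.state_succ, apply_ite State.flagged]
    refine Disc.ite hparts ?_ (Disc.ite hprom ?_ h.flagged)
    · exact h.flagged.map₂ hball Finset.erase
    · exact h.flagged.map₂ hball (fun S ρ => insert ρ S)

/-- The σ-algebra is arbitrary: below it is generated by selected contexts and noise terms, which is
what the independence arguments need. -/
lemma measRun (hf : ∀ a, Measurable (f a)) (n : ℕ) (hx : ∀ s < n, Measurable[mΩ] (x s))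
    (hε : ∀ s < n, Measurable[mΩ] (ε s)) : MeasRun mΩ p R f x ε n := by
  induction n with
  | zero =>
    refine ⟨by simp, by simp, by simp, by simp, by simp, ?_, ?_⟩
    · exact disc_const _
    · exact disc_const _
  | succ n ih =>
    exact (ih (fun s hs => hx s (by omega)) (fun s hs => hε s (by omega))).succ
      (hx n (by omega)) (hε n (by omega)) hf

lemma MeasRun.parts {t : ℕ} (h : MeasRun mΩ p R f x ε (t + 1)) :
    MeasurableSet[mΩ] {ω | (path p R f x ε ω).parts t} := by
  unfold Path.parts
  refine (h.flag t (by omega)).inter ?_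
  simp only [← Path.hist_succ]
  exact (h.ball t (by omega)).setOf_bind (P := fun ρ ω => ∀ b ∈ ρ.arms,
    SuffData p ((path p R f x ε ω).hist (t + 1)) ρ b) fun ρ =>
    measurableSet_ball_forall _ fun b _ => measurableSet_suffData h.ctx h.ball h.arm h.flag ρ b

end Run

end

end ApproxZooming

/-! ### The probabilistic setting and Gaussian deviations along predictable trials -/

namespace ApproxZooming

noncomputable section

open scoped ENNReal NNReal

variable {Ω : Type*} {mΩ : MeasurableSpace Ω} {P : Measure Ω} {v : ℝ≥0} {x ε : ℕ → Ω → ℝ}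

/-- Independent uniform contexts and independent Gaussian noise. -/
structure Sampling (P : Measure Ω) (v : ℝ≥0) (x ε : ℕ → Ω → ℝ) : Prop where
  measX : ∀ t, Measurable (x t)
  measE : ∀ t, Measurable (ε t)
  lawX : ∀ t, P.map (x t) = volume.restrict (Set.Icc (0 : ℝ) 1)
  lawE : ∀ t, P.map (ε t) = gaussianReal 0 v
  indep : iIndepFun (fun i : ℕ ⊕ ℕ => Sum.elim x ε i) P

/-- The `σ`-algebra generated by the contexts and noise terms with index in `S`. -/
@[reducible] def sig (x ε : ℕ → Ω → ℝ) (S : Set (ℕ ⊕ ℕ)) : MeasurableSpace Ω :=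
  ⨆ i ∈ S, MeasurableSpace.comap (Sum.elim x ε i) inferInstance

lemma sig_mono {S T : Set (ℕ ⊕ ℕ)} (h : S ⊆ T) : sig x ε S ≤ sig x ε T :=
  biSup_mono h

lemma measurable_sig_x {S : Set (ℕ ⊕ ℕ)} {t : ℕ} (h : Sum.inl t ∈ S) :
    Measurable[sig x ε S] (x t) :=
  (comap_measurable (x t)).mono
    (le_biSup (fun i => MeasurableSpace.comap (Sum.elim x ε i) inferInstance) h) le_rfl

lemma measurable_sig_e {S : Set (ℕ ⊕ ℕ)} {t : ℕ} (h : Sum.inr t ∈ S) :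
    Measurable[sig x ε S] (ε t) :=
  (comap_measurable (ε t)).mono
    (le_biSup (fun i => MeasurableSpace.comap (Sum.elim x ε i) inferInstance) h) le_rfl

namespace Sampling

variable (hs : Sampling P v x ε)
include hs

lemma meas (i : ℕ ⊕ ℕ) : Measurable (Sum.elim x ε i) := by
  rcases i with t | t
  · exact hs.measX t
  · exact hs.measE t

lemma sig_le (S : Set (ℕ ⊕ ℕ)) : sig x ε S ≤ mΩ :=
  iSup₂_le fun i _ => (hs.meas i).comap_le

lemma isProbabilityMeasure : IsProbabilityMeasure P := by
  have h1 : IsProbabilityMeasure (P.map (ε 0)) := by rw [hs.lawE]; infer_instance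
  exact Measure.isProbabilityMeasure_of_map (ε 0)

lemma indep_sig {S T : Set (ℕ ⊕ ℕ)} (h : Disjoint S T) : Indep (sig x ε S) (sig x ε T) P :=
  indep_iSup_of_disjoint (fun i => (hs.meas i).comap_le) hs.indep.iIndep h

lemma measure_inter {S T : Set (ℕ ⊕ ℕ)} (h : Disjoint S T) {A B : Set Ω}
    (hA : MeasurableSet[sig x ε S] A) (hB : MeasurableSet[sig x ε T] B) :
    P (A ∩ B) = P A * P B :=
  (Indep_iff _ _ _).1 (hs.indep_sig h) A B hA hB

/-! ### Almost sure properties of the contexts -/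

lemma noAtoms_x (t : ℕ) : NullSingletonClass (P.map (x t)) := by
  rw [hs.lawX]; infer_instance

lemma ae_mem (t : ℕ) : ∀ᵐ ω ∂P, x t ω ∈ Set.Icc (0 : ℝ) 1 := by
  have : ∀ᵐ y ∂(P.map (x t)), y ∈ Set.Icc (0 : ℝ) 1 := by
    rw [hs.lawX]; exact ae_restrict_mem measurableSet_Icc
  exact ae_of_ae_map (hs.measX t).aemeasurable this

lemma ae_irrational (t : ℕ) : ∀ᵐ ω ∂P, Irrational (x t ω) := by
  have := hs.noAtoms_x t
  have : ∀ᵐ y ∂(P.map (x t)), Irrational y := by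
    have h : (Set.range ((↑) : ℚ → ℝ)).Countable := Set.countable_range _
    exact measure_mono_null (fun y hy => by simpa [Irrational] using hy)
      (h.measure_zero (P.map (x t)))
  exact ae_of_ae_map (hs.measX t).aemeasurable this

/-- Under the product law each section of the graph of g is a single point, a null set for the
atomless law of `x t`. -/
lemma ae_ne {s t : ℕ} (hst : s ≠ t) {g : ℝ → ℝ} (hg : Measurable g) :
    ∀ᵐ ω ∂P, x t ω ≠ g (x s ω) := by
  have := hs.isProbabilityMeasure
  have hi : IndepFun (x s) (x t) P :=
    hs.indep.indepFun (i := Sum.inl s) (j := Sum.inl t) (by simpa using hst)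
  have hprod := (indepFun_iff_map_prod_eq_prod_map_map (hs.measX s).aemeasurable
    (hs.measX t).aemeasurable).1 hi
  have := hs.noAtoms_x t
  have hmeas : MeasurableSet {q : ℝ × ℝ | q.2 = g q.1} :=
    measurableSet_eq_fun measurable_snd (hg.comp measurable_fst)
  have hpm : IsProbabilityMeasure (P.map (x t)) :=
    Measure.isProbabilityMeasure_map (hs.measX t).aemeasurable
  have h0 : (P.map (fun ω => (x s ω, x t ω))) {q : ℝ × ℝ | q.2 = g q.1} = 0 := by
    rw [hprod, Measure.measure_prod_null hmeas]
    refine Filter.Eventually.of_forall fun a => ?_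
    have : Prod.mk a ⁻¹' {q : ℝ × ℝ | q.2 = g q.1} = {g a} := by ext y; simp
    change P.map (x t) (Prod.mk a ⁻¹' {q : ℝ × ℝ | q.2 = g q.1}) = 0
    rw [this]
    exact measure_singleton _
  rw [Measure.map_apply ((hs.measX s).prodMk (hs.measX t)) hmeas] at h0
  exact measure_mono_null (fun ω hω => by simpa using hω) h0

/-- Use `ae_ne` with g(y) = y for distinctness and with g(y) = q - y, for each rational q, for the
irrationality of sums. -/
lemma ae_generic {K : ℕ} (p : Params) (R : Rules K) (f : Fin K → ℝ → ℝ) :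
    ∀ᵐ ω ∂P, (path p R f x ε ω).Generic := by
  have h1 := ae_all_iff.2 hs.ae_mem
  have h2 := ae_all_iff.2 hs.ae_irrational
  have h3 : ∀ᵐ ω ∂P, ∀ s t : ℕ, s ≠ t → x t ω ≠ x s ω := by
    rw [ae_all_iff]; intro s; rw [ae_all_iff]; intro t
    by_cases h : s = t
    · simp [h]
    · filter_upwards [hs.ae_ne h measurable_id] with ω hω _ using hω
  have h4 : ∀ᵐ ω ∂P, ∀ s t : ℕ, ∀ q : ℚ, s ≠ t → x t ω ≠ q - x s ω := by
    rw [ae_all_iff]; intro s; rw [ae_all_iff]; intro t; rw [ae_all_iff]; intro q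
    by_cases h : s = t
    · simp [h]
    · filter_upwards [hs.ae_ne h (measurable_const.sub measurable_id : 
        Measurable fun y : ℝ => (q : ℝ) - y)] with ω hω _ using hω
  filter_upwards [h1, h2, h3, h4] with ω a b c d
  refine ⟨a, b, fun s t hst => (c s t hst).symm, fun s t hst => ?_⟩
  rintro ⟨q, hq⟩
  have hq' : (q : ℝ) = x s ω + x t ω := hq
  exact d s t q hst (by linarith)

lemma measure_mem_Icc {t : ℕ} {a b : ℝ} (ha : 0 ≤ a) (hb : b ≤ 1) :
    P {ω | x t ω ∈ Set.Icc a b} = ENNReal.ofReal (b - a) := by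
  have : P {ω | x t ω ∈ Set.Icc a b} = P.map (x t) (Set.Icc a b) := by
    rw [Measure.map_apply (hs.measX t) measurableSet_Icc]; rfl
  rw [this, hs.lawX, Measure.restrict_apply measurableSet_Icc,
    Set.inter_eq_left.2 (Set.Icc_subset_Icc ha hb), Real.volume_Icc]

/-! ### An exponential inequality -/

/-- All contexts and the noise of the first `n` trials. -/
def pastSet (n : ℕ) : Set (ℕ ⊕ ℕ) := {i | ∀ s, i = Sum.inr s → s < n}

omit hs in
lemma pastSet_mono {m n : ℕ} (h : m ≤ n) : pastSet m ⊆ pastSet n :=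
  fun _ hi s hs' => (hi s hs').trans_le h

/-- The factor by which the exponential martingale grows. -/
def expFactor (v : ℝ≥0) (l y : ℝ) : ℝ≥0∞ := ENNReal.ofReal (Real.exp (l * y - l ^ 2 * v / 2))

omit hs in
lemma measurable_expFactor (l : ℝ) : Measurable (expFactor v l) := by
  unfold expFactor; fun_prop

lemma lintegral_expFactor (t : ℕ) (l : ℝ) : ∫⁻ ω, expFactor v l (ε t ω) ∂P = 1 := by
  have := hs.isProbabilityMeasure
  have hm := mgf_gaussianReal (hs.lawE t) l
  have hint : Integrable (fun ω => Real.exp (l * ε t ω)) P := by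
    rw [← mgf_pos_iff (μ := P) (X := ε t) (t := l), hm]
    exact Real.exp_pos _
  unfold expFactor
  have he : ∀ ω, Real.exp (l * ε t ω - l ^ 2 * v / 2)
      = Real.exp (-(l ^ 2 * v / 2)) * Real.exp (l * ε t ω) := by
    intro ω; rw [← Real.exp_add]; congr 1; ring
  simp only [he]
  rw [← ofReal_integral_eq_lintegral_ofReal (hint.const_mul _)
    (Filter.Eventually.of_forall fun ω => by positivity), integral_const_mul]
  unfold mgf at hm
  rw [hm, ← Real.exp_add]
  have : -(l ^ 2 * (v : ℝ) / 2) + (0 * l + v * l ^ 2 / 2) = 0 := by ring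
  rw [this]; simp

open Classical in
/-- The exponential martingale of the noise in the trials where `B` occurs. -/
def expMart (v : ℝ≥0) (ε : ℕ → Ω → ℝ) (l : ℝ) (B : ℕ → Set Ω) (n : ℕ) (ω : Ω) : ℝ≥0∞ :=
  ∏ s ∈ Finset.range n, if ω ∈ B s then expFactor v l (ε s ω) else 1

omit hs in
lemma measurable_expMart (l : ℝ) {B : ℕ → Set Ω}
    (hB : ∀ s, MeasurableSet[sig x ε (pastSet s)] (B s)) (n : ℕ) :
    Measurable[sig x ε (pastSet n)] (expMart v ε l B n) := by
  classical
  unfold expMart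
  refine Finset.measurable_prod _ fun s hs' => ?_
  have hs' := Finset.mem_range.1 hs'
  have h1 : MeasurableSet[sig x ε (pastSet n)] (B s) :=
    sig_mono (pastSet_mono hs'.le) _ (hB s)
  have h2 : Measurable[sig x ε (pastSet n)] (ε s) := measurable_sig_e (by
    intro u hu; rw [← Sum.inr_injective hu]; exact hs')
  exact Measurable.ite h1 ((measurable_expFactor l).comp h2) measurable_const

/-- Whether `B n` occurs is decided by contexts and earlier noise, so `ε n` is independent of it and
of the product so far. The new factor has mean one where it is used. -/
lemma lintegral_expMart (l : ℝ) {B : ℕ → Set Ω}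
    (hB : ∀ s, MeasurableSet[sig x ε (pastSet s)] (B s)) (n : ℕ) :
    ∫⁻ ω, expMart v ε l B n ω ∂P = 1 := by
  classical
  have := hs.isProbabilityMeasure
  induction n with
  | zero => simp [expMart]
  | succ n ih =>
    have hM := measurable_expMart (v := v) l hB n
    set M := expMart v ε l B n with hMdef
    have hsplit : ∀ ω, expMart v ε l B (n + 1) ω = (B n).indicator M ω * expFactor v l (ε n ω)
        + (B n)ᶜ.indicator M ω := by
      intro ω
      have : expMart v ε l B (n + 1) ω = M ω * if ω ∈ B n then expFactor v l (ε n ω) else 1 := by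
        rw [hMdef]; unfold expMart; rw [Finset.prod_range_succ]
      rw [this]
      by_cases h : ω ∈ B n <;> simp [h]
    simp only [hsplit]
    have hle := hs.sig_le (pastSet n)
    have hind : Measurable[sig x ε (pastSet n)] ((B n).indicator M) := hM.indicator (hB n)
    have hind' : Measurable[sig x ε (pastSet n)] ((B n)ᶜ.indicator M) :=
      hM.indicator (hB n).compl
    rw [lintegral_add_right _ (hind'.mono hle le_rfl)]
    have hdisj : Disjoint (pastSet n) {Sum.inr n} := by
      rw [Set.disjoint_singleton_right]
      intro h
      exact lt_irrefl n (h n rfl)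
    have hY : Measurable[sig x ε {Sum.inr n}] (fun ω => expFactor v l (ε n ω)) :=
      (measurable_expFactor l).comp (measurable_sig_e (by simp))
    rw [lintegral_mul_eq_lintegral_mul_lintegral_of_independent_measurableSpace hle
      (hs.sig_le _) (hs.indep_sig hdisj) hind hY, hs.lintegral_expFactor, mul_one,
      ← lintegral_add_left (hind.mono hle le_rfl), ← ih]
    refine lintegral_congr fun ω => ?_
    by_cases h : ω ∈ B n <;> simp [h]

open Classical in
-- This is Markov's inequality for the exponential martingale with the optimal parameters ±c/(vk).
-- Fixing the number k of summands makes the normalizing factor deterministic.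
lemma measure_sum_ge_le (hv : 0 < v) {B : ℕ → Set Ω}
    (hB : ∀ s, MeasurableSet[sig x ε (pastSet s)] (B s)) (n : ℕ) {k : ℕ} (hk : 0 < k) {c : ℝ}
    (hc : 0 ≤ c) :
    P {ω | ((Finset.range n).filter (fun s => ω ∈ B s)).card = k ∧
      c ≤ |∑ s ∈ (Finset.range n).filter (fun s => ω ∈ B s), ε s ω|}
      ≤ ENNReal.ofReal (2 * Real.exp (-(c ^ 2 / (2 * v * k)))) := by
  have hv' : (0 : ℝ) < v := hv
  have hk' : (0 : ℝ) < k := by exact_mod_cast hk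
  have hprod : ∀ (l : ℝ) (ω : Ω), expMart v ε l B n ω = ENNReal.ofReal (Real.exp
      (l * ∑ s ∈ (Finset.range n).filter (fun s => ω ∈ B s), ε s ω
        - ((Finset.range n).filter (fun s => ω ∈ B s)).card * (l ^ 2 * v / 2))) := by
    intro l ω
    unfold expMart expFactor
    rw [← Finset.prod_filter, ← ENNReal.ofReal_prod_of_nonneg (fun _ _ => (Real.exp_pos _).le),
      ← Real.exp_sum, Finset.sum_sub_distrib, ← Finset.mul_sum, Finset.sum_const, nsmul_eq_mul]
  have key : ∀ l : ℝ,
      P {ω | ENNReal.ofReal (Real.exp (c ^ 2 / (2 * v * k))) ≤ expMart v ε l B n ω}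
        ≤ ENNReal.ofReal (Real.exp (-(c ^ 2 / (2 * v * k)))) := by
    intro l
    have h1 := mul_meas_ge_le_lintegral (μ := P) ((measurable_expMart (v := v) l hB n).mono
      (hs.sig_le _) le_rfl) (ENNReal.ofReal (Real.exp (c ^ 2 / (2 * v * k))))
    rw [hs.lintegral_expMart l hB n, mul_comm] at h1
    rw [Real.exp_neg, ENNReal.ofReal_inv_of_pos (Real.exp_pos _)]
    rw [← one_div]
    rw [ENNReal.le_div_iff_mul_le (Or.inl (by simp [Real.exp_pos])) (Or.inl (by simp))]
    exact h1
  have hsub : {ω | ((Finset.range n).filter (fun s => ω ∈ B s)).card = k ∧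
      c ≤ |∑ s ∈ (Finset.range n).filter (fun s => ω ∈ B s), ε s ω|} ⊆
      {ω | ENNReal.ofReal (Real.exp (c ^ 2 / (2 * v * k))) ≤ expMart v ε (c / (v * k)) B n ω} ∪
      {ω | ENNReal.ofReal (Real.exp (c ^ 2 / (2 * v * k))) ≤
        expMart v ε (-(c / (v * k))) B n ω} := by
    rintro ω ⟨h1, h2⟩
    have e : c / (v * k) * c - k * ((c / (v * k)) ^ 2 * v / 2) = c ^ 2 / (2 * v * k) := by
      field_simp; ring
    have e0 : 0 ≤ c / (v * k) := by positivity
    rcases le_abs.1 h2 with h | h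
    · left
      change _ ≤ expMart v ε (c / (v * k)) B n ω
      rw [hprod, h1]
      refine ENNReal.ofReal_le_ofReal (Real.exp_le_exp.2 ?_)
      rw [← e]
      have := mul_le_mul_of_nonneg_left h e0
      linarith
    · right
      change _ ≤ expMart v ε (-(c / (v * k))) B n ω
      rw [hprod, h1]
      refine ENNReal.ofReal_le_ofReal (Real.exp_le_exp.2 ?_)
      rw [← e, neg_sq]
      have := mul_le_mul_of_nonneg_left h e0
      linarith
  refine (measure_mono hsub).trans ((measure_union_le _ _).trans ?_)
  refine (add_le_add (key _) (key _)).trans ?_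
  rw [← ENNReal.ofReal_add (Real.exp_pos _).le (Real.exp_pos _).le]
  exact (congrArg ENNReal.ofReal (two_mul _).symm).le

lemma measure_sum_finset_ge_le (hv : 0 < v) {S : Finset ℕ} (hS : S.Nonempty) {c : ℝ}
    (hc : 0 ≤ c) : P {ω | c ≤ |∑ s ∈ S, ε s ω|}
      ≤ ENNReal.ofReal (2 * Real.exp (-(c ^ 2 / (2 * v * S.card)))) := by
  classical
  obtain ⟨n, hn⟩ : ∃ n, S ⊆ Finset.range n := S.exists_nat_subset_range
  have h := hs.measure_sum_ge_le hv (B := fun s => {_ω | s ∈ S}) (fun s => MeasurableSet.const _) n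
    (Finset.card_pos.2 hS) hc
  have hf : (Finset.range n).filter (fun s => s ∈ S) = S := by
    ext s; rw [Finset.mem_filter]; exact ⟨fun h => h.2, fun h => ⟨hn h, h⟩⟩
  refine le_trans (measure_mono fun ω hω => ?_) h
  simp only [Set.mem_ofPred_eq] at hω ⊢
  rw [hf]
  exact ⟨rfl, hω⟩

end Sampling

end

end ApproxZooming

/-! ### Probability that a confidence bound fails -/

namespace ApproxZooming

noncomputable section

open scoped ENNReal NNReal

variable {K : ℕ} {Ω : Type*} {mΩ : MeasurableSpace Ω} {P : Measure Ω} {v : ℝ≥0}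
  {x ε : ℕ → Ω → ℝ} {p : Params} {R : Rules K} {f : Fin K → ℝ → ℝ}

lemma measRun_past (hf : ∀ a, Measurable (f a)) (n : ℕ) :
    MeasRun (sig x ε (Sampling.pastSet n)) p R f x ε n := by
  refine measRun hf n (fun s _ => measurable_sig_x fun u hu => ?_)
    (fun s hs => measurable_sig_e fun u hu => ?_)
  · simp at hu
  · rw [← Sum.inr_injective hu]; exact hs

/-- The ball of trial s is determined by the noise of earlier trials and by contexts. All contexts
may be included in `pastSet`, being independent of the noise. -/
lemma disc_ball_past (hf : ∀ a, Measurable (f a)) {s n : ℕ} (h : s ≤ n) :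
    Disc (sig x ε (Sampling.pastSet n)) (fun ω => (path p R f x ε ω).ball s) := by
  rcases Nat.lt_or_eq_of_le h with h | rfl
  · exact (measRun_past hf n).ball s h
  · exact (measRun_past hf s).selectBall (measurable_sig_x fun u hu => by simp at hu)

/-- In trial `s` the ball of trial `τ` is selected again, for at most the `n`-th time since `τ`. -/
def repeats (p : Params) (R : Rules K) (f : Fin K → ℝ → ℝ) (x ε : ℕ → Ω → ℝ) (τ n s : ℕ) :
    Set Ω :=
  {ω | τ ≤ s ∧ (path p R f x ε ω).ball s = (path p R f x ε ω).ball τ ∧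
    ((Finset.Ico τ s).filter
      (fun u => (path p R f x ε ω).ball u = (path p R f x ε ω).ball τ)).card < n}

lemma measurableSet_repeats (hf : ∀ a, Measurable (f a)) (τ n s : ℕ) :
    MeasurableSet[sig x ε (Sampling.pastSet s)] (repeats p R f x ε τ n s) := by
  by_cases h : τ ≤ s
  · have h1 : Disc (sig x ε (Sampling.pastSet s)) (fun ω => (path p R f x ε ω).ball τ) :=
      disc_ball_past hf h
    have h2 : Disc (sig x ε (Sampling.pastSet s)) (fun ω => (path p R f x ε ω).ball s) :=
      disc_ball_past hf le_rfl
    unfold repeats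
    refine (MeasurableSet.const _).inter (MeasurableSet.inter ?_ ?_)
    · exact h1.setOf_bind (P := fun ρ ω => (path p R f x ε ω).ball s = ρ) fun ρ => h2 ρ
    · refine h1.setOf_bind (P := fun ρ ω => ((Finset.Ico τ s).filter
        (fun u => (path p R f x ε ω).ball u = ρ)).card < n) fun ρ => ?_
      have : Disc (sig x ε (Sampling.pastSet s)) (fun ω => (Finset.Ico τ s).filter
          (fun u => (path p R f x ε ω).ball u = ρ)) := disc_filter _ fun u hu =>
        disc_ball_past hf (Finset.mem_Ico.1 hu).2.le ρ
      exact this.setOf (fun F => F.card < n)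
  · have : repeats p R f x ε τ n s = ∅ := by
      unfold repeats
      ext ω
      simp [h]
    rw [this]
    exact @MeasurableSet.empty _ (sig x ε (Sampling.pastSet s))

/-- There are infinitely many possible balls, so a ball is named by the first trial τ that selects
it. Its first n selections from τ on are exactly those before t when n is their number, so the union
bound runs over τ and n only. -/
lemma filter_repeats_eq {ω : Ω} {t : ℕ} {ρ : Ball K}
    (hn : 0 < ((Finset.range t).filter (fun s => (path p R f x ε ω).ball s = ρ)).card) :
    ∃ τ < t, ∀ s, ω ∈ repeats p R f x ε τ
      ((Finset.range t).filter (fun s => (path p R f x ε ω).ball s = ρ)).card s ↔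
      s < t ∧ (path p R f x ε ω).ball s = ρ := by
  set π := path p R f x ε ω with hπ
  set S := (Finset.range t).filter (fun s => π.ball s = ρ) with hS
  have hne := Finset.card_pos.1 hn
  have hmin := S.min'_mem hne
  set τ := S.min' hne with hτ
  have hτt : τ < t := Finset.mem_range.1 (Finset.mem_filter.1 hmin).1
  have hτρ : π.ball τ = ρ := (Finset.mem_filter.1 hmin).2
  refine ⟨τ, hτt, fun s => ?_⟩
  have hmem : ω ∈ repeats p R f x ε τ S.card s ↔ τ ≤ s ∧ π.ball s = π.ball τ ∧
    ((Finset.Ico τ s).filter (fun u => π.ball u = π.ball τ)).card < S.card := Iff.rfl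
  rw [hmem, hτρ]
  constructor
  · rintro ⟨h1, h2, h3⟩
    refine ⟨?_, h2⟩
    by_contra hle
    push Not at hle
    have : S ⊆ (Finset.Ico τ s).filter (fun u => π.ball u = ρ) := by
      intro u hu
      have hu' := Finset.mem_filter.1 hu
      have := Finset.mem_range.1 hu'.1
      exact Finset.mem_filter.2 ⟨Finset.mem_Ico.2 ⟨S.min'_le u hu, by omega⟩, hu'.2⟩
    have := Finset.card_le_card this
    omega
  · rintro ⟨h1, h2⟩
    have hsS : s ∈ S := Finset.mem_filter.2 ⟨Finset.mem_range.2 h1, h2⟩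
    refine ⟨S.min'_le s hsS, h2, Finset.card_lt_card ?_⟩
    rw [Finset.ssubset_iff_of_subset]
    · exact ⟨s, hsS, by simp⟩
    · intro u hu
      obtain ⟨hu1, hu2⟩ := Finset.mem_filter.1 hu
      have := (Finset.mem_Ico.1 hu1).2
      exact Finset.mem_filter.2 ⟨Finset.mem_range.2 (by omega), hu2⟩

/-- The deviation √(6σ² ln(T) n) gives the exponent 3 ln T, hence 2/T³ for each of the T² pairs (τ,
n). -/
lemma measure_not_ucbNoise_le (hs : Sampling P v x ε) (hv : 0 < v) (hvσ : (v : ℝ) = p.σ ^ 2)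
    (hT : 2 ≤ p.T) (hf : ∀ a, Measurable (f a)) :
    P {ω | ∃ t < p.T, ¬ (path p R f x ε ω).UcbNoise t} ≤ ENNReal.ofReal (2 / p.T) := by
  classical
  set lT := Real.log p.T with hlT
  have hT' : (2 : ℝ) ≤ p.T := by exact_mod_cast hT
  have hlog : 0 ≤ lT := Real.log_nonneg (by linarith)
  have hv' : (0 : ℝ) < v := hv
  set E : ℕ → ℕ → Set Ω := fun τ n =>
    {ω | ((Finset.range p.T).filter (fun s => ω ∈ repeats p R f x ε τ n s)).card = n ∧
      Real.sqrt (6 * v * lT * n) ≤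
        |∑ s ∈ (Finset.range p.T).filter (fun s => ω ∈ repeats p R f x ε τ n s), ε s ω|} with hE
  have hsub : {ω | ∃ t < p.T, ¬ (path p R f x ε ω).UcbNoise t} ⊆
      ⋃ τ ∈ Finset.range p.T, ⋃ n ∈ Finset.Icc 1 p.T, E τ n := by
    rintro ω ⟨t, ht, hbad⟩
    unfold Path.UcbNoise at hbad
    push Not at hbad
    obtain ⟨ρ, -, hn, hlt⟩ := hbad
    rw [Path.plays_eq] at hn hlt
    obtain ⟨τ, hτ, hiff⟩ := filter_repeats_eq (p := p) (R := R) (f := f) hn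
    set S := (Finset.range t).filter (fun s => (path p R f x ε ω).ball s = ρ) with hS
    have hfil : (Finset.range p.T).filter (fun s => ω ∈ repeats p R f x ε τ S.card s) = S := by
      ext s
      rw [hS, Finset.mem_filter, Finset.mem_filter, Finset.mem_range, Finset.mem_range]
      constructor
      · rintro ⟨h1, h2⟩; exact (hiff s).1 h2
      · intro h; exact ⟨h.1.trans ht, (hiff s).2 h⟩
    have hcard : S.card ≤ p.T := (Finset.card_filter_le _ _).trans (by simp; omega)
    simp only [Set.mem_iUnion]
    refine ⟨τ, Finset.mem_range.2 (by omega), S.card, Finset.mem_Icc.2 ⟨hn, hcard⟩, ?_⟩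
    change _ ∧ _
    rw [hfil]
    refine ⟨rfl, ?_⟩
    rw [hvσ]
    exact hlt.le
  have hEle : ∀ τ, ∀ n ∈ Finset.Icc 1 p.T, P (E τ n) ≤ ENNReal.ofReal (2 / (p.T : ℝ) ^ 3) := by
    intro τ n hn
    have hn1 := (Finset.mem_Icc.1 hn).1
    have hn' : (0 : ℝ) < n := by exact_mod_cast hn1
    refine (hs.measure_sum_ge_le hv (measurableSet_repeats hf τ n) p.T hn1
      (Real.sqrt_nonneg _)).trans (ENNReal.ofReal_le_ofReal (le_of_eq ?_))
    rw [Real.sq_sqrt (by positivity)]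
    have : 6 * v * lT * n / (2 * v * n) = 3 * lT := by field_simp; ring
    rw [this, Real.exp_neg, mul_comm 3 lT, Real.exp_mul, hlT, Real.exp_log (by linarith)]
    norm_cast
  refine (measure_mono hsub).trans ((measure_biUnion_finset_le _ _).trans ?_)
  calc ∑ τ ∈ Finset.range p.T, P (⋃ n ∈ Finset.Icc 1 p.T, E τ n)
      ≤ ∑ τ ∈ Finset.range p.T, ∑ n ∈ Finset.Icc 1 p.T, ENNReal.ofReal (2 / (p.T : ℝ) ^ 3) :=
        Finset.sum_le_sum fun τ _ => (measure_biUnion_finset_le _ _).trans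
          (Finset.sum_le_sum fun n hn => hEle τ n hn)
    _ = ENNReal.ofReal (2 / p.T) := by
        simp only [Finset.sum_const, Finset.card_range, Nat.card_Icc, Nat.add_sub_cancel,
          nsmul_eq_mul]
        rw [← ENNReal.ofReal_natCast, ← ENNReal.ofReal_mul (by positivity),
          ← ENNReal.ofReal_mul (by positivity)]
        congr 1
        field_simp

end

end ApproxZooming

/-! ### Probability that the estimates fail at a partition -/

namespace ApproxZooming

noncomputable section

open scoped ENNReal NNReal

variable {K : ℕ} {Ω : Type*} {mΩ : MeasurableSpace Ω} {P : Measure Ω} {v : ℝ≥0}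
  {x ε : ℕ → Ω → ℝ} {p : Params} {R : Rules K} {f : Fin K → ℝ → ℝ}

lemma ae_valid (hs : Sampling P v x ε) (hK : Nonempty (Fin K)) (hT : 2 ≤ p.T) (hL : 0 < p.L)
    (hσ : 0 < p.σ) : ∀ᵐ ω ∂P, (path p R f x ε ω).Valid := by
  filter_upwards [hs.ae_generic p R f] with ω hω
  exact ⟨hK, hT, hL, hσ, hω⟩

/-- In trial `t` the ball `ρ` is partitioned. -/
def partEvent (p : Params) (R : Rules K) (f : Fin K → ℝ → ℝ) (x ε : ℕ → Ω → ℝ) (t : ℕ)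
    (ρ : Ball K) : Set Ω :=
  {ω | (path p R f x ε ω).parts t ∧ (path p R f x ε ω).ball t = ρ}

/-- In trial `t` the ball `ρ` is partitioned, and the samples in `S` are used at `z`. -/
def nbrsEvent (p : Params) (R : Rules K) (f : Fin K → ℝ → ℝ) (x ε : ℕ → Ω → ℝ) (t : ℕ)
    (ρ : Ball K) (a : Fin K) (z : ℝ) (S : Finset ℕ) : Set Ω :=
  partEvent p R f x ε t ρ ∩ {ω | (path p R f x ε ω).nbrs (t + 1) ρ a z = S}

lemma measurableSet_partEvent (hf : ∀ a, Measurable (f a)) (hx : ∀ t, Measurable (x t))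
    (hε : ∀ t, Measurable (ε t)) (t : ℕ) (ρ : Ball K) :
    MeasurableSet (partEvent p R f x ε t ρ) := by
  have h : MeasRun mΩ p R f x ε (t + 1) := measRun hf _ (fun s _ => hx s) (fun s _ => hε s)
  exact h.parts.inter (h.ball t (by omega) ρ)

lemma measurableSet_nbrsEvent (hf : ∀ a, Measurable (f a)) (hx : ∀ t, Measurable (x t))
    (hε : ∀ t, Measurable (ε t)) (t : ℕ) (ρ : Ball K) (a : Fin K) (z : ℝ) (S : Finset ℕ) :
    MeasurableSet (nbrsEvent p R f x ε t ρ a z S) := by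
  have h : MeasRun mΩ p R f x ε (t + 1) := measRun hf _ (fun s _ => hx s) (fun s _ => hε s)
  exact (measurableSet_partEvent hf hx hε t ρ).inter
    (disc_nbrs h.ctx h.ball h.arm h.flag ρ a z S)

/-- The noise terms with index in `S` replaced by zero. -/
def zeroOn (S : Finset ℕ) (ε : ℕ → Ω → ℝ) (s : ℕ) (ω : Ω) : ℝ := if s ∈ S then 0 else ε s ω

lemma mem_nbrsEvent_of_eq {ε' : ℕ → Ω → ℝ} {ω : Ω} (hv : (path p R f x ε ω).Valid) {t : ℕ}
    {ρ : Ball K} {a : Fin K} {z : ℝ} {S : Finset ℕ} (he : ∀ s ∉ S, ε s ω = ε' s ω)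
    (h : ω ∈ nbrsEvent p R f x ε t ρ a z S) : ω ∈ nbrsEvent p R f x ε' t ρ a z S := by
  obtain ⟨⟨hp, hb⟩, hn⟩ := h
  change (path p R f x ε ω).nbrs (t + 1) ρ a z = S at hn
  have := Path.parts_congr (π := path p R f x ε ω) (π' := path p R f x ε' ω)
    ⟨rfl, rfl, rfl, rfl⟩ hv hp a z (by rw [hb, hn]; exact he)
  rw [hb, hn] at this
  exact ⟨⟨this.1, this.2.1⟩, this.2.2⟩

lemma ae_valid_noise (hs : Sampling P v x ε) (hK : Nonempty (Fin K)) (hT : 2 ≤ p.T) (hL : 0 < p.L)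
    (hσ : 0 < p.σ) (ε' : ℕ → Ω → ℝ) : ∀ᵐ ω ∂P, (path p R f x ε' ω).Valid := by
  filter_upwards [ae_valid (R := R) (f := f) hs hK hT hL hσ] with ω hω
  exact ⟨hK, hT, hL, hσ, hω.gen.mem, hω.gen.irr, hω.gen.inj, hω.gen.sum⟩

/-- By `Path.parts_congr` the event does not see the noise of the samples in `S`; exceptional
contexts account for the null set. -/
lemma nbrsEvent_zeroOn (hs : Sampling P v x ε) (hK : Nonempty (Fin K)) (hT : 2 ≤ p.T)
    (hL : 0 < p.L) (hσ : 0 < p.σ) (t : ℕ) (ρ : Ball K) (a : Fin K) (z : ℝ) (S : Finset ℕ) :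
    nbrsEvent p R f x ε t ρ a z S =ᵐ[P] nbrsEvent p R f x (zeroOn S ε) t ρ a z S := by
  filter_upwards [ae_valid_noise (R := R) (f := f) hs hK hT hL hσ ε,
    ae_valid_noise (R := R) (f := f) hs hK hT hL hσ (zeroOn S ε)] with ω h1 h2
  refine propext ⟨mem_nbrsEvent_of_eq h1 fun s hs' => ?_,
    mem_nbrsEvent_of_eq h2 fun s hs' => ?_⟩
  · exact (if_neg hs').symm
  · exact if_neg hs'

/-- With the noise on `S` set to zero, the event is measurable with respect to the contexts and the
noise off `S`, so it is independent of the noise on `S`. -/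
lemma measure_nbrsEvent_inter (hs : Sampling P v x ε) (hK : Nonempty (Fin K)) (hT : 2 ≤ p.T)
    (hL : 0 < p.L) (hσ : 0 < p.σ) (hf : ∀ a, Measurable (f a)) (t : ℕ) (ρ : Ball K) (a : Fin K)
    (z : ℝ) (S : Finset ℕ) (c : ℝ) :
    P (nbrsEvent p R f x ε t ρ a z S ∩ {ω | c ≤ |∑ s ∈ S, ε s ω|})
      = P (nbrsEvent p R f x ε t ρ a z S) * P {ω | c ≤ |∑ s ∈ S, ε s ω|} := by
  have hAA' := nbrsEvent_zeroOn (R := R) (f := f) hs hK hT hL hσ t ρ a z S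
  have hdisj : Disjoint {i : ℕ ⊕ ℕ | ∀ s ∈ S, i ≠ Sum.inr s} {i | ∃ s ∈ S, i = Sum.inr s} := by
    rw [Set.disjoint_left]
    rintro i h1 ⟨s, hs', rfl⟩
    exact h1 s hs' rfl
  have hA'm : MeasurableSet[sig x ε {i : ℕ ⊕ ℕ | ∀ s ∈ S, i ≠ Sum.inr s}]
      (nbrsEvent p R f x (zeroOn S ε) t ρ a z S) := by
    refine measurableSet_nbrsEvent hf (fun s => measurable_sig_x fun u _ => by simp)
      (fun s => ?_) t ρ a z S
    by_cases h : s ∈ S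
    · rw [show zeroOn S ε s = fun _ => 0 from funext fun _ => if_pos h]
      exact measurable_const
    · rw [show zeroOn S ε s = ε s from funext fun _ => if_neg h]
      exact measurable_sig_e fun u hu hus => h (Sum.inr_injective hus ▸ hu)
  have hDm : MeasurableSet[sig x ε {i : ℕ ⊕ ℕ | ∃ s ∈ S, i = Sum.inr s}]
      {ω | c ≤ |∑ s ∈ S, ε s ω|} := by
    refine measurableSet_le measurable_const (continuous_abs.measurable.comp ?_)
    exact Finset.measurable_sum _ fun s hs' => measurable_sig_e ⟨s, hs', rfl⟩
  rw [measure_congr hAA', ← hs.measure_inter hdisj hA'm hDm]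
  exact measure_congr (hAA'.inter (Filter.EventuallyEq.refl _ _))

lemma card_of_mem_nbrsEvent {ω : Ω} (hω : (path p R f x ε ω).Valid) {t : ℕ} {ρ : Ball K}
    {a : Fin K} (ha : a ∈ ρ.arms) {z : ℝ} (hz : ¬ Irrational z) {S : Finset ℕ}
    (h : ω ∈ nbrsEvent p R f x ε t ρ a z S) : S.card = numNbr p ρ := by
  obtain ⟨⟨hp, hb⟩, hn⟩ := h
  change (path p R f x ε ω).nbrs (t + 1) ρ a z = S at hn
  rw [← hn]
  refine Path.card_nbrs hω.gen hz ?_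
  have hsuff := hp.2 a (hb ▸ ha)
  rw [← Path.hist_succ, hb, Path.suffData_iff] at hsuff
  exact (hsuff 1 (Finset.mem_Icc.2 ⟨le_rfl, by norm_num⟩)).trans (Path.partCount_le_card _ _ _ _)

/-- The events for different S are disjoint pieces of `partEvent`, and on each the sum behaves like
a Gaussian sum of k fixed terms. Summing over S therefore costs no extra factor. -/
lemma measure_part_noise_le (hs : Sampling P v x ε) (hv : 0 < v) (hK : Nonempty (Fin K))
    (hT : 2 ≤ p.T) (hL : 0 < p.L) (hσ : 0 < p.σ) (hf : ∀ a, Measurable (f a)) (t : ℕ)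
    {ρ : Ball K} {a : Fin K} (ha : a ∈ ρ.arms) {z : ℝ} (hz : ¬ Irrational z) {c : ℝ} (hc : 0 ≤ c) :
    P (partEvent p R f x ε t ρ ∩
      {ω | c ≤ |∑ s ∈ (path p R f x ε ω).nbrs (t + 1) ρ a z, ε s ω|})
      ≤ P (partEvent p R f x ε t ρ)
        * ENNReal.ofReal (2 * Real.exp (-(c ^ 2 / (2 * v * numNbr p ρ)))) := by
  set e := ENNReal.ofReal (2 * Real.exp (-(c ^ 2 / (2 * v * numNbr p ρ)))) with he
  set A := nbrsEvent p R f x ε t ρ a z with hA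
  have hkpos : 0 < numNbr p ρ := numNbr_pos hT hL hσ ⟨a, ha⟩
  have hsub : partEvent p R f x ε t ρ ∩
      {ω | c ≤ |∑ s ∈ (path p R f x ε ω).nbrs (t + 1) ρ a z, ε s ω|} ⊆
      ⋃ S, A S ∩ {ω | c ≤ |∑ s ∈ S, ε s ω|} := by
    rintro ω ⟨h1, h2⟩
    rw [Set.mem_ofPred_eq] at h2
    generalize hS : (path p R f x ε ω).nbrs (t + 1) ρ a z = S at h2
    exact Set.mem_iUnion.2 ⟨S, ⟨h1, hS⟩, h2⟩
  have hone : ∀ S, P (A S ∩ {ω | c ≤ |∑ s ∈ S, ε s ω|}) ≤ P (A S) * e := by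
    intro S
    rw [measure_nbrsEvent_inter hs hK hT hL hσ hf t ρ a z S c]
    by_cases hS : S.card = numNbr p ρ
    · have hD := hs.measure_sum_finset_ge_le hv (Finset.card_pos.1 (hS ▸ hkpos)) hc
      rw [hS] at hD
      exact mul_le_mul_right hD _
    · have h0 : P (A S) = 0 := by
        refine measure_eq_zero_iff_ae_notMem.2 ?_
        filter_upwards [ae_valid (R := R) (f := f) hs hK hT hL hσ] with ω hω hmem
        exact hS (card_of_mem_nbrsEvent hω ha hz hmem)
      rw [h0, zero_mul, zero_mul]
  have hdisj : Pairwise (Function.onFun Disjoint A) := by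
    intro S S' hne
    rw [Function.onFun, Set.disjoint_left]
    rintro ω ⟨_, h1⟩ ⟨_, h2⟩
    exact hne (Eq.trans (Eq.symm h1) h2)
  calc _ ≤ P (⋃ S, A S ∩ {ω | c ≤ |∑ s ∈ S, ε s ω|}) := measure_mono hsub
    _ ≤ ∑' S, P (A S ∩ {ω | c ≤ |∑ s ∈ S, ε s ω|}) := measure_iUnion_le _
    _ ≤ ∑' S, P (A S) * e := ENNReal.tsum_le_tsum hone
    _ = (∑' S, P (A S)) * e := ENNReal.tsum_mul_right
    _ = P (⋃ S, A S) * e := by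
        rw [measure_iUnion hdisj fun S => measurableSet_nbrsEvent hf hs.measX hs.measE t ρ a z S]
    _ ≤ _ := by
        gcongr
        exact Set.iUnion_subset fun S => Set.inter_subset_left

/-- The exponent equals kL²Δ²/(2048σ²), which is at least (5431/2048) ln(T|𝒜|) ≥ 2 ln(T|𝒜|) by the
choice of k. -/
lemma exp_part_le (hvσ : (v : ℝ) = p.σ ^ 2) (hT : 2 ≤ p.T) (hL : 0 < p.L) (hσ : 0 < p.σ)
    {ρ : Ball K} (hρ : ρ.arms.Nonempty) :
    2 * Real.exp (-((numNbr p ρ * (p.L * ρ.width / 32)) ^ 2 / (2 * v * numNbr p ρ)))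
      ≤ 2 / ((p.T : ℝ) * ρ.arms.card) ^ 2 := by
  have hk : (0 : ℝ) < numNbr p ρ := by
    exact_mod_cast numNbr_pos hT hL hσ hρ
  have h1 : (1 : ℝ) ≤ ρ.arms.card := by exact_mod_cast hρ.card_pos
  have h2 : (2 : ℝ) ≤ p.T := by exact_mod_cast hT
  have hpos : (0 : ℝ) < (p.T : ℝ) * ρ.arms.card := by positivity
  have h3 : 0 ≤ Real.log ((p.T : ℝ) * ρ.arms.card) := Real.log_nonneg (by nlinarith)
  have h5 := Nat.le_ceil (5431 * p.σ ^ 2 * Real.log ((p.T : ℝ) * ρ.arms.card)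
    / (p.L ^ 2 * ρ.width ^ 2))
  have hw := ρ.width_pos
  change _ ≤ (numNbr p ρ : ℝ) at h5
  rw [div_le_iff₀ (by positivity)] at h5
  have h6 : 2 * Real.log ((p.T : ℝ) * ρ.arms.card) ≤
      (numNbr p ρ * (p.L * ρ.width / 32)) ^ 2 / (2 * v * numNbr p ρ) := by
    rw [hvσ, le_div_iff₀ (by positivity)]
    have h7 : 0 ≤ p.σ ^ 2 * Real.log ((p.T : ℝ) * ρ.arms.card) := by positivity
    have h8 : 4 * (p.σ ^ 2 * Real.log ((p.T : ℝ) * ρ.arms.card)) ≤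
        numNbr p ρ * (p.L ^ 2 * ρ.width ^ 2) / 1024 := by linarith
    have := mul_le_mul_of_nonneg_left h8 hk.le
    nlinarith
  rw [div_eq_mul_inv (2 : ℝ) (_ ^ 2)]
  refine mul_le_mul_of_nonneg_left ?_ zero_le_two
  rw [← Real.exp_log (pow_pos hpos 2), ← Real.exp_neg, Real.log_pow]
  apply Real.exp_le_exp.2
  push_cast
  linarith

/-- For a fixed ball, |𝒜| arms, 2 halves and 200 grid points against 2/(T|𝒜|)² leave at most 800/T²
times the probability of partitioning it. Only one ball is partitioned per trial, so these
probabilities add up to at most 1. -/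
lemma measure_not_partNoise_le (hs : Sampling P v x ε) (hv : 0 < v) (hvσ : (v : ℝ) = p.σ ^ 2)
    (hK : Nonempty (Fin K)) (hT : 2 ≤ p.T) (hL : 0 < p.L) (hσ : 0 < p.σ)
    (hf : ∀ a, Measurable (f a)) :
    P {ω | ∃ t < p.T, ¬ (path p R f x ε ω).PartNoise t} ≤ ENNReal.ofReal (800 / p.T) := by
  have := hs.isProbabilityMeasure
  have hT' : (2 : ℝ) ≤ p.T := by exact_mod_cast hT
  set c : Ball K → ℝ := fun ρ => numNbr p ρ * (p.L * ρ.width / 32) with hc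
  have hc0 : ∀ ρ, 0 ≤ c ρ := fun ρ => by
    have := ρ.width_pos
    positivity
  set E : ℕ → Ball K → Fin K → ℕ → ℕ → Set Ω := fun t ρ a j i => partEvent p R f x ε t ρ ∩
    {ω | c ρ ≤ |∑ s ∈ (path p R f x ε ω).nbrs (t + 1) ρ a (Path.gridPt ρ j i), ε s ω|} with hE
  have hsub : {ω | ∃ t < p.T, ¬ (path p R f x ε ω).PartNoise t} ⊆ ⋃ t ∈ Finset.range p.T, ⋃ ρ,
      ⋃ a ∈ ρ.arms, ⋃ j ∈ Finset.range 2, ⋃ i ∈ Finset.Icc 1 200, E t ρ a j i := by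
    rintro ω ⟨t, ht, hbad⟩
    unfold Path.PartNoise at hbad
    push Not at hbad
    obtain ⟨hp, a, ha, j, hj, i, hi, hlt⟩ := hbad
    simp only [Set.mem_iUnion]
    exact ⟨t, Finset.mem_range.2 ht, _, a, ha, j, Finset.mem_range.2 hj, i, hi, ⟨hp, rfl⟩, hlt.le⟩
  have hball : ∀ t ρ, P (⋃ a ∈ ρ.arms, ⋃ j ∈ Finset.range 2, ⋃ i ∈ Finset.Icc 1 200, E t ρ a j i)
      ≤ P (partEvent p R f x ε t ρ) * ENNReal.ofReal (800 / (p.T : ℝ) ^ 2) := by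
    intro t ρ
    rcases ρ.arms.eq_empty_or_nonempty with h0 | hne
    · simp [h0]
    have hcard : (1 : ℝ) ≤ ρ.arms.card := by exact_mod_cast hne.card_pos
    have hb : ∀ a ∈ ρ.arms, ∀ j i, P (E t ρ a j i) ≤ P (partEvent p R f x ε t ρ)
        * ENNReal.ofReal (2 / ((p.T : ℝ) * ρ.arms.card) ^ 2) := by
      intro a ha j i
      refine (measure_part_noise_le hs hv hK hT hL hσ hf t ha
        (Path.gridPt_not_irrational ρ j i) (hc0 ρ)).trans ?_
      gcongr
      exact exp_part_le hvσ hT hL hσ hne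
    calc _ ≤ ∑ a ∈ ρ.arms, ∑ j ∈ Finset.range 2, ∑ i ∈ Finset.Icc 1 200,
          P (partEvent p R f x ε t ρ) * ENNReal.ofReal (2 / ((p.T : ℝ) * ρ.arms.card) ^ 2) := by
          refine (measure_biUnion_finset_le _ _).trans (Finset.sum_le_sum fun a ha => ?_)
          refine (measure_biUnion_finset_le _ _).trans (Finset.sum_le_sum fun j _ => ?_)
          exact (measure_biUnion_finset_le _ _).trans (Finset.sum_le_sum fun i _ => hb a ha j i)
      _ = P (partEvent p R f x ε t ρ) * ENNReal.ofReal
          (ρ.arms.card * (2 * (200 * (2 / ((p.T : ℝ) * ρ.arms.card) ^ 2)))) := by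
          simp only [Finset.sum_const, Finset.card_range, Nat.card_Icc, nsmul_eq_mul]
          rw [ENNReal.ofReal_mul (by positivity), ENNReal.ofReal_mul (by positivity),
            ENNReal.ofReal_mul (by positivity), ENNReal.ofReal_natCast]
          norm_num
          ring
      _ ≤ _ := by
          gcongr
          rw [div_eq_mul_inv 800, mul_pow, div_eq_mul_inv, mul_inv]
          have : (ρ.arms.card : ℝ) * ((ρ.arms.card : ℝ) ^ 2)⁻¹ ≤ 1 := by
            rw [← div_eq_mul_inv, div_le_one (by positivity)]
            nlinarith
          have h2 : (0 : ℝ) ≤ ((p.T : ℝ) ^ 2)⁻¹ := by positivity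
          nlinarith [mul_le_mul_of_nonneg_left this h2]
  have hone : ∀ t, ∑' ρ, P (partEvent p R f x ε t ρ) ≤ 1 := by
    intro t
    rw [← measure_univ (μ := P)]
    refine tsum_measure_le_measure_univ
      (fun ρ => (measurableSet_partEvent hf hs.measX hs.measE t ρ).nullMeasurableSet) ?_
    intro ρ ρ' hne
    refine Disjoint.aedisjoint (Set.disjoint_left.2 ?_)
    rintro ω ⟨_, h1⟩ ⟨_, h2⟩
    exact hne (h1.symm.trans h2)
  refine (measure_mono hsub).trans ((measure_biUnion_finset_le _ _).trans ?_)
  calc _ ≤ ∑ t ∈ Finset.range p.T, ENNReal.ofReal (800 / (p.T : ℝ) ^ 2) := by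
        refine Finset.sum_le_sum fun t _ => (measure_iUnion_le _).trans ?_
        refine (ENNReal.tsum_le_tsum (hball t)).trans ?_
        rw [ENNReal.tsum_mul_right]
        exact (mul_le_mul_left (hone t) _).trans (by rw [one_mul])
    _ = ENNReal.ofReal (800 / p.T) := by
        rw [Finset.sum_const, Finset.card_range, nsmul_eq_mul, ← ENNReal.ofReal_natCast,
          ← ENNReal.ofReal_mul (by positivity)]
        congr 1
        field_simp

end

end ApproxZooming

/-! ### Expected duration of the flagged phase -/

namespace ApproxZooming

noncomputable section

open scoped ENNReal NNReal

variable {K : ℕ} {Ω : Type*} {mΩ : MeasurableSpace Ω} {P : Measure Ω} {v : ℝ≥0}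
  {x ε : ℕ → Ω → ℝ} {p : Params} {R : Rules K} {f : Fin K → ℝ → ℝ}

/-- An irrational point of the dyadic interval of level `i` at position `l`. -/
def probePt (i l : ℕ) : ℝ := (l + Real.sqrt 2 / 2) / 2 ^ i

lemma probePt_nonneg (i l : ℕ) : 0 ≤ probePt i l := by
  unfold probePt
  positivity

lemma irrational_probePt (i l : ℕ) : Irrational (probePt i l) := by
  have h := ((irrational_sqrt_two.div_natCast (m := 2) (by norm_num)).natCast_add l).div_natCast
    (m := 2 ^ i) (by positivity)
  unfold probePt
  push_cast at h
  exact h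

lemma floor_probePt (i l : ℕ) : ⌊probePt i l * 2 ^ i⌋₊ = l := by
  have h0 : (0 : ℝ) < 2 ^ i := by positivity
  unfold probePt
  rw [div_mul_cancel₀ _ h0.ne', Nat.floor_eq_iff (by positivity)]
  have := Real.sqrt_two_lt_three_halves
  have := Real.sqrt_nonneg 2
  constructor <;> linarith

/-- A trial with context `probePt i l` after `t` trials would select a flagged ball of level `i` at
position `l` and play `a`, and the `j`-th part of this ball lacks samples of `a`. -/
def probeEvent (p : Params) (R : Rules K) (f : Fin K → ℝ → ℝ) (x ε : ℕ → Ω → ℝ)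
    (i l : ℕ) (a : Fin K) (j t : ℕ) : Set Ω :=
  {ω | flaggedPhase ((path p R f x ε ω).state t) (probePt i l) ∧
    selectArm p R ((path p R f x ε ω).state t) (probePt i l) = a ∧
    ((selectBall p R ((path p R f x ε ω).state t) (probePt i l)).level = i ∧
    (selectBall p R ((path p R f x ε ω).state t) (probePt i l)).pos = l ∧
    (path p R f x ε ω).partCount t
      (selectBall p R ((path p R f x ε ω).state t) (probePt i l)) a j
      < numNbr p (selectBall p R ((path p R f x ε ω).state t) (probePt i l)))}

lemma measurableSet_probeEvent {m : MeasurableSpace Ω} {t : ℕ} (h : MeasRun m p R f x ε t)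
    (i l : ℕ) (a : Fin K) (j : ℕ) : MeasurableSet[m] (probeEvent p R f x ε i l a j t) := by
  refine (h.flaggedPhase measurable_const).inter ((h.selectArm measurable_const a).inter ?_)
  refine (h.selectBall (measurable_const (a := probePt i l))).setOf_bind
    (P := fun ρ ω => ρ.level = i ∧ ρ.pos = l ∧
      (path p R f x ε ω).partCount t ρ a j < numNbr p ρ) fun ρ => ?_
  exact (MeasurableSet.const _).inter ((MeasurableSet.const _).inter
    ((disc_partCount h.ctx h.ball h.arm h.flag ρ a j).setOf (fun k => k < numNbr p ρ)))

lemma selectArm_congr {st : State K} {y z : ℝ} (hy : flaggedPhase st y) (hz : flaggedPhase st z)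
    (h : selectBall p R st y = selectBall p R st z) :
    selectArm p R st y = selectArm p R st z := by
  unfold selectArm
  simp only [if_pos hy, if_pos hz, h]

lemma mem_Icc_dyadic_iff {z : ℝ} (hz0 : 0 ≤ z) (hz : Irrational z) (i l : ℕ) :
    z ∈ Set.Icc ((l : ℝ) / 2 ^ i) ((l + 1 : ℝ) / 2 ^ i) ↔ ⌊z * 2 ^ i⌋₊ = l :=
  Ball.has_iff_floor (⟨i, l, ∅⟩ : Ball (0 : ℕ)) hz0 hz

/-- By `flagged_select_congr` the context matters only through its cell of level i, so it can be
replaced by the fixed point `probePt i l`. This separates an event about the trials before t from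
one about the context of trial t. -/
lemma lacks_iff {ω : Ω} (hv : (path p R f x ε ω).Valid) {i l : ℕ} {a : Fin K} {j t : ℕ} :
    (path p R f x ε ω).Lacks i l a j t ↔ ω ∈ probeEvent p R f x ε i l a j t ∧
      x t ω ∈ Set.Icc ((l : ℝ) / 2 ^ i) ((l + 1 : ℝ) / 2 ^ i) := by
  have hx0 : 0 ≤ x t ω := (hv.gen.mem t).1
  have hxi : Irrational (x t ω) := hv.gen.irr t
  rw [mem_Icc_dyadic_iff hx0 hxi]
  constructor
  · rintro ⟨⟨h1, h2, h3⟩, hf, hlt⟩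
    have hfl : ⌊x t ω * 2 ^ i⌋₊ = l := by
      have := (((path p R f x ε ω).ball t).has_iff_floor hx0 hxi).1 (hv.ball_has t)
      rwa [h1, h2] at this
    obtain ⟨hf', hb⟩ := Path.flagged_select_congr (p := p) (R := R) hx0 hxi hfl (probePt_nonneg i l)
      (irrational_probePt i l) (floor_probePt i l) hf h1
    refine ⟨⟨hf', ?_, ?_⟩, hfl⟩
    · exact (selectArm_congr hf' hf hb).trans h3
    · rw [hb]; exact ⟨h1, h2, hlt⟩
  · rintro ⟨⟨hf, h3, h1, h2, hlt⟩, hfl⟩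
    obtain ⟨hf', hb⟩ := Path.flagged_select_congr (p := p) (R := R) (probePt_nonneg i l)
      (irrational_probePt i l) (floor_probePt i l) hx0 hxi hfl hf h1
    have hb' : (path p R f x ε ω).ball t
      = selectBall p R ((path p R f x ε ω).state t) (probePt i l) := hb
    refine ⟨⟨?_, ?_, ?_⟩, hf', ?_⟩
    · rw [hb']; exact h1
    · rw [hb']; exact h2
    · exact (selectArm_congr hf' hf hb).trans h3
    · rw [hb']; exact hlt

lemma Path.inPart_iff {ρ : Ball K} {j : ℕ} {z : ℝ} : Path.inPart ρ j z ↔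
    z ∈ Set.Icc (((ρ.pos : ℝ) + ((j : ℝ) - 1) / 64) / 2 ^ ρ.level)
      (((ρ.pos : ℝ) + (j : ℝ) / 64) / 2 ^ ρ.level) := by
  unfold Path.inPart
  rw [Ball.width_eq, Ball.c0, Set.mem_Icc]
  have h1 : (ρ.pos : ℝ) / 2 ^ ρ.level + ((j : ℝ) - 1) * (1 / 2 ^ ρ.level) / 64
    = ((ρ.pos : ℝ) + ((j : ℝ) - 1) / 64) / 2 ^ ρ.level := by ring
  have h2 : (ρ.pos : ℝ) / 2 ^ ρ.level + (j : ℝ) * (1 / 2 ^ ρ.level) / 64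
    = ((ρ.pos : ℝ) + (j : ℝ) / 64) / 2 ^ ρ.level := by ring
  rw [h1, h2]

lemma lacks_inPart_iff {ω : Ω} (hv : (path p R f x ε ω).Valid) {i l : ℕ} {a : Fin K} {j t : ℕ}
    (hj : j ∈ Finset.Icc 1 64) :
    (path p R f x ε ω).Lacks i l a j t ∧ Path.inPart ((path p R f x ε ω).ball t) j (x t ω) ↔
      ω ∈ probeEvent p R f x ε i l a j t ∧
      x t ω ∈ Set.Icc (((l : ℝ) + ((j : ℝ) - 1) / 64) / 2 ^ i)
        (((l : ℝ) + (j : ℝ) / 64) / 2 ^ i) := by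
  obtain ⟨h1, h64⟩ := Finset.mem_Icc.1 hj
  have h1' : (1 : ℝ) ≤ j := by exact_mod_cast h1
  have h64' : (j : ℝ) ≤ 64 := by exact_mod_cast h64
  have hp : ∀ h : (path p R f x ε ω).Lacks i l a j t,
      (Path.inPart ((path p R f x ε ω).ball t) j (x t ω) ↔ x t ω ∈
      Set.Icc (((l : ℝ) + ((j : ℝ) - 1) / 64) / 2 ^ i) (((l : ℝ) + (j : ℝ) / 64) / 2 ^ i)) := by
    intro h
    rw [Path.inPart_iff, h.1.1, h.1.2.1]
  constructor
  · rintro ⟨hl, hin⟩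
    exact ⟨((lacks_iff hv).1 hl).1, (hp hl).1 hin⟩
  · rintro ⟨hB, hin⟩
    have hl : (path p R f x ε ω).Lacks i l a j t := by
      refine (lacks_iff hv).2 ⟨hB, Set.Icc_subset_Icc ?_ ?_ hin⟩ <;> gcongr <;> linarith
    exact ⟨hl, (hp hl).2 hin⟩

/-- The contexts and noise terms of the trials before `t`. -/
def beforeSet (t : ℕ) : Set (ℕ ⊕ ℕ) := {i | ∃ s < t, i = Sum.inl s ∨ i = Sum.inr s}

/-- `beforeSet t`, in contrast to `pastSet t`, leaves out the context of trial t, whose independence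
is used here. -/
lemma Sampling.measure_probe_inter (hs : Sampling P v x ε) (hf : ∀ a, Measurable (f a)) {i l : ℕ}
    (a : Fin K) (j t : ℕ) {c d : ℝ} (hc : 0 ≤ c) (hd : d ≤ 1) :
    P (probeEvent p R f x ε i l a j t ∩ {ω | x t ω ∈ Set.Icc c d})
      = P (probeEvent p R f x ε i l a j t) * ENNReal.ofReal (d - c) := by
  have hm : MeasRun (sig x ε (beforeSet t)) p R f x ε t :=
    measRun hf t (fun s hs' => measurable_sig_x ⟨s, hs', Or.inl rfl⟩)
      (fun s hs' => measurable_sig_e ⟨s, hs', Or.inr rfl⟩)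
  have hdisj : Disjoint (beforeSet t) {Sum.inl t} := by
    rw [Set.disjoint_singleton_right]
    rintro ⟨s, hs', h | h⟩
    · exact hs'.ne (Sum.inl_injective h).symm
    · simp at h
  have hset : {ω | x t ω ∈ Set.Icc c d} = x t ⁻¹' Set.Icc c d := rfl
  rw [← hs.measure_mem_Icc (t := t) hc hd, hset]
  exact hs.measure_inter hdisj (measurableSet_probeEvent hm i l a j)
    (measurableSet_Icc.preimage (measurable_sig_x rfl) : MeasurableSet[sig x ε {Sum.inl t}]
      (x t ⁻¹' Set.Icc c d))

lemma measurableSet_lacks (hs : Sampling P v x ε) (hf : ∀ a, Measurable (f a)) (i l : ℕ)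
    (a : Fin K) (j t : ℕ) : MeasurableSet {ω | (path p R f x ε ω).Lacks i l a j t} := by
  have h : MeasRun mΩ p R f x ε (t + 1) :=
    measRun hf _ (fun s _ => hs.measX s) (fun s _ => hs.measE s)
  have h' : MeasRun mΩ p R f x ε t := measRun hf _ (fun s _ => hs.measX s) (fun s _ => hs.measE s)
  have hb := h.ball t (by omega)
  refine MeasurableSet.inter (MeasurableSet.inter ?_ (MeasurableSet.inter ?_
    (h.arm t (by omega) a))) ((h.flag t (by omega)).inter ?_)
  · exact hb.setOf (fun ρ => ρ.level = i)
  · exact hb.setOf (fun ρ => ρ.pos = l)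
  · exact hb.setOf_bind (P := fun ρ ω => (path p R f x ε ω).partCount t ρ a j < numNbr p ρ)
      fun ρ => (disc_partCount h'.ctx h'.ball h'.arm h'.flag ρ a j).setOf (fun k => k < numNbr p ρ)

/-- Both events combine the same probe event with an interval for a uniform context, and the part
has 1/64 of the length of the cell. -/
lemma measure_lacks (hs : Sampling P v x ε) (hK : Nonempty (Fin K)) (hT : 2 ≤ p.T)
    (hL : 0 < p.L) (hσ : 0 < p.σ) (hf : ∀ a, Measurable (f a)) {i l : ℕ} (hl : l < 2 ^ i)
    (a : Fin K) {j : ℕ} (hj : j ∈ Finset.Icc 1 64) (t : ℕ) :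
    P {ω | (path p R f x ε ω).Lacks i l a j t} = 64 *
      P {ω | (path p R f x ε ω).Lacks i l a j t ∧
        Path.inPart ((path p R f x ε ω).ball t) j (x t ω)} := by
  have hae := ae_valid (R := R) (f := f) hs hK hT hL hσ
  obtain ⟨h1, h64⟩ := Finset.mem_Icc.1 hj
  have h1' : (1 : ℝ) ≤ j := by exact_mod_cast h1
  have h64' : (j : ℝ) ≤ 64 := by exact_mod_cast h64
  have hl' : (l : ℝ) + 1 ≤ 2 ^ i := by exact_mod_cast hl
  have hpos : (0 : ℝ) < 2 ^ i := by positivity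
  have e1 : {ω | (path p R f x ε ω).Lacks i l a j t} =ᵐ[P]
      (probeEvent p R f x ε i l a j t ∩
        {ω | x t ω ∈ Set.Icc ((l : ℝ) / 2 ^ i) ((l + 1 : ℝ) / 2 ^ i)} : Set Ω) := by
    filter_upwards [hae] with ω hω
    exact propext (lacks_iff hω)
  have e2 : {ω | (path p R f x ε ω).Lacks i l a j t ∧
        Path.inPart ((path p R f x ε ω).ball t) j (x t ω)} =ᵐ[P]
      (probeEvent p R f x ε i l a j t ∩ {ω | x t ω ∈ Set.Icc
        (((l : ℝ) + ((j : ℝ) - 1) / 64) / 2 ^ i) (((l : ℝ) + (j : ℝ) / 64) / 2 ^ i)} : Set Ω) := by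
    filter_upwards [hae] with ω hω
    exact propext (lacks_inPart_iff hω hj)
  rw [measure_congr e1, measure_congr e2, hs.measure_probe_inter hf a j t (by positivity)
    ((div_le_one hpos).2 hl'), hs.measure_probe_inter hf a j t
    (div_nonneg (by linarith [(Nat.cast_nonneg l : (0 : ℝ) ≤ l)]) hpos.le)
    ((div_le_one hpos).2 (by linarith)), mul_left_comm]
  congr 1
  rw [show (64 : ℝ≥0∞) = ENNReal.ofReal 64 by norm_num, ← ENNReal.ofReal_mul (by norm_num)]
  congr 1
  field_simp
  ring

/-- The expected number of lacking trials is 64 times the expected number of hits, and the hits are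
bounded on almost every path by `card_hits_le`. -/
lemma sum_measure_lacks_le (hs : Sampling P v x ε) (hK : Nonempty (Fin K)) (hT : 2 ≤ p.T)
    (hL : 0 < p.L) (hσ : 0 < p.σ) (hf : ∀ a, Measurable (f a)) {i l : ℕ} (hl : l < 2 ^ i)
    (a : Fin K) {j : ℕ} (hj : j ∈ Finset.Icc 1 64) (n : ℕ) :
    ∑ t ∈ Finset.range n, P {ω | (path p R f x ε ω).Lacks i l a j t}
      ≤ ENNReal.ofReal (64 * Path.nbrBound p K i) := by
  classical
  have := hs.isProbabilityMeasure
  set H : ℕ → Set Ω := fun t => {ω | (path p R f x ε ω).Lacks i l a j t ∧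
        Path.inPart ((path p R f x ε ω).ball t) j (x t ω)} with hH
  have hHm : ∀ t, MeasurableSet (H t) := by
    intro t
    refine (measurableSet_lacks hs hf i l a j t).inter ?_
    have h : MeasRun mΩ p R f x ε (t + 1) :=
      measRun hf _ (fun s _ => hs.measX s) (fun s _ => hs.measE s)
    exact (h.ball t (by omega)).setOf_bind (P := fun ρ ω => Path.inPart ρ j (x t ω)) fun ρ =>
      (measurableSet_le measurable_const (hs.measX t)).inter
        (measurableSet_le (hs.measX t) measurable_const)
  have hsum : ∑ t ∈ Finset.range n, P (H t) ≤ ENNReal.ofReal (Path.nbrBound p K i) := by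
    calc ∑ t ∈ Finset.range n, P (H t)
        = ∑ t ∈ Finset.range n, ∫⁻ ω, (H t).indicator 1 ω ∂P :=
          Finset.sum_congr rfl fun t _ => (lintegral_indicator_one (hHm t)).symm
      _ = ∫⁻ ω, ∑ t ∈ Finset.range n, (H t).indicator 1 ω ∂P :=
          (lintegral_finsetSum _ fun t _ => measurable_one.indicator (hHm t)).symm
      _ ≤ ∫⁻ _, ENNReal.ofReal (Path.nbrBound p K i) ∂P := by
          refine lintegral_mono_ae ?_
          filter_upwards [ae_valid (R := R) (f := f) hs hK hT hL hσ] with ω hω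
          have h := hω.card_hits_le i l a j n
          calc ∑ t ∈ Finset.range n, (H t).indicator (1 : Ω → ℝ≥0∞) ω
              = ((Finset.range n).filter fun t => ω ∈ H t).card := by
                simp only [Set.indicator_apply, Pi.one_apply]
                rw [Finset.sum_boole]
            _ = ENNReal.ofReal ((Finset.range n).filter fun t => ω ∈ H t).card := by
                rw [ENNReal.ofReal_natCast]
            _ ≤ _ := ENNReal.ofReal_le_ofReal (by convert h using 5 <;> rfl)
      _ = _ := by simp
  calc _ = ∑ t ∈ Finset.range n, 64 * P (H t) :=
        Finset.sum_congr rfl fun t _ => measure_lacks hs hK hT hL hσ hf hl a hj t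
    _ = 64 * ∑ t ∈ Finset.range n, P (H t) := by rw [Finset.mul_sum]
    _ ≤ 64 * ENNReal.ofReal (Path.nbrBound p K i) := by gcongr
    _ = _ := by rw [ENNReal.ofReal_mul (by norm_num)]; norm_num

end

end ApproxZooming

/-! ### Expected regret -/

namespace ApproxZooming

noncomputable section

open scoped ENNReal NNReal

variable {K : ℕ} {Ω : Type*} {mΩ : MeasurableSpace Ω} {P : Measure Ω} {v : ℝ≥0}
  {x ε : ℕ → Ω → ℝ} {p : Params} {R : Rules K} {f : Fin K → ℝ → ℝ}

lemma measurable_regret (hs : Sampling P v x ε) (hf : ∀ a, Measurable (f a)) :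
    Measurable (fun ω => regret p R f (fun t => x t ω) (fun t => ε t ω)) := by
  unfold regret
  refine Finset.measurable_sum _ fun t _ => Measurable.sub ?_ ?_
  · have : Measurable (optReward f) := Measurable.iSup hf
    exact this.comp (hs.measX t)
  · have h : MeasRun mΩ p R f x ε t :=
      measRun hf _ (fun s _ => hs.measX s) (fun s _ => hs.measE s)
    exact (h.selectArm (hs.measX t)).measurable_bind (F := fun a ω => f a (x t ω))
      fun a => (hf a).comp (hs.measX t)

lemma regret_mem_Icc [Nonempty (Fin K)] {L : ℝ} (hf : Regular L f) {y e : ℕ → ℝ}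
    (hy : ∀ t, y t ∈ Set.Icc (0 : ℝ) 1) : regret p R f y e ∈ Set.Icc (0 : ℝ) p.T := by
  have h := (⟨p, R, f, y, e⟩ : Path K).regret_eq_sum_loss
  change regret p R f y e = _ at h
  rw [h]
  constructor
  · exact Finset.sum_nonneg fun t _ => Path.loss_nonneg _ t
  · refine (Finset.sum_le_sum fun t _ => Path.loss_le_one hf (hy t)).trans ?_
    simp

lemma integrable_regret (hs : Sampling P v x ε) [Nonempty (Fin K)] {L : ℝ} (hf : Regular L f)
    (hfm : ∀ a, Measurable (f a)) :
    Integrable (fun ω => regret p R f (fun t => x t ω) (fun t => ε t ω)) P := by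
  have := hs.isProbabilityMeasure
  refine Integrable.of_bound (measurable_regret hs hfm).aestronglyMeasurable p.T ?_
  filter_upwards [ae_all_iff.2 hs.ae_mem] with ω hω
  have h := regret_mem_Icc (p := p) (R := R) (e := fun t => ε t ω) hf hω
  rw [Real.norm_eq_abs, abs_of_nonneg h.1]
  exact h.2

lemma integral_regret_le_horizon (hs : Sampling P v x ε) [Nonempty (Fin K)] {L : ℝ}
    (hf : Regular L f) (hfm : ∀ a, Measurable (f a)) :
    ∫ ω, regret p R f (fun t => x t ω) (fun t => ε t ω) ∂P ≤ p.T := by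
  have := hs.isProbabilityMeasure
  calc _ ≤ ∫ _, (p.T : ℝ) ∂P := by
        refine integral_mono_ae (integrable_regret hs hf hfm) (integrable_const _) ?_
        filter_upwards [ae_all_iff.2 hs.ae_mem] with ω hω
        exact (regret_mem_Icc hf hω).2
    _ = p.T := by simp

lemma measure_not_good_le (hs : Sampling P v x ε) (hv : 0 < v) (hvσ : (v : ℝ) = p.σ ^ 2)
    (hK : Nonempty (Fin K)) (hT : 2 ≤ p.T) (hL : 0 < p.L) (hσ : 0 < p.σ)
    (hf : ∀ a, Measurable (f a)) :
    P {ω | ¬ (path p R f x ε ω).Good} ≤ ENNReal.ofReal (802 / p.T) := by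
  have hsub : {ω | ¬ (path p R f x ε ω).Good} ⊆
      {ω | ∃ t < p.T, ¬ (path p R f x ε ω).UcbNoise t} ∪
      {ω | ∃ t < p.T, ¬ (path p R f x ε ω).PartNoise t} := by
    intro ω hω
    by_contra h
    simp only [Set.mem_union, Set.mem_ofPred_eq, not_or, not_exists, not_and, not_not] at h
    exact hω ⟨h.1, h.2⟩
  refine (measure_mono hsub).trans ((measure_union_le _ _).trans ?_)
  refine (add_le_add (measure_not_ucbNoise_le hs hv hvσ hT hf)
    (measure_not_partNoise_le hs hv hvσ hK hT hL hσ hf)).trans ?_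
  rw [← ENNReal.ofReal_add (by positivity) (by positivity)]
  exact ENNReal.ofReal_le_ofReal (by rw [← add_div]; norm_num)

/-- A bound for the expected number of plays of an arm at a given level and position. -/
def playBound (p : Params) (K i : ℕ) : ℝ := Path.actBound p i + 4096 * Path.nbrBound p K i

open Classical in
lemma integral_card_lacks_le (hs : Sampling P v x ε) (hK : Nonempty (Fin K)) (hT : 2 ≤ p.T)
    (hL : 0 < p.L) (hσ : 0 < p.σ) (hf : ∀ a, Measurable (f a)) {i l : ℕ} (hl : l < 2 ^ i)
    (a : Fin K) {j : ℕ} (hj : j ∈ Finset.Icc 1 64) (n : ℕ) :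
    Integrable (fun ω => (((Finset.range n).filter
        (fun t => (path p R f x ε ω).Lacks i l a j t)).card : ℝ)) P ∧
      ∫ ω, (((Finset.range n).filter
        (fun t => (path p R f x ε ω).Lacks i l a j t)).card : ℝ) ∂P ≤ 64 * Path.nbrBound p K i := by
  have := hs.isProbabilityMeasure
  have hm := fun t => measurableSet_lacks (R := R) hs hf i l a j t (p := p)
  have he : (fun ω => (((Finset.range n).filter
      (fun t => (path p R f x ε ω).Lacks i l a j t)).card : ℝ)) = fun ω => ∑ t ∈ Finset.range n,
      {ω | (path p R f x ε ω).Lacks i l a j t}.indicator (fun _ => (1 : ℝ)) ω := by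
    funext ω
    simp only [Set.indicator_apply]
    rw [← Finset.sum_boole]
    rfl
  have hi : ∀ t, Integrable ({ω | (path p R f x ε ω).Lacks i l a j t}.indicator
      (fun _ => (1 : ℝ))) P := fun t => (integrable_const _).indicator (hm t)
  rw [he]
  refine ⟨integrable_finsetSum _ fun t _ => hi t, ?_⟩
  rw [integral_finsetSum _ fun t _ => hi t]
  have h0 : 0 ≤ 64 * Path.nbrBound p K i := by
    have hT' : (1 : ℝ) ≤ p.T := by exact_mod_cast (by omega : 1 ≤ p.T)
    have hK' : (1 : ℝ) ≤ K := by exact_mod_cast (Fin.pos_iff_nonempty.2 hK)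
    have := Real.log_nonneg (by nlinarith : (1 : ℝ) ≤ p.T * K)
    unfold Path.nbrBound
    positivity
  have h := ENNReal.toReal_mono ENNReal.ofReal_ne_top
    (sum_measure_lacks_le (R := R) hs hK hT hL hσ hf hl a hj n)
  rw [ENNReal.toReal_ofReal h0, ENNReal.toReal_sum fun t _ => measure_ne_top _ _] at h
  refine le_trans (le_of_eq (Finset.sum_congr rfl fun t _ => ?_)) h
  rw [integral_indicator_const _ (hm t)]
  simp [Measure.real]

lemma integral_add_const_add_indicator [IsProbabilityMeasure P] {g : Ω → ℝ} (hg : Integrable g P)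
    {B : Set Ω} (hB : MeasurableSet B) (c d : ℝ) :
    ∫ ω, (g ω + c + B.indicator (fun _ => d) ω) ∂P = ∫ ω, g ω ∂P + c + P.real B * d := by
  have h1 : Integrable (fun ω => g ω + c) P := hg.add (integrable_const c)
  have h2 : Integrable (B.indicator fun _ => d) P := (integrable_const d).indicator hB
  rw [integral_add h1 h2, integral_add hg (integrable_const c), integral_indicator_const _ hB,
    integral_const, probReal_univ, one_smul, smul_eq_mul]

open Classical in
lemma integral_regret_le (hs : Sampling P v x ε) (hv : 0 < v) (hvσ : (v : ℝ) = p.σ ^ 2)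
    (hK : Nonempty (Fin K)) (hT : 2 ≤ p.T) (hL : 0 < p.L) (hσ : 0 < p.σ) (hf : Regular p.L f)
    (hfm : ∀ a, Measurable (f a)) (m : ℕ) :
    ∫ ω, regret p R f (fun t => x t ω) (fun t => ε t ω) ∂P ≤
      ∑ i ∈ Finset.range (m + 2), ∑ l ∈ Finset.range (2 ^ i), ∑ a,
        Path.weight p.L f m i l a * playBound p K i + 16 * p.L * p.T / 2 ^ m + 802 := by
  have := hs.isProbabilityMeasure
  have hT' : (2 : ℝ) ≤ p.T := by exact_mod_cast hT
  -- A measurable hull avoids proving that goodness is a measurable event. On it the regret is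
  -- bounded by T, which contributes at most T · 802/T.
  set bad := toMeasurable P {ω | ¬ (path p R f x ε ω).Good} with hbad
  have hbm : MeasurableSet bad := measurableSet_toMeasurable _ _
  have hPbad : P.real bad ≤ 802 / p.T := by
    have h := measure_not_good_le (R := R) hs hv hvσ hK hT hL hσ hfm
    rw [← measure_toMeasurable] at h
    exact ENNReal.toReal_le_of_le_ofReal (by positivity) h
  set c : ℕ → ℕ → Fin K → ℕ → Ω → ℝ := fun i l a j ω => (((Finset.range p.T).filter
        (fun t => (path p R f x ε ω).Lacks i l a j t)).card : ℝ) with hc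
  have hcI := fun i l (hl : l ∈ Finset.range (2 ^ i)) a j (hj : j ∈ Finset.Icc 1 64) =>
    integral_card_lacks_le (R := R) hs hK hT hL hσ hfm (Finset.mem_range.1 hl) a hj p.T
  have hcS : ∀ i, ∀ l ∈ Finset.range (2 ^ i), ∀ a, Integrable
      (fun ω => Path.weight p.L f m i l a * (Path.actBound p i
        + ∑ j ∈ Finset.Icc (1 : ℕ) 64, c i l a j ω)) P := fun i l hl a =>
    ((integrable_const _).add
      (integrable_finsetSum _ fun j hj => (hcI i l hl a j hj).1)).const_mul _
  have hcT : Integrable (fun ω => ∑ i ∈ Finset.range (m + 2), ∑ l ∈ Finset.range (2 ^ i), ∑ a,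
      Path.weight p.L f m i l a * (Path.actBound p i
        + ∑ j ∈ Finset.Icc (1 : ℕ) 64, c i l a j ω)) P :=
    integrable_finsetSum _ fun i _ => integrable_finsetSum _ fun l hl =>
      integrable_finsetSum _ fun a _ => hcS i l hl a
  have hbI : Integrable (bad.indicator fun _ => (p.T : ℝ)) P := (integrable_const _).indicator hbm
  calc _ ≤ ∫ ω, (∑ i ∈ Finset.range (m + 2), ∑ l ∈ Finset.range (2 ^ i), ∑ a,
        Path.weight p.L f m i l a * (Path.actBound p i
          + ∑ j ∈ Finset.Icc (1 : ℕ) 64, c i l a j ω) + 16 * p.L * p.T / 2 ^ m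
          + bad.indicator (fun _ => (p.T : ℝ)) ω) ∂P := by
        refine integral_mono_ae (integrable_regret hs hf hfm)
          ((hcT.add (integrable_const _)).add hbI) ?_
        filter_upwards [ae_valid (R := R) (f := f) hs hK hT hL hσ] with ω hω
        by_cases hg : (path p R f x ε ω).Good
        · have h1 := hg.regret_le hω hf m
          have h2 : 0 ≤ bad.indicator (fun _ => (p.T : ℝ)) ω :=
            Set.indicator_nonneg (fun _ _ => by positivity) _
          exact h1.trans (le_add_of_nonneg_right h2)
        · have h1 : ω ∈ bad := subset_toMeasurable _ _ hg
          have h2 := (regret_mem_Icc (p := p) (R := R) (e := fun t => ε t ω) hf hω.gen.mem).2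
          rw [Set.indicator_of_mem h1]
          refine le_trans h2 (le_add_of_nonneg_left (add_nonneg ?_ (by positivity)))
          refine Finset.sum_nonneg fun i _ => Finset.sum_nonneg fun l _ =>
            Finset.sum_nonneg fun a _ => mul_nonneg (Path.weight_nonneg hL.le _ _ _ _ _)
            (add_nonneg ?_ (Finset.sum_nonneg fun j _ => by positivity))
          have := Real.log_nonneg (by linarith : (1 : ℝ) ≤ p.T)
          unfold Path.actBound
          positivity
    _ = ∑ i ∈ Finset.range (m + 2), ∑ l ∈ Finset.range (2 ^ i), ∑ a,
        Path.weight p.L f m i l a * (Path.actBound p i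
          + ∑ j ∈ Finset.Icc (1 : ℕ) 64, ∫ ω, c i l a j ω ∂P) + 16 * p.L * p.T / 2 ^ m
          + P.real bad * p.T := by
        rw [integral_add_const_add_indicator hcT hbm,
          integral_finsetSum _ fun i _ => integrable_finsetSum _ fun l hl =>
            integrable_finsetSum _ fun a _ => hcS i l hl a]
        congr 2
        refine Finset.sum_congr rfl fun i _ => ?_
        rw [integral_finsetSum _ fun l hl => integrable_finsetSum _ fun a _ => hcS i l hl a]
        refine Finset.sum_congr rfl fun l hl => ?_
        rw [integral_finsetSum _ fun a _ => hcS i l hl a]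
        refine Finset.sum_congr rfl fun a _ => ?_
        rw [integral_const_mul, integral_add (integrable_const _)
          (integrable_finsetSum _ fun j hj => (hcI i l hl a j hj).1), integral_const,
          probReal_univ, one_smul, integral_finsetSum _ fun j hj => (hcI i l hl a j hj).1]
    _ ≤ _ := by
        refine add_le_add (add_le_add (Finset.sum_le_sum fun i _ => Finset.sum_le_sum fun l hl =>
          Finset.sum_le_sum fun a _ => mul_le_mul_of_nonneg_left ?_
            (Path.weight_nonneg hL.le _ _ _ _ _)) le_rfl) ?_
        · unfold playBound
          refine add_le_add le_rfl ?_
          -- 64 parts with at most `64 * nbrBound` expected trials each give the factor 4096.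
          refine (Finset.sum_le_sum fun j hj => (hcI i l hl a j hj).2).trans (le_of_eq ?_)
          rw [Finset.sum_const, Nat.card_Icc, nsmul_eq_mul]
          push_cast
          ring
        · rwa [← le_div_iff₀ (by linarith)]

end

end ApproxZooming

/-! ### Collecting the constants -/

namespace ApproxZooming

noncomputable section

open scoped ENNReal NNReal

variable {K : ℕ} {Ω : Type*} {mΩ : MeasurableSpace Ω} {P : Measure Ω} {v : ℝ≥0}
  {x ε : ℕ → Ω → ℝ} {p : Params} {R : Rules K} {f : Fin K → ℝ → ℝ}

lemma playBound_nonneg (hT : 2 ≤ p.T) (hK : 1 ≤ K) (i : ℕ) : 0 ≤ playBound p K i := by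
  have hT' : (2 : ℝ) ≤ p.T := by exact_mod_cast hT
  have hK' : (1 : ℝ) ≤ K := by exact_mod_cast hK
  have := Real.log_nonneg (by linarith : (1 : ℝ) ≤ p.T)
  have := Real.log_nonneg (by nlinarith : (1 : ℝ) ≤ p.T * K)
  unfold playBound Path.actBound Path.nbrBound
  positivity

/-- `M` stands for `max 1 (L² / (σ² ln(TK)))`, of which only `L² ≤ M σ² ln(TK)` is used. -/
lemma playBound_le (hT : 2 ≤ p.T) (hK : 1 ≤ K) (hL : 0 < p.L) {M : ℝ} (hM1 : 1 ≤ M)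
    (hM : p.L ^ 2 ≤ M * (p.σ ^ 2 * Real.log (p.T * K))) (i : ℕ) :
    playBound p K i ≤ 3e7 * (M * (p.σ ^ 2 * Real.log (p.T * K)) / p.L ^ 2 * 4 ^ i) := by
  have hT' : (2 : ℝ) ≤ p.T := by exact_mod_cast hT
  have hK' : (1 : ℝ) ≤ K := by exact_mod_cast hK
  have hlog0 := Real.log_nonneg (by linarith : (1 : ℝ) ≤ p.T)
  have hlog : Real.log p.T ≤ Real.log (p.T * K) := Real.log_le_log (by linarith) (by nlinarith)
  set W := p.σ ^ 2 * Real.log (p.T * K) with hW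
  have hW1 : p.σ ^ 2 * Real.log p.T ≤ W := mul_le_mul_of_nonneg_left hlog (sq_nonneg _)
  have hW0 : 0 ≤ W := (mul_nonneg (sq_nonneg _) hlog0).trans hW1
  have hL2 : 0 < p.L ^ 2 := by positivity
  have h4 : (1 : ℝ) ≤ 4 ^ i := one_le_pow₀ (by norm_num)
  have hMW : W ≤ M * W := by nlinarith
  set Y := M * W / p.L ^ 2 * 4 ^ i with hY
  -- This is where the maximum in the theorem is needed: it absorbs the rounding terms `+ 2` and `+
  -- 1`. Then 6 + 2 + 4096 · 5432 < 3e7.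
  have h1 : 1 ≤ Y := by
    have : 1 ≤ M * W / p.L ^ 2 := (one_le_div hL2).2 hM
    nlinarith
  have h2 : ∀ w ≤ W, w / (p.L ^ 2 * (1 / 2 ^ i) ^ 2) ≤ Y := by
    intro w hw
    have e : w / (p.L ^ 2 * (1 / 2 ^ i) ^ 2) = w / p.L ^ 2 * 4 ^ i := by
      rw [one_div, inv_pow, ← pow_mul, mul_comm i 2, pow_mul]
      norm_num
      field_simp
    rw [e, hY]
    gcongr
    linarith
  have h3 := h2 _ hW1
  have h5 := h2 W le_rfl
  have e1 : Path.actBound p i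
      = 6 * (p.σ ^ 2 * Real.log p.T / (p.L ^ 2 * (1 / 2 ^ i) ^ 2)) + 2 := by
    unfold Path.actBound
    ring
  have e2 : Path.nbrBound p K i = 5431 * (W / (p.L ^ 2 * (1 / 2 ^ i) ^ 2)) + 1 := by
    unfold Path.nbrBound
    rw [hW]
    ring
  unfold playBound
  rw [e1, e2]
  norm_num at *
  linarith

open Classical in
lemma sum_weight {L : ℝ} {m i : ℕ} (h2 : 2 ≤ i) (hm : i < m) :
    ∑ l ∈ Finset.range (2 ^ i), ∑ a, Path.weight L f m i l a
      = 16 * L / 2 ^ i * nearOptCount L f i := by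
  unfold nearOptCount
  rw [← Finset.Ico_add_one_right_eq_Icc, Finset.sum_Ico_eq_sum_range, Nat.add_sub_cancel,
    Nat.cast_sum, Finset.mul_sum]
  refine Finset.sum_congr rfl fun l _ => ?_
  rw [add_comm 1 l]
  have hw : ∀ a, Path.weight L f m i l a = if Path.Contributes L f i (l + 1) then
      (if Path.NearOpt L f i (l + 1) a then 16 * L / 2 ^ i else 0) else 0 := by
    intro a
    unfold Path.weight
    rw [if_neg (by omega)]
    by_cases h1 : Path.Contributes L f i (l + 1) <;> simp [h1, hm]
  simp only [hw]
  change _ = 16 * L / 2 ^ i * ((if Path.Contributes L f i (l + 1) then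
    (Finset.univ.filter (Path.NearOpt L f i (l + 1))).card else 0 : ℕ) : ℝ)
  split_ifs
  · rw [← Finset.sum_filter, Finset.sum_const, nsmul_eq_mul, mul_comm]
  · simp

/-- Levels 0 and 1 have 2^i K pairs of weight 1, each with at most 3e7 · Y · 4^i plays, in total 3e7
(1 + 8) KY. At a level i ≥ 2 the product of 16L2^{-i}, M_i and the play bound is 4.8e8 · M times the
i-th term of the rate. Since KY ≥ 1, the constant 802 is absorbed as well. -/
lemma sum_weight_mul_le (hT : 2 ≤ p.T) (hK : 1 ≤ K) (hL : 0 < p.L) {M : ℝ} (hM1 : 1 ≤ M)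
    (hM : p.L ^ 2 ≤ M * (p.σ ^ 2 * Real.log (p.T * K))) {m : ℕ} (hm : 1 ≤ m) :
    ∑ i ∈ Finset.range (m + 2), ∑ l ∈ Finset.range (2 ^ i), ∑ a,
        Path.weight p.L f m i l a * playBound p K i + 16 * p.L * p.T / 2 ^ m + 802
      ≤ 5e8 * M * (p.σ ^ 2 / p.L ^ 2 * K * Real.log (p.T * K) + (p.L * p.T / 2 ^ m
      + ∑ i ∈ Finset.Ico 1 m,
          p.σ ^ 2 / p.L * nearOptCount p.L f i * 2 ^ i * Real.log (p.T * K))) := by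
  have hK' : (1 : ℝ) ≤ K := by exact_mod_cast hK
  have hT' : (2 : ℝ) ≤ p.T := by exact_mod_cast hT
  have hlog := Real.log_nonneg (by nlinarith : (1 : ℝ) ≤ p.T * K)
  set W := p.σ ^ 2 * Real.log (p.T * K) with hW
  have hW0 : 0 ≤ W := mul_nonneg (sq_nonneg _) hlog
  have hL2 : 0 < p.L ^ 2 := by positivity
  set Y := M * W / p.L ^ 2 with hY
  have hY1 : 1 ≤ Y := (one_le_div hL2).2 hM
  set A : ℕ → ℝ := fun i => p.σ ^ 2 / p.L * nearOptCount p.L f i * 2 ^ i * Real.log (p.T * K)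
    with hA
  have hA0 : ∀ i, 0 ≤ A i := fun i => by positivity
  have hterm : ∀ i ∈ Finset.range (m + 2),
      ∑ l ∈ Finset.range (2 ^ i), ∑ a, Path.weight p.L f m i l a * playBound p K i
      ≤ (if i ∈ Finset.range 2 then 3e7 * (K * Y) * 8 ^ i else 0)
        + (if i ∈ Finset.Ico 1 m then 4.8e8 * M * A i else 0) := by
    intro i _
    have hp0 := playBound_nonneg (p := p) hT hK i
    have hp := playBound_le hT hK hL hM1 hM i
    rw [← hW, ← hY] at hp
    have hsnd : 0 ≤ if i ∈ Finset.Ico 1 m then 4.8e8 * M * A i else 0 := by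
      have := hA0 i
      split_ifs <;> positivity
    simp only [← Finset.sum_mul]
    rcases Nat.lt_or_ge i 2 with hi | hi
    · rw [if_pos (Finset.mem_range.2 hi)]
      refine le_add_of_le_of_nonneg ?_ hsnd
      have e : ∑ l ∈ Finset.range (2 ^ i), ∑ a, Path.weight p.L f m i l a = 2 ^ i * K := by
        simp [Path.weight, hi]
      rw [e]
      refine (mul_le_mul_of_nonneg_left hp (by positivity)).trans (le_of_eq ?_)
      rw [show (8 : ℝ) ^ i = 2 ^ i * 4 ^ i by rw [← mul_pow]; norm_num]
      ring
    · rw [if_neg (fun h => absurd (Finset.mem_range.1 h) (by omega)), zero_add]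
      rcases Nat.lt_or_ge i m with him | him
      · rw [if_pos (Finset.mem_Ico.2 ⟨by omega, him⟩), sum_weight hi him]
        refine (mul_le_mul_of_nonneg_left hp (by positivity)).trans (le_of_eq ?_)
        rw [hA, hY, hW, show (4 : ℝ) ^ i = 2 ^ i * 2 ^ i by rw [← mul_pow]; norm_num]
        field_simp
        ring
      · have e : ∑ l ∈ Finset.range (2 ^ i), ∑ a, Path.weight p.L f m i l a = 0 := by
          refine Finset.sum_eq_zero fun l _ => Finset.sum_eq_zero fun a _ => ?_
          unfold Path.weight
          rw [if_neg (by omega), if_neg (by omega)]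
        rw [e, zero_mul]
        exact hsnd
  have hsum := Finset.sum_le_sum hterm
  rw [Finset.sum_add_distrib, Finset.sum_ite_mem, Finset.sum_ite_mem] at hsum
  have h1 : ∑ i ∈ Finset.range (m + 2) ∩ Finset.range 2, 3e7 * ((K : ℝ) * Y) * 8 ^ i
      = 2.7e8 * (K * Y) := by
    rw [Finset.inter_eq_right.2 (Finset.range_subset_range.2 (by omega)), Finset.sum_range_succ,
      Finset.sum_range_one]
    ring
  have h2 : ∑ i ∈ Finset.range (m + 2) ∩ Finset.Ico 1 m, 4.8e8 * M * A i
      ≤ 4.8e8 * M * ∑ i ∈ Finset.Ico 1 m, A i := by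
    rw [Finset.mul_sum]
    refine Finset.sum_le_sum_of_subset_of_nonneg Finset.inter_subset_right fun i _ _ => ?_
    have := hA0 i
    positivity
  have h3 : 16 * p.L * p.T / 2 ^ m ≤ 16 * M * (p.L * p.T / 2 ^ m) := by
    have : 0 ≤ p.L * p.T / 2 ^ m := by positivity
    have e : 16 * p.L * p.T / 2 ^ m = 16 * (p.L * p.T / 2 ^ m) := by ring
    rw [e]
    nlinarith
  have h4 : (1 : ℝ) ≤ K * Y := by nlinarith
  have e : M * (p.σ ^ 2 / p.L ^ 2 * K * Real.log (p.T * K)) = K * Y := by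
    rw [hY, hW]
    ring
  have h5 : 0 ≤ M * ∑ i ∈ Finset.Ico 1 m, A i :=
    mul_nonneg (by linarith) (Finset.sum_nonneg fun i _ => hA0 i)
  have h6 : 0 ≤ M * (p.L * p.T / 2 ^ m) := by positivity
  calc _ ≤ 2.7e8 * (K * Y) + 4.8e8 * M * ∑ i ∈ Finset.Ico 1 m, A i
        + 16 * M * (p.L * p.T / 2 ^ m) + 802 * (K * Y) := by linarith
    _ ≤ 5e8 * (K * Y) + 5e8 * (M * (p.L * p.T / 2 ^ m))
        + 5e8 * (M * ∑ i ∈ Finset.Ico 1 m, A i) := by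
        norm_num at *
        linarith
    _ = _ := by rw [← e]; ring

lemma le_mul_regretRate {T : ℕ} {L σ c X : ℝ} (hc : 0 < c)
    (h : ∀ m : ℕ, 1 ≤ m → X ≤ c * (σ ^ 2 / L ^ 2 * K * Real.log (T * K) + (L * T / 2 ^ m
      + ∑ i ∈ Finset.Ico 1 m, σ ^ 2 / L * nearOptCount L f i * 2 ^ i * Real.log (T * K)))) :
    X ≤ c * regretRate K T L σ f := by
  unfold regretRate
  rw [← div_le_iff₀' hc, ← sub_le_iff_le_add']
  refine le_ciInf fun m => ?_
  rw [sub_le_iff_le_add', div_le_iff₀' hc]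
  exact h m m.2

lemma Sampling.regret_bound (hs : Sampling P v x ε) (hv : 0 < v) (hvσ : (v : ℝ) = p.σ ^ 2)
    (hTK : 2 ≤ p.T * K) (hL : 0 < p.L) (hσ : 0 < p.σ) (hf : Regular p.L f)
    (hfm : ∀ a, Measurable (f a)) :
    ∫ ω, regret p R f (fun t => x t ω) (fun t => ε t ω) ∂P ≤
      5e8 * max 1 (p.L ^ 2 / (p.σ ^ 2 * Real.log (p.T * K))) * regretRate K p.T p.L p.σ f := by
  have hT1 : 1 ≤ p.T := Nat.pos_of_ne_zero fun h => by simp [h] at hTK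
  have hK1 : 1 ≤ K := Nat.pos_of_ne_zero fun h => by simp [h] at hTK
  have hK : Nonempty (Fin K) := Fin.pos_iff_nonempty.1 hK1
  have hTK' : (2 : ℝ) ≤ p.T * K := by exact_mod_cast hTK
  have hlog : 0 < Real.log (p.T * K) := Real.log_pos (by linarith)
  have hW : 0 < p.σ ^ 2 * Real.log (p.T * K) := by positivity
  set M := max 1 (p.L ^ 2 / (p.σ ^ 2 * Real.log (p.T * K))) with hM
  have hM1 : 1 ≤ M := le_max_left _ _
  have hM2 : p.L ^ 2 ≤ M * (p.σ ^ 2 * Real.log (p.T * K)) :=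
    (div_le_iff₀ hW).1 (le_max_right _ _)
  refine le_mul_regretRate (by positivity) fun m hm => ?_
  -- For T = 1 the regret is at most 1, while M times the first term of the rate is at least K ≥ 1.
  rcases Nat.lt_or_ge p.T 2 with hT | hT
  · have h1 := integral_regret_le_horizon (p := p) (R := R) hs hf hfm
    have hTe : p.T = 1 := by omega
    rw [hTe, Nat.cast_one] at h1
    refine h1.trans ?_
    have hK' : (1 : ℝ) ≤ K := by exact_mod_cast hK1
    have h2 : 0 ≤ M * (p.L * p.T / 2 ^ m + ∑ i ∈ Finset.Ico 1 m,
        p.σ ^ 2 / p.L * nearOptCount p.L f i * 2 ^ i * Real.log (p.T * K)) := by positivity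
    have h3 : 1 ≤ M * (p.σ ^ 2 * Real.log (p.T * K)) / p.L ^ 2 :=
      (one_le_div (by positivity)).2 hM2
    have h4 : M * (p.σ ^ 2 / p.L ^ 2 * K * Real.log (p.T * K))
      = K * (M * (p.σ ^ 2 * Real.log (p.T * K)) / p.L ^ 2) := by ring
    have h5 : 1 ≤ M * (p.σ ^ 2 / p.L ^ 2 * K * Real.log (p.T * K)) := by rw [h4]; nlinarith
    rw [mul_assoc, mul_add]
    norm_num at *
    linarith
  · exact (integral_regret_le hs hv hvσ hK hT hL hσ hf hfm m).trans
      (sum_weight_mul_le hT hK1 hL hM1 hM2 hm)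

end

end ApproxZooming

/-! ### Reduction to measurable rewards, contexts and noise -/

namespace ApproxZooming

noncomputable section

variable {K : ℕ} {Ω : Type*} {mΩ : MeasurableSpace Ω} {P : Measure Ω}
  {p : Params} {R : Rules K} {f g : Fin K → ℝ → ℝ}

lemma optReward_congr {y : ℝ} (h : ∀ a, f a y = g a y) : optReward f y = optReward g y :=
  iSup_congr h

lemma gap_congr {y : ℝ} (h : ∀ a, f a y = g a y) : gap f y = gap g y := by
  simp only [gap, optReward_congr h, h]

lemma run_congr {y e : ℕ → ℝ} (h : ∀ a t, f a (y t) = g a (y t)) (n : ℕ) :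
    run p R f y e n = run p R g y e n := by
  induction n with
  | zero => rfl
  | succ n ih => simp only [run, ih, h]

lemma regret_congr {y e : ℕ → ℝ} (h : ∀ a t, f a (y t) = g a (y t)) :
    regret p R f y e = regret p R g y e := by
  simp only [regret, run_congr h, h, fun t => optReward_congr fun a => h a t]

lemma nearOptCount_congr {L : ℝ} (h : ∀ a, ∀ y ∈ Set.Icc (0 : ℝ) 1, f a y = g a y) (i : ℕ) :
    nearOptCount L f i = nearOptCount L g i := by
  classical
  unfold nearOptCount
  refine Finset.sum_congr rfl fun l hl => ?_
  obtain ⟨h1, h2⟩ := Finset.mem_Icc.1 hl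
  have h1' : (1 : ℝ) ≤ l := by exact_mod_cast h1
  have h2' : (l : ℝ) ≤ 2 ^ i := by exact_mod_cast h2
  have hpos : (0 : ℝ) < 2 ^ i := by positivity
  have hr : (l : ℝ) / 2 ^ i ≤ 1 := (div_le_one hpos).2 h2'
  have hl0 : 0 ≤ ((l : ℝ) - 1) / 2 ^ i := div_nonneg (by linarith) hpos.le
  have e1 : (∃ x ∈ Set.Icc (((l : ℝ) - 1) / 2 ^ i) ((l : ℝ) / 2 ^ i), gap f x ≤ 20 * L / 2 ^ i) ↔
      ∃ x ∈ Set.Icc (((l : ℝ) - 1) / 2 ^ i) ((l : ℝ) / 2 ^ i), gap g x ≤ 20 * L / 2 ^ i :=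
    exists_congr fun x => and_congr_right fun hx => by
      rw [gap_congr fun a => h a x ⟨hl0.trans hx.1, hx.2.trans hr⟩]
  have e2 : ∀ a, f a ((l : ℝ) / 2 ^ i) = g a ((l : ℝ) / 2 ^ i) := fun a =>
    h a _ ⟨by positivity, hr⟩
  simp only [e1, e2, optReward_congr e2]

lemma regretRate_congr {T : ℕ} {L σ : ℝ} (h : ∀ a, ∀ y ∈ Set.Icc (0 : ℝ) 1, f a y = g a y) :
    regretRate K T L σ f = regretRate K T L σ g := by
  simp only [regretRate, nearOptCount_congr h]

/-- The mean rewards, extended constantly outside `[0, 1]`. -/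
def extend (f : Fin K → ℝ → ℝ) (a : Fin K) : ℝ → ℝ :=
  Set.IccExtend zero_le_one (Set.domRestrict (Set.Icc (0 : ℝ) 1) (f a))

lemma extend_of_mem (f : Fin K → ℝ → ℝ) (a : Fin K) {y : ℝ} (hy : y ∈ Set.Icc (0 : ℝ) 1) :
    f a y = extend f a y := by
  rw [extend, Set.IccExtend_of_mem _ _ hy]
  rfl

lemma Regular.extend {L : ℝ} (hf : Regular L f) : Regular L (extend f) := by
  constructor
  · intro a x hx
    rw [← extend_of_mem f a hx]
    exact hf.bdd a x hx
  · intro a x hx y hy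
    rw [← extend_of_mem f a hx, ← extend_of_mem f a hy]
    exact hf.lip a x hx y hy

/-- Nothing is assumed about the rewards outside [0, 1]; the constant extension is continuous. -/
lemma Regular.measurable_extend {L : ℝ} (hL : 0 ≤ L) (hf : Regular L f) (a : Fin K) :
    Measurable (ApproxZooming.extend f a) := by
  have h : LipschitzOnWith (Real.toNNReal L) (f a) (Set.Icc 0 1) := by
    refine LipschitzOnWith.of_dist_le_mul fun x hx y hy => ?_
    rw [Real.coe_toNNReal _ hL, Real.dist_eq, Real.dist_eq]
    exact hf.lip a x hx y hy
  exact (Continuous.Icc_extend' h.continuousOn.domRestrict).measurable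

/-- `HasLaw` provides almost everywhere measurability only; changing the variables on null sets
keeps their laws and their independence. -/
lemma exists_sampling [IsProbabilityMeasure P] {v : NNReal} {x ε : ℕ → Ω → ℝ}
    (hx : ∀ t, HasLaw (x t) (volume.restrict (Set.Icc (0 : ℝ) 1)) P)
    (hε : ∀ t, HasLaw (ε t) (gaussianReal 0 v) P)
    (hi : iIndepFun (fun i : ℕ ⊕ ℕ => Sum.elim x ε i) P) :
    ∃ x' ε' : ℕ → Ω → ℝ, Sampling P v x' ε' ∧ ∀ᵐ ω ∂P, ∀ t, x t ω = x' t ω ∧ ε t ω = ε' t ω := by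
  refine ⟨fun t => (hx t).aemeasurable.mk, fun t => (hε t).aemeasurable.mk,
    ⟨fun t => (hx t).aemeasurable.measurable_mk, fun t => (hε t).aemeasurable.measurable_mk,
      fun t => ?_, fun t => ?_, ?_⟩, ?_⟩
  · exact (Measure.map_congr (hx t).aemeasurable.ae_eq_mk.symm).trans (hx t).map_eq
  · exact (Measure.map_congr (hε t).aemeasurable.ae_eq_mk.symm).trans (hε t).map_eq
  · refine hi.congr fun i => ?_
    rcases i with t | t
    · exact (hx t).aemeasurable.ae_eq_mk
    · exact (hε t).aemeasurable.ae_eq_mk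
  · rw [ae_all_iff]
    intro t
    filter_upwards [(hx t).aemeasurable.ae_eq_mk, (hε t).aemeasurable.ae_eq_mk] with ω h1 h2
    exact ⟨h1, h2⟩

end

end ApproxZooming

theorem theorem1 :
    ∃ C : ℝ, 0 < C ∧
      ∀ (K T : ℕ) (L σ : ℝ) (f : Fin K → ℝ → ℝ) (R : ApproxZooming.Rules K),
        2 ≤ T * K → 0 < L → 0 < σ →
        (∀ a, ∀ x ∈ Set.Icc (0 : ℝ) 1, f a x ∈ Set.Icc (0 : ℝ) 1) →
        (∀ a, ∀ x ∈ Set.Icc (0 : ℝ) 1, ∀ y ∈ Set.Icc (0 : ℝ) 1,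
          |f a x - f a y| ≤ L * |x - y|) →
        ∀ (Ω : Type*) [MeasurableSpace Ω] (P : Measure Ω) [IsProbabilityMeasure P]
          (x ε : ℕ → Ω → ℝ),
          (∀ t, HasLaw (x t) (volume.restrict (Set.Icc (0 : ℝ) 1)) P) →
          (∀ t, HasLaw (ε t) (gaussianReal 0 (Real.toNNReal (σ ^ 2))) P) →
          iIndepFun (fun i : ℕ ⊕ ℕ => Sum.elim x ε i) P →
          Integrable (fun ω => ApproxZooming.regret ⟨T, L, σ⟩ R f
            (fun t => x t ω) (fun t => ε t ω)) P ∧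
          ∫ ω, ApproxZooming.regret ⟨T, L, σ⟩ R f (fun t => x t ω) (fun t => ε t ω) ∂P
            ≤ C * max 1 (L ^ 2 / (σ ^ 2 * Real.log (T * K)))
              * ApproxZooming.regretRate K T L σ f := by
  refine ⟨5e8, by norm_num, ?_⟩
  intro K T L σ f R hTK hL hσ hbdd hlip Ω _ P _ x ε hx hε hi
  obtain ⟨x', ε', hs, hae⟩ := ApproxZooming.exists_sampling hx hε hi
  have hf : ApproxZooming.Regular L f := ⟨hbdd, hlip⟩
  have hfm := hf.measurable_extend hL.le
  have hK1 : 1 ≤ K := Nat.pos_of_ne_zero fun h => by simp [h] at hTK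
  have : Nonempty (Fin K) := Fin.pos_iff_nonempty.1 hK1
  -- Almost surely all contexts lie in [0, 1], so neither replacement affects the regret.
  have heq : (fun ω => ApproxZooming.regret ⟨T, L, σ⟩ R f (fun t => x t ω) (fun t => ε t ω)) =ᵐ[P]
      fun ω => ApproxZooming.regret ⟨T, L, σ⟩ R (ApproxZooming.extend f)
        (fun t => x' t ω) (fun t => ε' t ω) := by
    filter_upwards [hae, ae_all_iff.2 hs.ae_mem] with ω h1 h2
    simp only [fun t => (h1 t).1, fun t => (h1 t).2]
    exact ApproxZooming.regret_congr fun a t => ApproxZooming.extend_of_mem f a (h2 t)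
  refine ⟨(ApproxZooming.integrable_regret hs hf.extend hfm).congr heq.symm, ?_⟩
  rw [integral_congr_ae heq,
    ApproxZooming.regretRate_congr fun a y hy => ApproxZooming.extend_of_mem f a hy]
  exact hs.regret_bound (p := ⟨T, L, σ⟩) (Real.toNNReal_pos.2 (by positivity))
    (Real.coe_toNNReal _ (by positivity)) hTK hL hσ hf.extend hfm
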